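/- Let $V:\mathbb R^3\to\mathbb R$ be a measurable real-valued potential with $V\in L^{3/2}(\mathbb R^3)$ and global Kato norm $$\|V\|_{\mathcal K}:=\sup_{y\in\mathbb R^3}\int_{\mathbb R^3}\frac{|V(x)|}{|x-y|}\,dx<4\pi .$$ Let $H=-\Delta+V$ on the complex Hilbert space $L^2(\mathbb R^3)$ be the operator associated with the quadratic form $q(u,\varphi)=\int\nabla u\cdot\overline{\nabla\varphi}\,dx+\int Vu\,\overline\varphi\,dx$ on the form domain $\{u\in H^1(\mathbb R^3): V|u|^2\in L^1\}$: that is, $u\in\mathrm{Dom}(H)$ and $Hu=h$ if and only if $u$ lies in the form domain, $h\in L^2$, and $q(u,\varphi)=\int h\,\overline\varphi\,dx$ for all $\varphi$ in the form domain. Then $H$ is self-adjoint and nonnegative, and, with $\frac{\sin(t\sqrt H)}{\sqrt H}=\int_{[0,\infty)}\frac{\sin(t\sqrt\lambda)}{\sqrt\lambda}\,E(d\lambda)$ defined by the spectral resolution $E$ of $H$ (the integrand being $t$ at $\lambda=0$), there is a constant $C>0$, depending only on $V$, such that $$\Big\|\frac{\sin(t\sqrt H)}{\sqrt H}f\Big\|_{L^\infty(\mathbb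 R^3)}\le C\,t^{-1}\,\|\nabla f\|_{L^1(\mathbb R^3)}$$ for all $t>0$ and all $f\in L^2(\mathbb R^3)$ whose distributional gradient $\nabla f$ is a locally integrable function (the right-hand side being $+\infty$ if $\nabla f\notin L^1$). -/

import Mathlib

open MeasureTheory ENNReal
open scoped ContDiff ComplexConjugate

noncomputable section

/-- Three-dimensional Euclidean space. -/
abbrev E3 : Type := EuclideanSpace ℝ (Fin 3)

/-- Complex vectors with three components (values of gradients of complex functions). -/
abbrev C3 : Type := EuclideanSpace ℂ (Fin 3)

/-- The complex Hilbert space `L²(ℝ³)`. -/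
abbrev L2 : Type := Lp ℂ 2 (volume : Measure E3)

/-- The complex Hilbert space `L²(ℝ³; ℂ³)`. -/
abbrev L2vec : Type := Lp C3 2 (volume : Measure E3)

/-- The global Kato norm `sup_y ∫ |V(x)| / |x - y| dx`. -/
def katoNorm (V : E3 → ℝ) : ℝ≥0∞ :=
  ⨆ y : E3, ∫⁻ x, ‖V x‖ₑ / ‖x - y‖ₑ

/-- `g` is the weak (distributional) gradient of `f`: both are locally integrable and
`∫ f ∂ᵢφ = - ∫ gᵢ φ` for all test functions `φ` and `i = 1, 2, 3`. -/
structure HasWeakGradient (f : E3 → ℂ) (g : E3 → C3) : Prop where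
  locInt : LocallyIntegrable f
  locInt_grad : LocallyIntegrable g
  integral_eq : ∀ φ : E3 → ℝ, ContDiff ℝ ∞ φ → HasCompactSupport φ → ∀ i : Fin 3,
    ∫ x, ((fderiv ℝ φ x (EuclideanSpace.single i 1) : ℝ) : ℂ) * f x
      = - ∫ x, (φ x : ℂ) * g x i

theorem HasWeakGradient.integrable_left {f : E3 → ℂ} {g : E3 → C3} (h : HasWeakGradient f g)
    {φ : E3 → ℝ} (hφ : ContDiff ℝ ∞ φ) (hc : HasCompactSupport φ) (i : Fin 3) :
    Integrable fun x => ((fderiv ℝ φ x (EuclideanSpace.single i 1) : ℝ) : ℂ) * f x := by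
  have h1 : Continuous fun x => fderiv ℝ φ x (EuclideanSpace.single i 1) :=
    (hφ.continuous_fderiv (by simp)).clm_apply continuous_const
  have h2 : HasCompactSupport fun x => fderiv ℝ φ x (EuclideanSpace.single i 1) :=
    hc.fderiv_apply (𝕜 := ℝ) _
  simpa using h.locInt.integrable_smul_left_of_hasCompactSupport h1 h2

theorem HasWeakGradient.integrable_right {f : E3 → ℂ} {g : E3 → C3} (h : HasWeakGradient f g)
    {φ : E3 → ℝ} (hφ : ContDiff ℝ ∞ φ) (hc : HasCompactSupport φ) (i : Fin 3) :
    Integrable fun x => (φ x : ℂ) * g x i := by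
  have h1 := h.locInt_grad.integrable_smul_left_of_hasCompactSupport hφ.continuous hc
  simpa using (EuclideanSpace.proj (𝕜 := ℂ) i).integrable_comp h1

theorem HasWeakGradient.add {f f' : E3 → ℂ} {g g' : E3 → C3} (h : HasWeakGradient f g)
    (h' : HasWeakGradient f' g') : HasWeakGradient (f + f') (g + g') where
  locInt := h.locInt.add h'.locInt
  locInt_grad := h.locInt_grad.add h'.locInt_grad
  integral_eq φ hφ hc i := by
    simp only [Pi.add_apply, PiLp.add_apply, mul_add]
    rw [integral_add (h.integrable_left hφ hc i) (h'.integrable_left hφ hc i),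
      integral_add (h.integrable_right hφ hc i) (h'.integrable_right hφ hc i),
      h.integral_eq φ hφ hc i, h'.integral_eq φ hφ hc i]
    ring

theorem HasWeakGradient.const_smul {f : E3 → ℂ} {g : E3 → C3} (c : ℂ)
    (h : HasWeakGradient f g) : HasWeakGradient (c • f) (c • g) where
  locInt := h.locInt.smul c
  locInt_grad := h.locInt_grad.smul c
  integral_eq φ hφ hc i := by
    simp only [Pi.smul_apply, PiLp.smul_apply, smul_eq_mul, mul_left_comm _ c]
    rw [integral_const_mul, integral_const_mul, h.integral_eq φ hφ hc i]
    ring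

theorem HasWeakGradient.congr {f f' : E3 → ℂ} {g g' : E3 → C3} (h : HasWeakGradient f g)
    (hf : f =ᵐ[volume] f') (hg : g =ᵐ[volume] g') : HasWeakGradient f' g' where
  locInt := h.locInt.congr hf
  locInt_grad := h.locInt_grad.congr hg
  integral_eq φ hφ hc i := by
    have e1 : ∫ x, ((fderiv ℝ φ x (EuclideanSpace.single i 1) : ℝ) : ℂ) * f' x
        = ∫ x, ((fderiv ℝ φ x (EuclideanSpace.single i 1) : ℝ) : ℂ) * f x :=
      integral_congr_ae (by filter_upwards [hf] with x hx; rw [hx])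
    have e2 : ∫ x, (φ x : ℂ) * g' x i = ∫ x, (φ x : ℂ) * g x i :=
      integral_congr_ae (by filter_upwards [hg] with x hx; rw [hx])
    rw [e1, e2, h.integral_eq φ hφ hc i]

/-- `u` lies in the form domain of `-Δ + V`, with weak gradient `G`: `u ∈ H¹(ℝ³)`, i.e.
`u ∈ L²` and `G = ∇u ∈ L²`, and `V |u|²` is integrable. -/
structure InFormDomain (V : E3 → ℝ) (u : L2) (G : L2vec) : Prop where
  grad : HasWeakGradient u G
  pot : Integrable fun x => V x * ‖u x‖ ^ 2

theorem InFormDomain.integrable_cross {V : E3 → ℝ} {u φ : L2} {G K : L2vec}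
    (hu : InFormDomain V u G) (hφ : InFormDomain V φ K) :
    Integrable fun x => (V x : ℂ) * (conj (φ x) * u x) := by
  have hum : AEStronglyMeasurable (fun x => u x) volume := Lp.aestronglyMeasurable u
  have hφm : AEStronglyMeasurable (fun x => φ x) volume := Lp.aestronglyMeasurable φ
  have hmeas : AEStronglyMeasurable (fun x => (V x : ℂ) * (conj (φ x) * u x)) volume := by
    have h1 : AEStronglyMeasurable (fun x => ((V x * ‖u x‖ ^ 2 : ℝ) : ℂ)) volume :=
      Complex.continuous_ofReal.comp_aestronglyMeasurable hu.pot.aestronglyMeasurable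
    have h2 : AEStronglyMeasurable
        (fun x => conj (φ x) * (u x / ((‖u x‖ ^ 2 : ℝ) : ℂ))) volume := by
      refine AEStronglyMeasurable.mul
        (Complex.continuous_conj.comp_aestronglyMeasurable hφm) ?_
      exact (hum.aemeasurable.div
        (Complex.measurable_ofReal.comp_aemeasurable
          (hum.norm.aemeasurable.pow_const 2))).aestronglyMeasurable
    refine (h1.mul h2).congr (Filter.Eventually.of_forall fun x => ?_)
    by_cases h0 : u x = 0
    · simp [h0]
    · have h0' : ((‖u x‖ : ℝ) : ℂ) ≠ 0 := by simpa using h0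
      simp only [Pi.mul_apply]
      push_cast
      field_simp
  refine Integrable.mono' (hu.pot.norm.add hφ.pot.norm) hmeas
    (Filter.Eventually.of_forall fun x => ?_)
  simp only [Pi.add_apply, norm_mul, norm_pow, norm_norm, Complex.norm_real, RCLike.norm_conj]
  have h1 := mul_nonneg (norm_nonneg (V x)) (sq_nonneg (‖u x‖ - ‖φ x‖))
  have h2 := mul_nonneg (norm_nonneg (V x)) (sq_nonneg ‖u x‖)
  have h3 := mul_nonneg (norm_nonneg (V x)) (sq_nonneg ‖φ x‖)
  nlinarith

theorem InFormDomain.add {V : E3 → ℝ} {u v : L2} {G K : L2vec}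
    (hu : InFormDomain V u G) (hv : InFormDomain V v K) :
    InFormDomain V (u + v) (G + K) where
  grad := (hu.grad.add hv.grad).congr (Lp.coeFn_add u v).symm (Lp.coeFn_add G K).symm
  pot := by
    refine ((hu.pot.add hv.pot).add ((hu.integrable_cross hv).re.const_mul 2)).congr ?_
    filter_upwards [Lp.coeFn_add u v] with x hx
    rw [hx]
    simp only [Pi.add_apply, ← Complex.normSq_eq_norm_sq, Complex.normSq_apply]
    simp
    ring

theorem InFormDomain.const_smul {V : E3 → ℝ} {u : L2} {G : L2vec} (c : ℂ)
    (hu : InFormDomain V u G) : InFormDomain V (c • u) (c • G) where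
  grad := (hu.grad.const_smul c).congr (Lp.coeFn_smul c u).symm (Lp.coeFn_smul c G).symm
  pot := by
    refine (hu.pot.const_mul (‖c‖ ^ 2)).congr ?_
    filter_upwards [Lp.coeFn_smul c u] with x hx
    rw [hx]
    simp only [Pi.smul_apply, smul_eq_mul, norm_mul]
    ring

theorem InFormDomain.zero (V : E3 → ℝ) : InFormDomain V 0 0 where
  grad := by
    refine HasWeakGradient.congr (f := 0) (g := 0) ⟨?_, ?_, ?_⟩
      (Lp.coeFn_zero ℂ 2 volume).symm (Lp.coeFn_zero C3 2 volume).symm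
    · exact (integrable_zero _ _ _).locallyIntegrable
    · exact (integrable_zero _ _ _).locallyIntegrable
    · intro φ _ _ i
      simp
  pot := by
    refine (integrable_zero E3 ℝ volume).congr ?_
    filter_upwards [Lp.coeFn_zero ℂ 2 (volume : Measure E3)] with x hx
    rw [hx]
    simp

/-- The graph of the operator associated with the quadratic form of `-Δ + V`: all pairs
`(u, h)` with `u` in the form domain, `h ∈ L²` and
`∫ ∇u · conj ∇φ + ∫ V u conj φ = ∫ h conj φ` for all `φ` in the form domain. -/
def schrodingerGraph (V : E3 → ℝ) : Submodule ℂ (L2 × L2) where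
  carrier := {p | ∃ G : L2vec, InFormDomain V p.1 G ∧
    ∀ (φ : L2) (K : L2vec), InFormDomain V φ K →
      inner ℂ K G + ∫ x, (V x : ℂ) * (conj (φ x) * p.1 x) = inner ℂ φ p.2}
  zero_mem' := by
    refine ⟨0, InFormDomain.zero V, fun φ K _ => ?_⟩
    rw [integral_eq_zero_of_ae]
    · simp
    · filter_upwards [Lp.coeFn_zero ℂ 2 (volume : Measure E3)] with x hx
      simp only [Prod.fst_zero, hx, Pi.zero_apply, mul_zero]
  add_mem' := by
    rintro ⟨u, h⟩ ⟨u', h'⟩ ⟨G, hG, hu⟩ ⟨G', hG', hu'⟩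
    refine ⟨G + G', hG.add hG', fun φ K hφ => ?_⟩
    have e : ∫ x, (V x : ℂ) * (conj (φ x) * (u + u' : L2) x)
        = (∫ x, (V x : ℂ) * (conj (φ x) * u x)) + ∫ x, (V x : ℂ) * (conj (φ x) * u' x) := by
      rw [← integral_add (hG.integrable_cross hφ) (hG'.integrable_cross hφ)]
      refine integral_congr_ae ?_
      filter_upwards [Lp.coeFn_add u u'] with x hx
      rw [hx, Pi.add_apply]
      ring
    have h1 := hu φ K hφ
    have h2 := hu' φ K hφ
    simp only [Prod.mk_add_mk] at h1 h2 ⊢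
    rw [e, inner_add_right, inner_add_right, ← h1, ← h2]
    ring
  smul_mem' := by
    rintro c ⟨u, h⟩ ⟨G, hG, hu⟩
    refine ⟨c • G, hG.const_smul c, fun φ K hφ => ?_⟩
    have e : ∫ x, (V x : ℂ) * (conj (φ x) * (c • u : L2) x)
        = c * ∫ x, (V x : ℂ) * (conj (φ x) * u x) := by
      rw [← integral_const_mul]
      refine integral_congr_ae ?_
      filter_upwards [Lp.coeFn_smul c u] with x hx
      rw [hx, Pi.smul_apply, smul_eq_mul]
      ring
    have h1 := hu φ K hφ
    simp only [Prod.smul_mk] at h1 ⊢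
    rw [e, inner_smul_right, inner_smul_right, ← h1]
    ring

/-- The Schrödinger operator `H = -Δ + V` on `L²(ℝ³)`, defined as a form sum. -/
def schrodinger (V : E3 → ℝ) : L2 →ₗ.[ℂ] L2 :=
  (schrodingerGraph V).toLinearPMap

section FunctionalCalculus

variable {X : Type*} [NormedAddCommGroup X] [InnerProductSpace ℂ X] [CompleteSpace X]

/-- The bounded operator `R` is the inverse `(A + 1)⁻¹` of the operator `A + 1`. -/
def IsShiftedInverse (A : X →ₗ.[ℂ] X) (R : X →L[ℂ] X) : Prop :=
  ∀ f u : X, R f = u ↔ ∃ h : u ∈ A.domain, A ⟨u, h⟩ + u = f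

open Classical in
/-- The operator `(A + 1)⁻¹`; it exists whenever `A` is self-adjoint and nonnegative. -/
def shiftedInverse (A : X →ₗ.[ℂ] X) : X →L[ℂ] X :=
  if h : ∃ R : X →L[ℂ] X, IsShiftedInverse A R then h.choose else 0

/-- The functional calculus `F ↦ F(A) = ∫ F(μ) E(dμ)` for a nonnegative self-adjoint operator `A`
with spectral resolution `E`, and for `F` continuous on `[0, ∞)` and tending to `0` at infinity.
With `R = (A + 1)⁻¹`, which is a bounded self-adjoint operator with spectrum in `[0, 1]`,
one has `A = R⁻¹ - 1`, and `F(A)` is the continuous function `r ↦ F(r⁻¹ - 1)`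
(with value `0 = F(∞)` at `r = 0`) of `R`. -/
def functionOf (F : ℝ → ℝ) (A : X →ₗ.[ℂ] X) : X →L[ℂ] X :=
  cfc (fun r : ℝ => if r = 0 then 0 else F (r⁻¹ - 1)) (shiftedInverse A)

end FunctionalCalculus

/-- The function `μ ↦ sin(t √μ) / √μ` on `[0, ∞)`, with its limit `t` at `μ = 0`. -/
def sineSymbol (t μ : ℝ) : ℝ :=
  if μ = 0 then t else Real.sin (t * √μ) / √μ

/-- The sine evolution `sin(t √H) / √H` for `H = -Δ + V`. -/
def sineEvolution (V : E3 → ℝ) (t : ℝ) : L2 →L[ℂ] L2 :=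
  functionOf (sineSymbol t) (schrodinger V)

end

/-! Write `κ < 1` for a bound on the Kato norm divided by 4π, so that ∫ |V(x)| / (4π|x-y|) dx ≤ κ
for every y. This smallness is used twice: it makes the potential a small form perturbation of -Δ,
and it makes the Born series of the wave equation converge geometrically.

Operator side. Let G_k(z) = e^{-k|z|} / (4π|z|) be the Yukawa kernel, the kernel of (-Δ + k²)⁻¹.
Schur's test applied to G_k, followed by k → 0, gives the Kato inequality ∫ |V||u|² ≤ κ ∫ |∇u|²
(`KatoBound.integral_le`). On the Hilbert space H¹ the potential term is then ⟨p, T q⟩ with ‖T‖ ≤ κ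
< 1, and inverting 1 + T produces R = (H + 1)⁻¹ with 0 ≤ R ≤ 1 (`KatoBound.exists_resolvent`).
Self-adjointness and nonnegativity of H are read off from R, and the sine evolution is a continuous
function of R.

Dispersive side. The Laplace transform in t of sin(t√H)/√H f is v = (H + k²)⁻¹ f
(`IsResolventOf.exists_laplace`). It satisfies v = G_k * f - G_k * (V v)
(`KatoBound.ae_resolvent_eq`), so it is the sum of a Born series in G_k and V
(`KatoBound.hasSum_integral_bornLaplace`). Since e^{-k|z|} is the Laplace image of a delay by |z|,
each term is the transform of an explicit retarded potential `born V g n`. The first of these is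
Kirchhoff's formula, t times the mean of f over the sphere of radius t about x, rewritten through
f(x + tω) = -∫_t^∞ ω·∇f(x + rω) dr as an integral of ∇f over |y - x| > t with a kernel of size t /
(4π|y - x|²) ≤ 1 / (4πt).

For the later terms, split t ≤ (t - |x - y|)₊ + |x - y|. The first summand falls under the induction
hypothesis and costs a factor κ; the second cancels the Newtonian kernel and leaves a quantity
bounded uniformly in time. By induction the n-th term is at most (n + 1) κⁿ / (4πt) times ‖∇f‖₁
(`mul_enorm_born_le`), and this is summable.

Finally, after pairing with a bounded function of bounded support, the evolution and the sum of the
series have the same Laplace transform at k = 1, 2, 3, ..., hence agree for almost every t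
(`ae_eq_zero_of_forall_integral_exp_pow`). Continuity in t gives the bound at every t > 0, and
duality of L¹ and L^∞ removes the test function. -/

noncomputable section

/-! ### Polar coordinates in ℝ³. -/

section PolarCoordinates

open Set Measure Metric

theorem finrank_E3 : Module.finrank ℝ E3 = 3 := by simp

theorem toSphere_real_univ_E3 :
    (volume : Measure E3).toSphere.real univ = 4 * Real.pi := by
  rw [toSphere_real_apply_univ, finrank_E3, Measure.real, EuclideanSpace.volume_ball_fin_three]
  rw [ENNReal.toReal_mul]
  simp [ENNReal.toReal_ofReal (show (0:ℝ) ≤ Real.pi * 4 / 3 by positivity)]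
  ring

/-- Integration in polar coordinates on `ℝ³`. -/
theorem integral_polar {F : E3 → ℝ} (hF : Integrable F) :
    ∫ x, F x = ∫ σ, (∫ r in Ioi (0 : ℝ), r ^ 2 * F (r • (σ : E3)))
      ∂(volume : Measure E3).toSphere := by
  have hmp := (volume : Measure E3).measurePreserving_homeomorphUnitSphereProd
  have hemb : MeasurableEmbedding (homeomorphUnitSphereProd E3) :=
    Homeomorph.measurableEmbedding _
  have hs : ∀ x : ({0}ᶜ : Set E3), ((homeomorphUnitSphereProd E3 x).2 : ℝ) •
      ((homeomorphUnitSphereProd E3 x).1 : E3) = x := by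
    intro x
    have hx : ‖(x : E3)‖ ≠ 0 := norm_ne_zero_iff.2 x.2
    simp [smul_smul, hx]
  have hint : Integrable (fun p : sphere (0 : E3) 1 × Ioi (0 : ℝ) => F ((p.2 : ℝ) • (p.1 : E3)))
      ((volume : Measure E3).toSphere.prod (volumeIoiPow (Module.finrank ℝ E3 - 1))) := by
    rw [← hmp.integrable_comp_emb hemb]
    simp only [Function.comp_def, hs]
    have : IntegrableOn F ({0}ᶜ : Set E3) := hF.integrableOn
    rwa [integrableOn_iff_comap_subtypeVal (by measurability)] at this
  calc ∫ x, F x = ∫ x : ({0}ᶜ : Set E3), F x ∂((volume : Measure E3).comap (↑)) := by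
        rw [integral_subtype_comap (measurableSet_singleton _).compl, restrict_compl_singleton]
    _ = ∫ p, F ((p.2 : ℝ) • (p.1 : E3))
        ∂((volume : Measure E3).toSphere.prod (volumeIoiPow (Module.finrank ℝ E3 - 1))) := by
        rw [← hmp.integral_comp hemb]
        simp only [hs]
    _ = _ := by
        rw [integral_prod _ hint]
        congr 1 with σ
        simp only [Measure.volumeIoiPow, ENNReal.ofReal, finrank_E3]
        rw [integral_withDensity_eq_integral_smul
            (measurable_subtype_coe.pow_const _).real_toNNReal,
          integral_subtype_comap measurableSet_Ioi
            fun a ↦ Real.toNNReal (a ^ (3 - 1)) • F (a • (σ : E3)),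
          setIntegral_congr_fun measurableSet_Ioi fun x hx ↦ ?_]
        rw [NNReal.smul_def, Real.coe_toNNReal _ (pow_nonneg hx.out.le _), smul_eq_mul]

end PolarCoordinates

/-! ### Kernels of size |z|⁻² and the divergence of radial fields. -/

section Kernels

open Set Metric

/-- The Jacobian r² of polar coordinates in dimension three cancels the singularity exactly. -/
theorem integrableOn_norm_sq_inv (R : ℝ) :
    IntegrableOn (fun z : E3 => (‖z‖ ^ 2)⁻¹) (ball 0 R) := by
  rw [integrableOn_fun_norm_addHaar (μ := volume) (f := fun r : ℝ => (r ^ 2)⁻¹), finrank_E3]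
  refine (integrableOn_const (C := (1 : ℝ)) (by simp)).congr_fun (fun r hr => ?_) measurableSet_Ioo
  have : r ≠ 0 := hr.1.ne'
  simp [this]

theorem locallyIntegrable_norm_sq_inv :
    LocallyIntegrable (fun z : E3 => (‖z‖ ^ 2)⁻¹) := by
  intro x
  refine ⟨ball 0 (‖x‖ + 1), isOpen_ball.mem_nhds (by simp), integrableOn_norm_sq_inv _⟩

/-- A measurable function bounded by `C |z|⁻²` is locally integrable on `ℝ³`. -/
theorem locallyIntegrable_of_norm_le_sq_inv {F : Type*} [NormedAddCommGroup F] {K : E3 → F}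
    (hm : AEStronglyMeasurable K volume) {C : ℝ} (hK : ∀ z, ‖K z‖ ≤ C * (‖z‖ ^ 2)⁻¹) :
    LocallyIntegrable K := by
  refine LocallyIntegrable.mono (f := fun z : E3 => C * (‖z‖ ^ 2)⁻¹) ?_ hm
    (Filter.Eventually.of_forall fun z => (hK z).trans (le_abs_self _))
  exact locallyIntegrable_norm_sq_inv.smul C

/-- The radial vector field `ψ(|z|) z / |z|³`. -/
def radialField (ψ : ℝ → ℝ) (z : E3) : E3 := (ψ ‖z‖ / ‖z‖ ^ 3) • z

theorem norm_radialField (ψ : ℝ → ℝ) (z : E3) :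
    ‖radialField ψ z‖ = |ψ ‖z‖| * (‖z‖ ^ 2)⁻¹ := by
  rw [radialField, norm_smul, Real.norm_eq_abs, abs_div, abs_of_nonneg (by positivity : 0 ≤ ‖z‖ ^ 3)]
  rcases eq_or_ne ‖z‖ 0 with h | h
  · simp [h]
  · field_simp

theorem norm_radialField_le {ψ : ℝ → ℝ} {C : ℝ} (h : ∀ r, 0 ≤ r → |ψ r| ≤ C) (z : E3) :
    ‖radialField ψ z‖ ≤ C * (‖z‖ ^ 2)⁻¹ := by
  rw [norm_radialField]
  exact mul_le_mul_of_nonneg_right (h _ (norm_nonneg _)) (by positivity)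

theorem measurable_radialField {ψ : ℝ → ℝ} (h : Measurable ψ) : Measurable (radialField ψ) := by
  unfold radialField
  exact ((h.comp measurable_norm).div (measurable_norm.pow_const 3)).smul measurable_id

/-- The divergence of `ψ(|z|) z / |z|³` is `ψ'(|z|) / |z|² + 4π ψ(0) δ`, tested against a
smooth function with compact support. -/
theorem integral_fderiv_radialField {ψ ψ' : ℝ → ℝ} {C : ℝ} (hψ : ∀ r, HasDerivAt ψ (ψ' r) r)
    (hψ' : Continuous ψ') (hC : ∀ r, 0 ≤ r → |ψ r| ≤ C) (hC' : ∀ r, 0 ≤ r → |ψ' r| ≤ C)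
    {η : E3 → ℝ} (hη : ContDiff ℝ 1 η) (hc : HasCompactSupport η) (x : E3) :
    ∫ z, fderiv ℝ η (x - z) (radialField ψ z)
      = (∫ z, η (x - z) * (ψ' ‖z‖ / ‖z‖ ^ 2)) + 4 * Real.pi * ψ 0 * η x := by
  have hψc : Continuous ψ := continuous_iff_continuousAt.2 fun r => (hψ r).continuousAt
  have hcx : HasCompactSupport fun z => η (x - z) :=
    hc.comp_homeomorph (Homeomorph.subLeft x)
  have hcx' : HasCompactSupport fun z => fderiv ℝ η (x - z) :=
    (hc.fderiv (𝕜 := ℝ)).comp_homeomorph (Homeomorph.subLeft x)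
  have hi2 : Integrable fun z => η (x - z) * (ψ' ‖z‖ / ‖z‖ ^ 2) := by
    have : LocallyIntegrable fun z : E3 => ψ' ‖z‖ / ‖z‖ ^ 2 := by
      refine locallyIntegrable_of_norm_le_sq_inv (C := C) ?_ fun z => ?_
      · exact ((hψ'.measurable.comp measurable_norm).div
          (measurable_norm.pow_const 2)).aestronglyMeasurable
      · rw [Real.norm_eq_abs, abs_div, div_eq_mul_inv, abs_of_nonneg (sq_nonneg ‖z‖)]
        exact mul_le_mul_of_nonneg_right (hC' _ (norm_nonneg _)) (by positivity)
    exact this.integrable_smul_left_of_hasCompactSupport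
      (hη.continuous.comp (continuous_const.sub continuous_id)) hcx
  have hi1 : Integrable fun z => fderiv ℝ η (x - z) (radialField ψ z) := by
    have hl : LocallyIntegrable (radialField ψ) :=
      locallyIntegrable_of_norm_le_sq_inv
        (measurable_radialField hψc.measurable).aestronglyMeasurable (norm_radialField_le hC)
    have hcont : Continuous fun z => fderiv ℝ η (x - z) :=
      (hη.continuous_fderiv (by simp)).comp (continuous_const.sub continuous_id)
    have h3 : Integrable fun z => ‖fderiv ℝ η (x - z)‖ • radialField ψ z :=
      hl.integrable_smul_left_of_hasCompactSupport hcont.norm hcx'.norm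
    refine h3.mono ?_ (Filter.Eventually.of_forall fun z => ?_)
    · exact (isBoundedBilinearMap_apply (𝕜 := ℝ) (E := E3) (F := ℝ)).continuous
        |>.comp_aestronglyMeasurable
          (hcont.aestronglyMeasurable.prodMk hl.aestronglyMeasurable)
    · rw [norm_smul, norm_norm]
      exact ContinuousLinearMap.le_opNorm _ _
  -- Along each ray the Jacobian r² cancels |z|⁻², and the integrand becomes -d/dr (η(x - rσ) ψ(r)).
  -- The boundary term at r = 0 is ψ(0) η(x) in every direction, and the sphere has area 4π.
  rw [← sub_eq_iff_eq_add', ← integral_sub hi1 hi2]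
  refine (integral_polar (hi1.sub hi2)).trans ?_
  simp only [Pi.sub_apply]
  have key : ∀ σ : sphere (0 : E3) 1, ∫ r in Ioi (0 : ℝ), r ^ 2 *
      (fderiv ℝ η (x - r • (σ : E3)) (radialField ψ (r • (σ : E3)))
        - η (x - r • (σ : E3)) * (ψ' ‖r • (σ : E3)‖ / ‖r • (σ : E3)‖ ^ 2)) = ψ 0 * η x := by
    intro σ
    have hσ : ‖(σ : E3)‖ = 1 := by simp
    have hd : ∀ r : ℝ, HasDerivAt (fun r : ℝ => η (x - r • (σ : E3)) * ψ r)
        (fderiv ℝ η (x - r • (σ : E3)) (-(σ : E3)) * ψ r + η (x - r • (σ : E3)) * ψ' r) r := by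
      intro r
      have h1 : HasDerivAt (fun r : ℝ => x - r • (σ : E3)) (-(σ : E3)) r := by
        simpa using ((hasDerivAt_id r).smul_const (σ : E3)).const_sub x
      have h2 := (hη.differentiable (by simp) (x - r • (σ : E3))).hasFDerivAt.comp_hasDerivAt r h1
      exact h2.mul (hψ r)
    have hemb : Topology.IsClosedEmbedding fun r : ℝ => x - r • (σ : E3) := by
      have : (σ : E3) ≠ 0 := norm_ne_zero_iff.1 (by simp)
      exact (Homeomorph.subLeft x).isClosedEmbedding.comp (isClosedEmbedding_smul_left this)
    have hcs : HasCompactSupport fun r : ℝ => η (x - r • (σ : E3)) :=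
      hc.comp_isClosedEmbedding hemb
    have hcs' : HasCompactSupport fun r : ℝ => fderiv ℝ η (x - r • (σ : E3)) :=
      (hc.fderiv (𝕜 := ℝ)).comp_isClosedEmbedding hemb
    have hline : Continuous fun r : ℝ => x - r • (σ : E3) := by fun_prop
    have hI : Integrable fun r : ℝ =>
        fderiv ℝ η (x - r • (σ : E3)) (-(σ : E3)) * ψ r + η (x - r • (σ : E3)) * ψ' r := by
      refine Integrable.add ?_ ?_
      · refine Continuous.integrable_of_hasCompactSupport ?_ ?_
        · exact (((hη.continuous_fderiv (by simp)).comp hline).clm_apply continuous_const).mul hψc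
        · refine HasCompactSupport.mul_right (hcs'.mono' ?_)
          intro r hr
          refine subset_closure ?_
          intro h0
          exact hr (by simp [h0])
      · exact ((hη.continuous.comp hline).mul hψ').integrable_of_hasCompactSupport hcs.mul_right
    have hT := integral_Ioi_of_hasDerivAt_of_tendsto (a := 0) (m := 0)
      (hd 0).continuousAt.continuousWithinAt (fun r _ => hd r) hI.integrableOn (by
        have := hcs.mul_right (f' := ψ)
        exact (this.is_zero_at_infty).mono_left (by rw [cocompact_eq_atBot_atTop]; exact le_sup_right))
    have : ∀ r ∈ Ioi (0 : ℝ), r ^ 2 *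
        (fderiv ℝ η (x - r • (σ : E3)) (radialField ψ (r • (σ : E3)))
        - η (x - r • (σ : E3)) * (ψ' ‖r • (σ : E3)‖ / ‖r • (σ : E3)‖ ^ 2))
        = -(fderiv ℝ η (x - r • (σ : E3)) (-(σ : E3)) * ψ r + η (x - r • (σ : E3)) * ψ' r) := by
      intro r hr
      have hr0 : (0 : ℝ) < r := hr
      have hn : ‖r • (σ : E3)‖ = r := by rw [norm_smul, hσ, mul_one, Real.norm_of_nonneg hr0.le]
      rw [radialField, hn, smul_smul, map_smul, map_neg, smul_eq_mul]
      field_simp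
      ring
    rw [setIntegral_congr_fun measurableSet_Ioi this, integral_neg, hT]
    simp [mul_comm]
  simp only [key, integral_const, toSphere_real_univ_E3, smul_eq_mul]
  ring

end Kernels

/-! ### Weak gradients tested without compact support. -/

section Cutoff

open Set Metric Filter Topology

/-- The weak gradient may be tested against smooth functions without compact support, provided
that all integrals converge. -/
theorem HasWeakGradient.integral_eq_of_integrable {f : E3 → ℂ} {g : E3 → C3}
    (h : HasWeakGradient f g) {η : E3 → ℝ} (hη : ContDiff ℝ ∞ η) (i : Fin 3)
    (h1 : Integrable fun x => ((fderiv ℝ η x (EuclideanSpace.single i 1) : ℝ) : ℂ) * f x)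
    (h2 : Integrable fun x => (η x : ℂ) * f x) (h3 : Integrable fun x => (η x : ℂ) * g x i) :
    ∫ x, ((fderiv ℝ η x (EuclideanSpace.single i 1) : ℝ) : ℂ) * f x
      = - ∫ x, (η x : ℂ) * g x i := by
  let χ : ContDiffBump (0 : E3) := ⟨1, 2, one_pos, one_lt_two⟩
  let e : E3 := EuclideanSpace.single i 1
  have hχ : ContDiff ℝ ∞ χ := χ.contDiff
  have hχc : Continuous fun x => fderiv ℝ χ x e :=
    (hχ.continuous_fderiv (by simp)).clm_apply continuous_const
  obtain ⟨C, hC⟩ : ∃ C, ∀ x, ‖fderiv ℝ χ x e‖ ≤ C :=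
    hχc.bounded_above_of_compact_support (χ.hasCompactSupport.fderiv_apply (𝕜 := ℝ) e)
  -- The cutoffs χ(c n • x) tend to 1 pointwise, while differentiating them brings out the factor c
  -- n → 0; the resulting extra term is dominated through `h2` and disappears in the limit.
  let c : ℕ → ℝ := fun n => ((n : ℝ) + 1)⁻¹
  have hc0 : ∀ n, c n ≠ 0 := fun n => by positivity
  have hcl : Tendsto c atTop (𝓝 0) := by
    simpa [c, one_div] using tendsto_one_div_add_atTop_nhds_zero_nat (𝕜 := ℝ)
  have hc1 : ∀ n, |c n| ≤ 1 := fun n => by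
    rw [abs_of_nonneg (by positivity)]
    exact inv_le_one_of_one_le₀ (by simp)
  let χn : ℕ → E3 → ℝ := fun n x => χ (c n • x)
  have hχn : ∀ n, ContDiff ℝ ∞ (χn n) := fun n => hχ.comp (contDiff_const_smul _)
  have hχns : ∀ n, HasCompactSupport (χn n) := fun n =>
    χ.hasCompactSupport.comp_homeomorph (Homeomorph.smulOfNeZero (c n) (hc0 n))
  have hfd : ∀ n x, fderiv ℝ (fun x => χn n x * η x) x e
      = χn n x * fderiv ℝ η x e + c n * fderiv ℝ χ (c n • x) e * η x := by
    intro n x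
    have d1 : HasFDerivAt (χn n) (c n • fderiv ℝ χ (c n • x)) x := by
      have := ((hχ.differentiable (by simp) (c n • x)).hasFDerivAt).comp x
        ((hasFDerivAt_id x).const_smul (c n))
      refine this.congr_fderiv ?_
      ext v
      simp
    have d2 := (hη.differentiable (by simp) x).hasFDerivAt
    rw [(d1.fun_mul d2).fderiv]
    simp
    ring
  have hlim : ∀ x, Tendsto (fun n => χn n x) atTop (𝓝 1) := by
    intro x
    have : Tendsto (fun n => c n • x) atTop (𝓝 0) := by simpa using hcl.smul_const x
    have h2 := (hχ.continuous.tendsto 0).comp this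
    have h3 : χ 0 = 1 := χ.one_of_mem_closedBall (by simp [χ])
    rw [h3] at h2
    exact h2
  have hb : ∀ n x, |χn n x| ≤ 1 := fun n x => by
    rw [abs_of_nonneg χ.nonneg]
    exact χ.le_one
  have hn : ∀ n, ∫ x, ((fderiv ℝ (fun x => χn n x * η x) x e : ℝ) : ℂ) * f x
      = - ∫ x, ((χn n x * η x : ℝ) : ℂ) * g x i := fun n =>
    h.integral_eq _ ((hχn n).mul hη) (hχns n).mul_right i
  have L : Tendsto (fun n => ∫ x, ((fderiv ℝ (fun x => χn n x * η x) x e : ℝ) : ℂ) * f x) atTop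
      (𝓝 (∫ x, ((fderiv ℝ η x e : ℝ) : ℂ) * f x)) := by
    refine tendsto_integral_of_dominated_convergence
      (fun x => ‖((fderiv ℝ η x e : ℝ) : ℂ) * f x‖ + C * ‖(η x : ℂ) * f x‖) (fun n => ?_)
      (h1.norm.add (h2.norm.const_mul C)) (fun n => Eventually.of_forall fun x => ?_)
      (Eventually.of_forall fun x => ?_)
    · exact (h.integrable_left ((hχn n).mul hη) (hχns n).mul_right i).aestronglyMeasurable
    · rw [hfd]
      have : ((χn n x * fderiv ℝ η x e + c n * fderiv ℝ χ (c n • x) e * η x : ℝ) : ℂ) * f x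
          = (χn n x : ℂ) * (((fderiv ℝ η x e : ℝ) : ℂ) * f x)
            + ((c n * fderiv ℝ χ (c n • x) e : ℝ) : ℂ) * ((η x : ℂ) * f x) := by
        push_cast; ring
      rw [this]
      refine (norm_add_le _ _).trans (add_le_add ?_ ?_)
      · rw [norm_mul, Complex.norm_real]
        exact mul_le_of_le_one_left (norm_nonneg _) (hb n x)
      · rw [norm_mul, Complex.norm_real, norm_mul]
        refine mul_le_mul_of_nonneg_right ?_ (norm_nonneg _)
        exact (mul_le_of_le_one_left (norm_nonneg _) (hc1 n)).trans (hC _)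
    · have t1 : Tendsto (fun n => c n * fderiv ℝ χ (c n • x) e * η x) atTop (𝓝 0) := by
        have hx0 : Tendsto (fun n => c n • x) atTop (𝓝 0) := by simpa using hcl.smul_const x
        have := (hcl.mul ((hχc.tendsto 0).comp hx0)).mul_const (η x)
        simpa using this
      have t2 := ((hlim x).mul_const (fderiv ℝ η x e)).add t1
      simp only [one_mul, add_zero] at t2
      simp only [hfd]
      exact ((Complex.continuous_ofReal.tendsto _).comp t2).mul_const (f x)
  have R : Tendsto (fun n => - ∫ x, ((χn n x * η x : ℝ) : ℂ) * g x i) atTop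
      (𝓝 (- ∫ x, (η x : ℂ) * g x i)) := by
    refine Tendsto.neg (tendsto_integral_of_dominated_convergence
      (fun x => ‖(η x : ℂ) * g x i‖) (fun n => ?_)
      h3.norm (fun n => Eventually.of_forall fun x => ?_) (Eventually.of_forall fun x => ?_))
    · exact (h.integrable_right ((hχn n).mul hη) (hχns n).mul_right i).aestronglyMeasurable
    · rw [Complex.ofReal_mul, mul_assoc, norm_mul, Complex.norm_real]
      exact mul_le_of_le_one_left (norm_nonneg _) (hb n x)
    · have t2 := (hlim x).mul_const (η x)
      rw [one_mul] at t2
      exact ((Complex.continuous_ofReal.tendsto _).comp t2).mul_const (g x i)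
  refine tendsto_nhds_unique L ?_
  simp only [hn]
  exact R

end Cutoff

/-! ### Quadratic decay of the |z|⁻² potential of a ball. -/

section KernelBounds

open Set Metric

theorem integrableOn_norm_sub_sq_inv (x : E3) (ρ : ℝ) :
    IntegrableOn (fun y : E3 => (‖y - x‖ ^ 2)⁻¹) (ball 0 ρ) := by
  have h := (integrableOn_norm_sq_inv (ρ + ‖x‖)).integrable_indicator measurableSet_ball
  have h2 := h.comp_sub_right x
  refine (h2.integrableOn (s := ball 0 ρ)).congr_fun (fun y hy => ?_) measurableSet_ball
  rw [mem_ball_zero_iff] at hy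
  have : y - x ∈ ball (0 : E3) (ρ + ‖x‖) := by
    rw [mem_ball_zero_iff]
    linarith [norm_sub_le y x]
  simp only [indicator_of_mem this]

/-- The potential `∫ |y - x|⁻² dy` of a ball decays quadratically. -/
theorem exists_setIntegral_norm_sub_sq_inv_le {ρ : ℝ} (hρ : 0 < ρ) :
    ∃ C, 0 ≤ C ∧ ∀ x : E3, ∫ y in ball (0 : E3) ρ, (‖y - x‖ ^ 2)⁻¹ ≤ C * ((1 + ‖x‖) ^ 2)⁻¹ := by
  obtain ⟨A, hA⟩ : ∃ A, A = ∫ z in ball (0 : E3) (3 * ρ), (‖z‖ ^ 2)⁻¹ := ⟨_, rfl⟩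
  have hA0 : 0 ≤ A := hA ▸ setIntegral_nonneg measurableSet_ball fun z _ => by positivity
  obtain ⟨v, hv⟩ : ∃ v, v = (volume : Measure E3).real (ball (0 : E3) ρ) := ⟨_, rfl⟩
  have hv0 : 0 ≤ v := hv ▸ measureReal_nonneg
  refine ⟨A * (1 + 2 * ρ) ^ 2 + v * (2 * (1 + 2 * ρ) / (2 * ρ)) ^ 2, by positivity, fun x => ?_⟩
  have hx1 : 0 < 1 + ‖x‖ := by positivity
  -- For |x| ≤ 2ρ the difference y - x stays in the ball of radius 3ρ, which gives the constant `A`;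
  -- for |x| ≥ 2ρ one has |y - x| ≥ |x| / 2, which gives the volume term.
  rcases le_total ‖x‖ (2 * ρ) with hx | hx
  · have h1 : ∫ y in ball (0 : E3) ρ, (‖y - x‖ ^ 2)⁻¹ ≤ A := by
      have h := (integrableOn_norm_sq_inv (3 * ρ)).integrable_indicator measurableSet_ball
      have h2 := h.comp_sub_right x
      rw [hA, ← integral_indicator measurableSet_ball, ← integral_indicator measurableSet_ball,
        ← integral_sub_right_eq_self (fun z => (ball (0 : E3) (3 * ρ)).indicator
          (fun z => (‖z‖ ^ 2)⁻¹) z) x]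
      refine integral_mono ((integrableOn_norm_sub_sq_inv x ρ).integrable_indicator
        measurableSet_ball) h2 fun y => ?_
      by_cases hy : y ∈ ball (0 : E3) ρ
      · have : y - x ∈ ball (0 : E3) (3 * ρ) := by
          rw [mem_ball_zero_iff] at hy ⊢
          linarith [norm_sub_le y x]
        simp only [indicator_of_mem hy, indicator_of_mem this, le_refl]
      · rw [indicator_of_notMem hy]
        exact indicator_nonneg (fun z _ => by positivity) _
    have h2 : 1 ≤ (1 + 2 * ρ) ^ 2 * ((1 + ‖x‖) ^ 2)⁻¹ := by
      rw [← div_eq_mul_inv, one_le_div (by positivity)]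
      exact pow_le_pow_left₀ hx1.le (by linarith) 2
    have h3 := mul_le_mul_of_nonneg_left h2 hA0
    have h4 : 0 ≤ v * (2 * (1 + 2 * ρ) / (2 * ρ)) ^ 2 * ((1 + ‖x‖) ^ 2)⁻¹ := by positivity
    linarith
  · have hx0 : 0 < ‖x‖ := by linarith
    have h1 : ∫ y in ball (0 : E3) ρ, (‖y - x‖ ^ 2)⁻¹
        ≤ ∫ y in ball (0 : E3) ρ, ((‖x‖ / 2) ^ 2)⁻¹ := by
      refine setIntegral_mono_on (integrableOn_norm_sub_sq_inv x ρ) ?_ measurableSet_ball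
        fun y hy => ?_
      · exact integrableOn_const measure_ball_lt_top.ne
      · rw [mem_ball_zero_iff] at hy
        have h2 : ‖x‖ / 2 ≤ ‖y - x‖ := by
          have := norm_sub_norm_le x y
          rw [norm_sub_rev] at this
          linarith
        exact inv_anti₀ (by positivity) (pow_le_pow_left₀ (by positivity) h2 2)
    rw [setIntegral_const, smul_eq_mul, ← hv] at h1
    refine h1.trans ?_
    have h3 : ((‖x‖ / 2) ^ 2)⁻¹ ≤ (2 * (1 + 2 * ρ) / (2 * ρ)) ^ 2 * ((1 + ‖x‖) ^ 2)⁻¹ := by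
      rw [← inv_pow, ← inv_pow, ← mul_pow]
      refine pow_le_pow_left₀ (by positivity) ?_ 2
      rw [inv_div, ← div_eq_mul_inv, div_div, div_le_div_iff₀ hx0 (by positivity)]
      nlinarith
    have h4 := mul_le_mul_of_nonneg_left h3 hv0
    have h5 : 0 ≤ A * (1 + 2 * ρ) ^ 2 * ((1 + ‖x‖) ^ 2)⁻¹ := by positivity
    linarith

end KernelBounds

/-! ### Real vectors inside ℂ³. -/

section Complexification

/-- A real vector, regarded as a complex vector. -/
def cplx (z : E3) : C3 := WithLp.toLp 2 fun i => (z i : ℂ)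

theorem cplx_apply (z : E3) (i : Fin 3) : cplx z i = (z i : ℂ) := rfl

theorem norm_cplx (z : E3) : ‖cplx z‖ = ‖z‖ := by
  simp [EuclideanSpace.norm_eq, cplx_apply]

theorem continuous_cplx : Continuous cplx := by
  unfold cplx
  fun_prop

theorem inner_cplx (z : E3) (w : C3) : inner ℂ (cplx z) w = ∑ i, (z i : ℂ) * w i := by
  simp [PiLp.inner_apply, cplx_apply, mul_comm]

theorem norm_inner_cplx_le (z : E3) (w : C3) : ‖(inner ℂ (cplx z) w : ℂ)‖ ≤ ‖z‖ * ‖w‖ := by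
  simpa [norm_cplx] using norm_inner_le_norm (𝕜 := ℂ) (cplx z) w

end Complexification

/-! ### The weight (1 + |y|)⁻² and absolute convergence of double integrals. -/

section Decay

open Set Metric

/-- The weight `(1 + |y|)⁻²`. -/
def decay (y : E3) : ℝ := ((1 + ‖y‖) ^ 2)⁻¹

theorem decay_pos (y : E3) : 0 < decay y := by
  unfold decay
  positivity

theorem decay_le_one (y : E3) : decay y ≤ 1 := by
  refine inv_le_one_of_one_le₀ (one_le_pow₀ ?_)
  linarith [norm_nonneg y]

theorem continuous_decay : Continuous decay := by
  unfold decay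
  exact Continuous.inv₀ (by fun_prop) fun y => by positivity

/-- The square is (1 + |y|)⁻⁴, integrable since 4 > 3. One weight thus serves both classes of
functions that occur: L² functions by Cauchy–Schwarz, and L¹ functions because the weight is
bounded. -/
theorem memLp_decay : MemLp decay 2 (volume : Measure E3) := by
  rw [memLp_two_iff_integrable_sq continuous_decay.aestronglyMeasurable]
  have h := integrable_one_add_norm (μ := (volume : Measure E3)) (r := 4) (by
    rw [finrank_E3]; norm_num)
  refine h.congr (Filter.Eventually.of_forall fun x => ?_)
  have h0 : 0 ≤ 1 + ‖x‖ := by positivity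
  simp only [decay]
  rw [Real.rpow_neg h0, inv_pow, ← pow_mul]
  norm_cast

theorem integrable_decay_mul_of_memLp {F : Type*} [NormedAddCommGroup F] {w : E3 → F}
    (hw : MemLp w 2 (volume : Measure E3)) : Integrable fun y => decay y * ‖w y‖ :=
  memLp_decay.integrable_mul hw.norm

theorem integrable_decay_mul_of_integrable {F : Type*} [NormedAddCommGroup F] {w : E3 → F}
    (hw : Integrable w) : Integrable fun y => decay y * ‖w y‖ := by
  refine hw.norm.mono (continuous_decay.aestronglyMeasurable.mul hw.aestronglyMeasurable.norm)
    (Filter.Eventually.of_forall fun y => ?_)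
  rw [norm_mul, Real.norm_of_nonneg (decay_pos y).le]
  exact mul_le_of_le_one_left (norm_nonneg _) (decay_le_one y)

theorem integrable_indicator_kernel {h : E3 → ℝ} (hm : AEStronglyMeasurable h) {M ρ : ℝ}
    (hM : ∀ x, |h x| ≤ M) (hs : ∀ x, ρ ≤ ‖x‖ → h x = 0) (y : E3) :
    Integrable fun x => h x * (‖y - x‖ ^ 2)⁻¹ := by
  have h1 := ((integrableOn_norm_sub_sq_inv y ρ).integrable_indicator measurableSet_ball).const_mul M
  refine h1.mono' ?_ (Filter.Eventually.of_forall fun x => ?_)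
  · refine hm.mul ?_
    exact (((measurable_const.sub measurable_id).norm.pow_const 2).inv).aestronglyMeasurable
  · by_cases hx : x ∈ ball (0 : E3) ρ
    · rw [indicator_of_mem hx, norm_mul, norm_sub_rev, Real.norm_of_nonneg
        (by positivity : 0 ≤ (‖x - y‖ ^ 2)⁻¹)]
      exact mul_le_mul_of_nonneg_right (hM x) (by positivity)
    · rw [hs x (by simpa using hx), indicator_of_notMem hx]
      simp

/-- The kernel `|y - x|⁻²` maps bounded functions with bounded support to functions of
size `O((1 + |y|)⁻²)`. -/
theorem exists_integral_kernel_le {h : E3 → ℝ} (hm : AEStronglyMeasurable h) {M ρ : ℝ}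
    (hM : ∀ x, |h x| ≤ M) (hs : ∀ x, ρ ≤ ‖x‖ → h x = 0) :
    ∃ C, 0 ≤ C ∧ ∀ y : E3, ∫ x, ‖h x * (‖y - x‖ ^ 2)⁻¹‖ ≤ C * decay y := by
  obtain ⟨C, hC0, hC⟩ := exists_setIntegral_norm_sub_sq_inv_le (ρ := max ρ 1) (by positivity)
  have hM0 : 0 ≤ M := (abs_nonneg _).trans (hM 0)
  refine ⟨M * C, by positivity, fun y => ?_⟩
  calc ∫ x, ‖h x * (‖y - x‖ ^ 2)⁻¹‖
      ≤ ∫ x, M * (ball (0 : E3) (max ρ 1)).indicator (fun x => (‖x - y‖ ^ 2)⁻¹) x := by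
        refine integral_mono (integrable_indicator_kernel hm hM hs y).norm
          (((integrableOn_norm_sub_sq_inv y _).integrable_indicator measurableSet_ball).const_mul M)
          fun x => ?_
        by_cases hx : x ∈ ball (0 : E3) (max ρ 1)
        · simp only [indicator_of_mem hx, norm_mul]
          rw [norm_sub_rev, Real.norm_of_nonneg (by positivity : 0 ≤ (‖x - y‖ ^ 2)⁻¹)]
          exact mul_le_mul_of_nonneg_right (hM x) (by positivity)
        · have hx' : ρ ≤ ‖x‖ := by
            rw [mem_ball_zero_iff, not_lt] at hx
            exact (le_max_left _ _).trans hx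
          simp [hs x hx', indicator_of_notMem hx]
    _ = M * ∫ x in ball (0 : E3) (max ρ 1), (‖x - y‖ ^ 2)⁻¹ := by
        rw [integral_const_mul, integral_indicator measurableSet_ball]
    _ ≤ M * (C * decay y) := mul_le_mul_of_nonneg_left (hC y) hM0
    _ = _ := by ring

/-- Integrating in x first leaves a multiple of `decay y` by `exists_integral_kernel_le`, so the
weighted integrability of `w` is just what Fubini needs. -/
theorem integrable_prod_kernel {h w : E3 → ℝ} (hm : AEStronglyMeasurable h) {M ρ : ℝ}
    (hM : ∀ x, |h x| ≤ M) (hs : ∀ x, ρ ≤ ‖x‖ → h x = 0) (hwm : AEStronglyMeasurable w)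
    (hw : Integrable fun y => decay y * ‖w y‖) :
    Integrable (fun p : E3 × E3 => h p.1 * (‖p.2 - p.1‖ ^ 2)⁻¹ * w p.2)
      (volume.prod volume) := by
  obtain ⟨C, hC0, hC⟩ := exists_integral_kernel_le hm hM hs
  have hme : AEStronglyMeasurable (fun p : E3 × E3 => h p.1 * (‖p.2 - p.1‖ ^ 2)⁻¹ * w p.2)
      (volume.prod volume) := by
    refine (hm.comp_fst.mul ?_).mul hwm.comp_snd
    exact (((measurable_snd.sub measurable_fst).norm.pow_const 2).inv).aestronglyMeasurable
  rw [integrable_prod_iff' hme]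
  refine ⟨Filter.Eventually.of_forall fun y =>
    (integrable_indicator_kernel hm hM hs y).mul_const (w y), ?_⟩
  refine (hw.const_mul C).mono' hme.norm.prod_swap.integral_prod_right'
    (Filter.Eventually.of_forall fun y => ?_)
  rw [Real.norm_of_nonneg (integral_nonneg fun x => norm_nonneg _)]
  simp only [norm_mul _ (w y)]
  rw [integral_mul_const, ← mul_assoc]
  exact mul_le_mul_of_nonneg_right (hC y) (norm_nonneg _)

/-- Absolute convergence of `∫∫ h(x) K(y - x) w(y)` for kernels with `|K(z)| ≤ C |z|⁻²`. -/
theorem integrable_prod_of_norm_le {F : Type*} [NormedAddCommGroup F] {Q : E3 × E3 → F}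
    {h w : E3 → ℝ} (hm : AEStronglyMeasurable h) {M ρ C : ℝ}
    (hM : ∀ x, |h x| ≤ M) (hs : ∀ x, ρ ≤ ‖x‖ → h x = 0) (hwm : AEStronglyMeasurable w)
    (hw : Integrable fun y => decay y * ‖w y‖)
    (hQ : AEStronglyMeasurable Q (volume.prod volume))
    (hQb : ∀ p, ‖Q p‖ ≤ C * (h p.1 * (‖p.2 - p.1‖ ^ 2)⁻¹ * w p.2)) :
    Integrable Q (volume.prod volume) :=
  ((integrable_prod_kernel hm hM hs hwm hw).const_mul C).mono' hQ
    (Filter.Eventually.of_forall hQb)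

end Decay

/-! ### Fubini for potentials with kernels of size |z|⁻². -/

section Potentials

open Set Metric

variable {F : Type*} [NormedAddCommGroup F] {Q : E3 × E3 → ℂ} {w : E3 → F} {C : ℝ}

/-- `Q` stands for a kernel already applied to `w`, scalar or vector valued; only its size |y - x|⁻²
|w(y)| matters. Both sides of an integration by parts are then handled by the same lemmas. -/
theorem integrable_mul_potential (hQ : AEStronglyMeasurable Q (volume.prod volume))
    (hwm : AEStronglyMeasurable w) (hw : Integrable fun y => decay y * ‖w y‖)
    (hb : ∀ p, ‖Q p‖ ≤ C * ((‖p.2 - p.1‖ ^ 2)⁻¹ * ‖w p.2‖))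
    {h : E3 → ℂ} (hm : AEStronglyMeasurable h) {M ρ : ℝ}
    (hM : ∀ x, ‖h x‖ ≤ M) (hs : ∀ x, ρ ≤ ‖x‖ → h x = 0) :
    Integrable (fun p : E3 × E3 => h p.1 * Q p) (volume.prod volume) := by
  refine integrable_prod_of_norm_le (h := fun x => ‖h x‖) (w := fun y => ‖w y‖) (M := M) (ρ := ρ)
    (C := C) hm.norm (by simpa using hM) (fun x hx => by simp [hs x hx]) hwm.norm
    (by simpa using hw) (hm.comp_fst.mul hQ) fun p => ?_
  rw [norm_mul]
  refine (mul_le_mul_of_nonneg_left (hb p) (norm_nonneg _)).trans (le_of_eq (by ring))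

theorem integral_mul_potential (hQ : AEStronglyMeasurable Q (volume.prod volume))
    (hwm : AEStronglyMeasurable w) (hw : Integrable fun y => decay y * ‖w y‖)
    (hb : ∀ p, ‖Q p‖ ≤ C * ((‖p.2 - p.1‖ ^ 2)⁻¹ * ‖w p.2‖))
    {h : E3 → ℂ} (hm : AEStronglyMeasurable h) {M ρ : ℝ}
    (hM : ∀ x, ‖h x‖ ≤ M) (hs : ∀ x, ρ ≤ ‖x‖ → h x = 0) :
    ∫ x, h x * ∫ y, Q (x, y) = ∫ y, ∫ x, h x * Q (x, y) := by
  rw [← integral_integral_swap (integrable_mul_potential hQ hwm hw hb hm hM hs)]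
  simp only [integral_const_mul]

theorem integrable_mul_integral_potential (hQ : AEStronglyMeasurable Q (volume.prod volume))
    (hwm : AEStronglyMeasurable w) (hw : Integrable fun y => decay y * ‖w y‖)
    (hb : ∀ p, ‖Q p‖ ≤ C * ((‖p.2 - p.1‖ ^ 2)⁻¹ * ‖w p.2‖))
    {h : E3 → ℂ} (hm : AEStronglyMeasurable h) {M ρ : ℝ}
    (hM : ∀ x, ‖h x‖ ≤ M) (hs : ∀ x, ρ ≤ ‖x‖ → h x = 0) :
    Integrable fun x => h x * ∫ y, Q (x, y) := by
  have := (integrable_mul_potential hQ hwm hw hb hm hM hs).integral_prod_left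
  simpa only [integral_const_mul] using this

theorem locallyIntegrable_potential (hQ : AEStronglyMeasurable Q (volume.prod volume))
    (hwm : AEStronglyMeasurable w) (hw : Integrable fun y => decay y * ‖w y‖)
    (hb : ∀ p, ‖Q p‖ ≤ C * ((‖p.2 - p.1‖ ^ 2)⁻¹ * ‖w p.2‖)) :
    LocallyIntegrable fun x => ∫ y, Q (x, y) := by
  intro x₀
  refine ⟨ball 0 (‖x₀‖ + 1), isOpen_ball.mem_nhds (by simp), ?_⟩
  have h := integrable_mul_integral_potential hQ hwm hw hb
    (h := (ball (0 : E3) (‖x₀‖ + 1)).indicator fun _ => 1) (M := 1) (ρ := ‖x₀‖ + 1)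
    (aestronglyMeasurable_const.indicator measurableSet_ball)
    (fun x => by
      by_cases hx : x ∈ ball (0 : E3) (‖x₀‖ + 1)
      · simp [indicator_of_mem hx]
      · simp [indicator_of_notMem hx])
    (fun x hx => indicator_of_notMem (by simpa using hx) _)
  rw [← integrable_indicator_iff measurableSet_ball]
  refine h.congr (Filter.Eventually.of_forall fun x => ?_)
  by_cases hx : x ∈ ball (0 : E3) (‖x₀‖ + 1)
  · simp [indicator_of_mem hx]
  · simp [indicator_of_notMem hx]

theorem exists_bound_of_hasCompactSupport {h : E3 → ℝ} (hc : Continuous h)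
    (hs : HasCompactSupport h) :
    ∃ M ρ : ℝ, (∀ x, |h x| ≤ M) ∧ ∀ x, ρ ≤ ‖x‖ → h x = 0 := by
  obtain ⟨M, hM⟩ := hc.bounded_above_of_compact_support hs
  obtain ⟨ρ, hρ⟩ := hs.isCompact.isBounded.subset_ball (0 : E3)
  refine ⟨M, ρ, hM, fun x hx => ?_⟩
  by_contra h0
  have := hρ (subset_closure (Function.mem_support.2 h0))
  rw [mem_ball_zero_iff] at this
  linarith

end Potentials

/-! ### Integration by parts against a radial field, for weak gradients. -/

section Divergence

open Set Metric Convolution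

variable {ψ ψ' : ℝ → ℝ} {C : ℝ}

theorem locallyIntegrable_radialField_apply (hψ : Measurable ψ) (hC : ∀ r, 0 ≤ r → |ψ r| ≤ C)
    (i : Fin 3) : LocallyIntegrable fun z => radialField ψ z i := by
  refine locallyIntegrable_of_norm_le_sq_inv (C := C) ?_ fun z =>
    (PiLp.norm_apply_le _ i).trans (norm_radialField_le hC z)
  exact ((EuclideanSpace.proj (𝕜 := ℝ) i).continuous.measurable.comp
    (measurable_radialField hψ)).aestronglyMeasurable

/-- The convolution of a component of a radial field with a function of compact support. -/
def fieldConv (ψ : ℝ → ℝ) (η : E3 → ℝ) (i : Fin 3) : E3 → ℝ :=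
  (fun z => radialField ψ z i) ⋆[ContinuousLinearMap.lsmul ℝ ℝ, volume] η

theorem fieldConv_eq (η : E3 → ℝ) (i : Fin 3) (y : E3) :
    fieldConv ψ η i y = ∫ x, η x * radialField ψ (y - x) i := by
  rw [← integral_sub_left_eq_self _ volume y]
  have e : ∀ x : E3, y - (y - x) = x := fun x => sub_sub_cancel y x
  simp only [fieldConv, convolution, ContinuousLinearMap.lsmul_apply, smul_eq_mul, e, mul_comm]

theorem contDiff_fieldConv (hψ : Measurable ψ) (hC : ∀ r, 0 ≤ r → |ψ r| ≤ C) {η : E3 → ℝ}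
    (hη : ContDiff ℝ ∞ η) (hc : HasCompactSupport η) (i : Fin 3) :
    ContDiff ℝ ∞ (fieldConv ψ η i) :=
  hc.contDiff_convolution_right _ (locallyIntegrable_radialField_apply hψ hC i) hη

theorem fderiv_fieldConv (hψ : Measurable ψ) (hC : ∀ r, 0 ≤ r → |ψ r| ≤ C) {η : E3 → ℝ}
    (hη : ContDiff ℝ ∞ η) (hc : HasCompactSupport η) (i : Fin 3) (y v : E3) :
    fderiv ℝ (fieldConv ψ η i) y v = fieldConv ψ (fun x => fderiv ℝ η x v) i y := by
  have hl := locallyIntegrable_radialField_apply hψ hC i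
  have h1 := hc.hasFDerivAt_convolution_right (ContinuousLinearMap.lsmul ℝ ℝ) hl
    (hη.of_le (by simp)) y
  unfold fieldConv
  rw [h1.fderiv, convolution_precompR_apply _ hl (hc.fderiv (𝕜 := ℝ))
    (hη.continuous_fderiv (by simp))]

/-- Convolution with a field of size |z|⁻² destroys compact support but leaves quadratic decay,
enough to pair with functions in the weighted class. -/
theorem exists_fieldConv_le (hC : ∀ r, 0 ≤ r → |ψ r| ≤ C) {η : E3 → ℝ}
    (hη : Continuous η) (hc : HasCompactSupport η) (i : Fin 3) :
    ∃ D, ∀ y, |fieldConv ψ η i y| ≤ D * decay y := by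
  obtain ⟨M, ρ, hM, hρ⟩ := exists_bound_of_hasCompactSupport hη hc
  obtain ⟨D, hD0, hD⟩ := exists_integral_kernel_le hη.aestronglyMeasurable hM hρ
  have hC0 : 0 ≤ C := (abs_nonneg _).trans (hC 0 le_rfl)
  refine ⟨C * D, fun y => ?_⟩
  rw [fieldConv_eq, mul_assoc, ← Real.norm_eq_abs]
  refine (norm_integral_le_integral_norm _).trans ?_
  refine le_trans ?_ (mul_le_mul_of_nonneg_left (hD y) hC0)
  rw [← integral_const_mul]
  refine integral_mono_of_nonneg (Filter.Eventually.of_forall fun x => norm_nonneg _)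
    ((integrable_indicator_kernel hη.aestronglyMeasurable hM hρ y).norm.const_mul C)
    (Filter.Eventually.of_forall fun x => ?_)
  simp only [norm_mul]
  rw [mul_left_comm C]
  refine mul_le_mul_of_nonneg_left ?_ (norm_nonneg _)
  rw [Real.norm_of_nonneg (by positivity : 0 ≤ (‖y - x‖ ^ 2)⁻¹)]
  exact (PiLp.norm_apply_le (radialField ψ (y - x)) i).trans (norm_radialField_le hC _)

theorem integrable_of_le_decay {F : Type*} [NormedAddCommGroup F] {a : E3 → ℝ} {D : ℝ}
    (ha : AEStronglyMeasurable a) (hD : ∀ y, |a y| ≤ D * decay y) {w : E3 → F} {b : E3 → ℂ}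
    (hb : AEStronglyMeasurable b) (hbw : ∀ y, ‖b y‖ ≤ ‖w y‖)
    (hw : Integrable fun y => decay y * ‖w y‖) : Integrable fun y => (a y : ℂ) * b y := by
  refine (hw.const_mul D).mono' ((Complex.continuous_ofReal.comp_aestronglyMeasurable ha).mul hb)
    (Filter.Eventually.of_forall fun y => ?_)
  rw [norm_mul, Complex.norm_real, ← mul_assoc]
  exact mul_le_mul (hD y) (hbw y) (norm_nonneg _) ((abs_nonneg _).trans (hD y))

/-- The derivatives are moved onto η; their sum against the components of the field is the
derivative of η along the field, where `integral_fderiv_radialField` applies. -/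
theorem sum_fderiv_fieldConv (hψ : ∀ r, HasDerivAt ψ (ψ' r) r)
    (hψ' : Continuous ψ') (hC : ∀ r, 0 ≤ r → |ψ r| ≤ C) (hC' : ∀ r, 0 ≤ r → |ψ' r| ≤ C)
    {η : E3 → ℝ} (hη : ContDiff ℝ ∞ η) (hc : HasCompactSupport η) (y : E3) :
    ∑ i, fderiv ℝ (fieldConv ψ η i) y (EuclideanSpace.single i 1)
      = (∫ x, η x * (ψ' ‖y - x‖ / ‖y - x‖ ^ 2)) + 4 * Real.pi * ψ 0 * η y := by
  have hψm : Measurable ψ :=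
    (continuous_iff_continuousAt.2 fun r => (hψ r).continuousAt).measurable
  have key := integral_fderiv_radialField hψ hψ' hC hC' (hη.of_le (by simp)) hc y
  rw [← integral_sub_left_eq_self _ volume y]
  have e : ∀ x : E3, y - (y - x) = x := fun x => sub_sub_cancel y x
  simp only [e]
  rw [← key]
  simp only [fderiv_fieldConv hψm hC hη hc]
  have hint : ∀ i, Integrable fun z => fderiv ℝ η (y - z) (EuclideanSpace.single i 1)
      * radialField ψ z i := fun i =>
    (locallyIntegrable_radialField_apply hψm hC i).integrable_smul_left_of_hasCompactSupport
      (((hη.continuous_fderiv (by simp)).clm_apply continuous_const).comp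
        (continuous_const.sub continuous_id))
      ((hc.fderiv_apply (𝕜 := ℝ) _).comp_homeomorph (Homeomorph.subLeft y))
  have e : ∀ i, fieldConv ψ (fun x => fderiv ℝ η x (EuclideanSpace.single i 1)) i y
      = ∫ z, fderiv ℝ η (y - z) (EuclideanSpace.single i 1) * radialField ψ z i := by
    intro i
    simp only [fieldConv, convolution, ContinuousLinearMap.lsmul_apply, smul_eq_mul, mul_comm]
  simp only [e]
  rw [← integral_finsetSum _ fun i _ => hint i]
  congr 1 with z
  conv_rhs => rw [← (EuclideanSpace.basisFun (Fin 3) ℝ).sum_repr (radialField ψ z)]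
  rw [map_sum]
  simp [mul_comm]

/-- Integration by parts against a radial field `ψ(|z|) z / |z|³`, whose divergence is
`ψ'(|z|) / |z|² + 4π ψ(0) δ`. -/
theorem HasWeakGradient.ae_radialField (hψ : ∀ r, HasDerivAt ψ (ψ' r) r)
    (hψ' : Continuous ψ') (hC : ∀ r, 0 ≤ r → |ψ r| ≤ C) (hC' : ∀ r, 0 ≤ r → |ψ' r| ≤ C)
    {u : E3 → ℂ} {g : E3 → C3} (h : HasWeakGradient u g)
    (hu : Integrable fun y => decay y * ‖u y‖) (hg : Integrable fun y => decay y * ‖g y‖) :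
    ∀ᵐ x, -∫ y, (inner ℂ (cplx (radialField ψ (y - x))) (g y) : ℂ)
      = (∫ y, ((ψ' ‖y - x‖ / ‖y - x‖ ^ 2 : ℝ) : ℂ) * u y)
        + ((4 * Real.pi * ψ 0 : ℝ) : ℂ) * u x := by
  have hψm : Measurable ψ :=
    (continuous_iff_continuousAt.2 fun r => (hψ r).continuousAt).measurable
  have hgm := h.locInt_grad.aestronglyMeasurable
  have hum := h.locInt.aestronglyMeasurable
  let Q₁ : E3 × E3 → ℂ := fun p => inner ℂ (cplx (radialField ψ (p.2 - p.1))) (g p.2)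
  let Q₂ : E3 × E3 → ℂ := fun p => ((ψ' ‖p.2 - p.1‖ / ‖p.2 - p.1‖ ^ 2 : ℝ) : ℂ) * u p.2
  have hQ₁m : AEStronglyMeasurable Q₁ (volume.prod volume) := by
    refine AEStronglyMeasurable.inner ?_ hgm.comp_snd
    exact (continuous_cplx.measurable.comp ((measurable_radialField hψm).comp
      (measurable_snd.sub measurable_fst))).aestronglyMeasurable
  have hQ₂m : AEStronglyMeasurable Q₂ (volume.prod volume) := by
    refine AEStronglyMeasurable.mul ?_ hum.comp_snd
    refine (Complex.measurable_ofReal.comp ?_).aestronglyMeasurable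
    exact (hψ'.measurable.comp (measurable_snd.sub measurable_fst).norm).div
      ((measurable_snd.sub measurable_fst).norm.pow_const 2)
  have hb₁ : ∀ p, ‖Q₁ p‖ ≤ C * ((‖p.2 - p.1‖ ^ 2)⁻¹ * ‖g p.2‖) := fun p => by
    refine (norm_inner_cplx_le _ _).trans ?_
    rw [← mul_assoc]
    exact mul_le_mul_of_nonneg_right (norm_radialField_le hC _) (norm_nonneg _)
  have hb₂ : ∀ p, ‖Q₂ p‖ ≤ C * ((‖p.2 - p.1‖ ^ 2)⁻¹ * ‖u p.2‖) := fun p => by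
    rw [norm_mul, Complex.norm_real, Real.norm_eq_abs, abs_div, div_eq_mul_inv, ← mul_assoc,
      abs_of_nonneg (sq_nonneg ‖p.2 - p.1‖)]
    gcongr
    exact hC' _ (norm_nonneg _)
  have hl₁ := locallyIntegrable_potential hQ₁m hgm hg hb₁
  have hl₂ := locallyIntegrable_potential hQ₂m hum hu hb₂
  have hlu := h.locInt.smul ((4 * Real.pi * ψ 0 : ℝ) : ℂ)
  -- After testing with η, Fubini moves the convolution onto η, and the claim becomes the weak
  -- gradient relation of `u` tested with the components `fieldConv ψ η i`.
  have main : ∀ᵐ x, (-∫ y, Q₁ (x, y)) - ((∫ y, Q₂ (x, y))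
      + ((4 * Real.pi * ψ 0 : ℝ) : ℂ) * u x) = 0 := by
    refine ae_eq_zero_of_integral_contDiff_smul_eq_zero (hl₁.neg.sub (hl₂.add hlu)) ?_
    intro η hη hc
    obtain ⟨M, ρ, hM, hρ⟩ := exists_bound_of_hasCompactSupport hη.continuous hc
    have hηm : AEStronglyMeasurable (fun x => (η x : ℂ)) (volume : Measure E3) :=
      (Complex.continuous_ofReal.comp hη.continuous).aestronglyMeasurable
    have hM' : ∀ x, ‖(η x : ℂ)‖ ≤ M := by simpa using hM
    have hρ' : ∀ x, ρ ≤ ‖x‖ → (η x : ℂ) = 0 := fun x hx => by simp [hρ x hx]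
    have i₁ := integrable_mul_integral_potential hQ₁m hgm hg hb₁ hηm hM' hρ'
    have i₂ := integrable_mul_integral_potential hQ₂m hum hu hb₂ hηm hM' hρ'
    have i₃ : Integrable fun x => (η x : ℂ) * (((4 * Real.pi * ψ 0 : ℝ) : ℂ) * u x) := by
      have := hlu.integrable_smul_left_of_hasCompactSupport hη.continuous hc
      simpa using this
    have e₁ := integral_mul_potential hQ₁m hgm hg hb₁ hηm hM' hρ'
    have e₂ := integral_mul_potential hQ₂m hum hu hb₂ hηm hM' hρ'
    have expand : ∀ x, η x • ((-∫ y, Q₁ (x, y)) - ((∫ y, Q₂ (x, y))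
        + ((4 * Real.pi * ψ 0 : ℝ) : ℂ) * u x))
        = -((η x : ℂ) * ∫ y, Q₁ (x, y)) - ((η x : ℂ) * (∫ y, Q₂ (x, y))
        + (η x : ℂ) * (((4 * Real.pi * ψ 0 : ℝ) : ℂ) * u x)) := fun x => by
      rw [Complex.real_smul]; ring
    simp only [expand]
    have i₁' : Integrable fun x => -((η x : ℂ) * ∫ y, Q₁ (x, y)) := i₁.neg
    have i₂₃ : Integrable fun x => (η x : ℂ) * (∫ y, Q₂ (x, y))
        + (η x : ℂ) * (((4 * Real.pi * ψ 0 : ℝ) : ℂ) * u x) := i₂.add i₃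
    rw [integral_sub i₁' i₂₃, integral_neg, integral_add i₂ i₃, e₁, e₂]
    have ce : ∀ i, Continuous fun x => fderiv ℝ η x (EuclideanSpace.single i 1) := fun i =>
      (hη.continuous_fderiv (by simp)).clm_apply continuous_const
    have cc : ∀ i, HasCompactSupport fun x => fderiv ℝ η x (EuclideanSpace.single i 1) := fun i =>
      hc.fderiv_apply (𝕜 := ℝ) _
    have smooth := contDiff_fieldConv hψm hC hη hc
    have hgi : ∀ i, AEStronglyMeasurable fun y => g y i := fun i =>
      (EuclideanSpace.proj (𝕜 := ℂ) i).continuous.comp_aestronglyMeasurable hgm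
    have j₁ : ∀ i, Integrable fun y => (fieldConv ψ η i y : ℂ) * g y i := fun i => by
      obtain ⟨D, hD⟩ := exists_fieldConv_le hC hη.continuous hc i
      exact integrable_of_le_decay (smooth i).continuous.aestronglyMeasurable hD (hgi i)
        (fun y => PiLp.norm_apply_le _ i) hg
    have j₂ : ∀ i, Integrable fun y => (fieldConv ψ η i y : ℂ) * u y := fun i => by
      obtain ⟨D, hD⟩ := exists_fieldConv_le hC hη.continuous hc i
      exact integrable_of_le_decay (smooth i).continuous.aestronglyMeasurable hD hum
        (fun y => le_rfl) hu
    have j₃ : ∀ i, Integrable fun y =>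
        ((fderiv ℝ (fieldConv ψ η i) y (EuclideanSpace.single i 1) : ℝ) : ℂ) * u y := fun i => by
      obtain ⟨D, hD⟩ := exists_fieldConv_le hC (ce i) (cc i) i
      refine integrable_of_le_decay (D := D) ?_ ?_ hum (fun y => le_rfl) hu
      · exact (((smooth i).continuous_fderiv (by simp)).clm_apply
          continuous_const).aestronglyMeasurable
      · intro y
        rw [fderiv_fieldConv hψm hC hη hc]
        exact hD y
    have lhs : ∫ y, ∫ x, (η x : ℂ) * Q₁ (x, y) = ∑ i, ∫ y, (fieldConv ψ η i y : ℂ) * g y i := by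
      rw [← integral_finsetSum _ fun i _ => j₁ i]
      congr 1 with y
      have : ∀ x, (η x : ℂ) * Q₁ (x, y)
          = ∑ i, ((η x * radialField ψ (y - x) i : ℝ) : ℂ) * g y i := by
        intro x
        simp only [Q₁, inner_cplx, Finset.mul_sum]
        push_cast
        simp only [mul_assoc]
      simp only [this]
      have hi : ∀ i, Integrable fun x => η x * radialField ψ (y - x) i := fun i => by
        have hr : AEStronglyMeasurable (fun x => radialField ψ (y - x) i) :=
          ((EuclideanSpace.proj (𝕜 := ℝ) i).continuous.measurable.comp
            ((measurable_radialField hψm).comp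
              (measurable_const.sub measurable_id))).aestronglyMeasurable
        refine ((integrable_indicator_kernel hη.continuous.aestronglyMeasurable hM hρ
          y).norm.const_mul C).mono' (hη.continuous.aestronglyMeasurable.mul hr)
          (Filter.Eventually.of_forall fun x => ?_)
        rw [norm_mul, norm_mul, mul_left_comm C,
          Real.norm_of_nonneg (by positivity : 0 ≤ (‖y - x‖ ^ 2)⁻¹)]
        exact mul_le_mul_of_nonneg_left ((PiLp.norm_apply_le (radialField ψ (y - x)) i).trans
          (norm_radialField_le hC _)) (norm_nonneg _)
      rw [integral_finsetSum _ fun i _ => (hi i).ofReal.mul_const _]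
      refine Finset.sum_congr rfl fun i _ => ?_
      rw [integral_mul_const, integral_complex_ofReal, fieldConv_eq]
    have rhs : ∑ i, ∫ y, ((fderiv ℝ (fieldConv ψ η i) y (EuclideanSpace.single i 1) : ℝ) : ℂ) * u y
        = (∫ y, ∫ x, (η x : ℂ) * Q₂ (x, y))
          + ∫ y, (η y : ℂ) * (((4 * Real.pi * ψ 0 : ℝ) : ℂ) * u y) := by
      rw [← integral_finsetSum _ fun i _ => j₃ i,
        ← integral_add (integrable_mul_potential hQ₂m hum hu hb₂ hηm hM' hρ').integral_prod_right i₃]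
      congr 1 with y
      rw [← Finset.sum_mul, ← Complex.ofReal_sum, sum_fderiv_fieldConv hψ hψ' hC hC' hη hc]
      have : ∀ x, (η x : ℂ) * Q₂ (x, y)
          = ((η x * (ψ' ‖y - x‖ / ‖y - x‖ ^ 2) : ℝ) : ℂ) * u y := fun x => by
        simp only [Q₂]; push_cast; ring
      simp only [this]
      rw [integral_mul_const, integral_complex_ofReal]
      push_cast
      ring
    -- `fieldConv ψ η i` is smooth but in general not compactly supported, hence the appeal to the
    -- version with integrability hypotheses.
    have parts : ∀ i, ∫ y,
        ((fderiv ℝ (fieldConv ψ η i) y (EuclideanSpace.single i 1) : ℝ) : ℂ) * u y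
        = -∫ y, (fieldConv ψ η i y : ℂ) * g y i := fun i =>
      h.integral_eq_of_integrable (smooth i) i (j₃ i) (j₂ i) (j₁ i)
    rw [← rhs, lhs]
    simp only [parts, Finset.sum_neg_distrib]
    ring
  filter_upwards [main] with x hx
  exact sub_eq_zero.1 hx

end Divergence

/-! ### The Yukawa kernel and its gradient. -/

section Yukawa

open Set Metric Filter Topology

/-- The kernel `e^{-k|z|} / (4π|z|)` of `(-Δ + k²)⁻¹`. -/
def yukawa (k : ℝ) (z : E3) : ℝ := Real.exp (-(k * ‖z‖)) / (4 * Real.pi * ‖z‖)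

/-- The profile of the gradient of the Yukawa kernel. -/
def yukawaProfile (k r : ℝ) : ℝ := -((1 + k * r) * Real.exp (-(k * r))) / (4 * Real.pi)

/-- The profile of the field with divergence `e^{-k|z|} / (4π|z|)` that vanishes at the origin. -/
def primitiveProfile (k r : ℝ) : ℝ := (1 - (1 + k * r) * Real.exp (-(k * r))) / (4 * Real.pi * k ^ 2)

theorem one_add_mul_exp_neg_le {s : ℝ} : (1 + s) * Real.exp (-s) ≤ 1 := by
  have h := Real.add_one_le_exp s
  rw [Real.exp_neg, ← div_eq_mul_inv, div_le_one (Real.exp_pos _)]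
  linarith

theorem mul_exp_neg_le {s : ℝ} : s * Real.exp (-s) ≤ 1 := by
  have h := one_add_mul_exp_neg_le (s := s)
  have := Real.exp_pos (-s)
  linarith

theorem hasDerivAt_one_add_mul_exp (k r : ℝ) :
    HasDerivAt (fun r => (1 + k * r) * Real.exp (-(k * r))) (-(k ^ 2 * r * Real.exp (-(k * r)))) r := by
  have h1 : HasDerivAt (fun r => k * r) k r := by simpa using (hasDerivAt_id r).const_mul k
  have h2 := (h1.const_add 1).mul h1.neg.exp
  refine h2.congr_deriv ?_
  simp
  ring

theorem hasDerivAt_yukawaProfile (k r : ℝ) :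
    HasDerivAt (yukawaProfile k) (k ^ 2 * r * Real.exp (-(k * r)) / (4 * Real.pi)) r := by
  have := (hasDerivAt_one_add_mul_exp k r).neg.div_const (4 * Real.pi)
  rwa [neg_neg] at this

theorem hasDerivAt_primitiveProfile {k : ℝ} (hk : 0 < k) (r : ℝ) :
    HasDerivAt (primitiveProfile k) (r * Real.exp (-(k * r)) / (4 * Real.pi)) r := by
  have := ((hasDerivAt_one_add_mul_exp k r).const_sub 1).div_const (4 * Real.pi * k ^ 2)
  refine this.congr_deriv ?_
  field_simp

theorem four_pi_inv_le_one : (4 * Real.pi)⁻¹ ≤ 1 := by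
  apply inv_le_one_of_one_le₀
  linarith [Real.pi_gt_three]

theorem abs_yukawaProfile_le {k : ℝ} (hk : 0 < k) (r : ℝ) (hr : 0 ≤ r) :
    |yukawaProfile k r| ≤ (4 * Real.pi)⁻¹ := by
  have h0 : 0 ≤ (1 + k * r) * Real.exp (-(k * r)) := by positivity
  rw [yukawaProfile, neg_div, abs_neg, abs_of_nonneg (by positivity), div_eq_mul_inv]
  exact mul_le_of_le_one_left (by positivity) one_add_mul_exp_neg_le

theorem abs_primitiveProfile_le {k : ℝ} (hk : 0 < k) (r : ℝ) (hr : 0 ≤ r) :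
    |primitiveProfile k r| ≤ (4 * Real.pi * k ^ 2)⁻¹ := by
  have h0 : 0 ≤ (1 + k * r) * Real.exp (-(k * r)) := by positivity
  have h1 := one_add_mul_exp_neg_le (s := k * r)
  rw [primitiveProfile, abs_of_nonneg (div_nonneg (by linarith) (by positivity)), div_eq_mul_inv]
  exact mul_le_of_le_one_left (by positivity) (by linarith)

theorem yukawa_nonneg (k : ℝ) (z : E3) : 0 ≤ yukawa k z := by
  unfold yukawa
  positivity

theorem measurable_yukawa (k : ℝ) : Measurable (yukawa k) := by
  unfold yukawa
  fun_prop

theorem yukawa_neg (k : ℝ) (z : E3) : yukawa k (-z) = yukawa k z := by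
  simp [yukawa]

theorem yukawa_sub_comm (k : ℝ) (x y : E3) : yukawa k (x - y) = yukawa k (y - x) := by
  rw [← yukawa_neg, neg_sub]

theorem exp_div_le {k r : ℝ} (hk : 0 < k) (hr : 0 < r) :
    Real.exp (-(k * r)) / (4 * Real.pi * r) ≤ k⁻¹ * (r ^ 2)⁻¹ := by
  have h1 := mul_exp_neg_le (s := k * r)
  have h2 := Real.pi_gt_three
  rw [← mul_inv, ← one_div, div_le_div_iff₀ (by positivity) (by positivity)]
  calc Real.exp (-(k * r)) * (k * r ^ 2) = (k * r * Real.exp (-(k * r))) * r := by ring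
    _ ≤ 1 * r := mul_le_mul_of_nonneg_right h1 hr.le
    _ ≤ 1 * (4 * Real.pi * r) := by nlinarith

theorem yukawa_le {k : ℝ} (hk : 0 < k) (z : E3) : yukawa k z ≤ k⁻¹ * (‖z‖ ^ 2)⁻¹ := by
  rcases eq_or_ne z 0 with rfl | hz
  · simp [yukawa]
  · exact exp_div_le hk (norm_pos_iff.2 hz)

theorem norm_yukawa_le {k : ℝ} (hk : 0 < k) (z : E3) : ‖yukawa k z‖ ≤ k⁻¹ * (‖z‖ ^ 2)⁻¹ := by
  rw [Real.norm_of_nonneg (yukawa_nonneg k z)]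
  exact yukawa_le hk z

/-- The divergence density of the field with profile `primitiveProfile k` is the Yukawa kernel; at z
= 0 both sides vanish by the convention on division by zero. -/
theorem profile_deriv_div (k : ℝ) (z : E3) :
    ‖z‖ * Real.exp (-(k * ‖z‖)) / (4 * Real.pi) / ‖z‖ ^ 2 = yukawa k z := by
  unfold yukawa
  rcases eq_or_ne ‖z‖ 0 with h | h
  · simp [h]
  · field_simp

/-- The gradient of the Yukawa kernel. -/
def yukawaGrad (k : ℝ) : E3 → E3 := radialField (yukawaProfile k)

theorem measurable_yukawaGrad (k : ℝ) : Measurable (yukawaGrad k) := by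
  refine measurable_radialField (Continuous.measurable ?_)
  unfold yukawaProfile
  fun_prop

theorem norm_yukawaGrad_le {k : ℝ} (hk : 0 < k) (z : E3) :
    ‖yukawaGrad k z‖ ≤ (4 * Real.pi)⁻¹ * (‖z‖ ^ 2)⁻¹ :=
  norm_radialField_le (abs_yukawaProfile_le hk) z

/-- `u = ∫ ∇G · ∇u + k² ∫ G u` for the Yukawa kernel `G`. -/
theorem HasWeakGradient.ae_eq_yukawa {k : ℝ} (hk : 0 < k) {u : E3 → ℂ} {g : E3 → C3}
    (h : HasWeakGradient u g) (hu : Integrable fun y => decay y * ‖u y‖)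
    (hg : Integrable fun y => decay y * ‖g y‖) :
    ∀ᵐ x, u x = (∫ y, (inner ℂ (cplx (yukawaGrad k (y - x))) (g y) : ℂ))
      + (k : ℂ) ^ 2 * ∫ y, (yukawa k (y - x) : ℂ) * u y := by
  have hd : ∀ r, 0 ≤ r → |k ^ 2 * r * Real.exp (-(k * r)) / (4 * Real.pi)| ≤ k := fun r hr => by
    rw [abs_of_nonneg (by positivity), div_eq_mul_inv]
    have h1 := mul_exp_neg_le (s := k * r)
    calc k ^ 2 * r * Real.exp (-(k * r)) * (4 * Real.pi)⁻¹
        = k * (k * r * Real.exp (-(k * r))) * (4 * Real.pi)⁻¹ := by ring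
      _ ≤ k * 1 * 1 := by
        refine mul_le_mul (mul_le_mul_of_nonneg_left h1 hk.le) four_pi_inv_le_one
          (by positivity) (by positivity)
      _ = k := by ring
  have key := h.ae_radialField (C := max (4 * Real.pi)⁻¹ k) (hasDerivAt_yukawaProfile k)
    (by fun_prop) (fun r hr => (abs_yukawaProfile_le hk r hr).trans (le_max_left _ _))
    (fun r hr => (hd r hr).trans (le_max_right _ _)) hu hg
  filter_upwards [key] with x hx
  have e : ∀ y, ((k ^ 2 * ‖y - x‖ * Real.exp (-(k * ‖y - x‖)) / (4 * Real.pi)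
      / ‖y - x‖ ^ 2 : ℝ) : ℂ) * u y = (k : ℂ) ^ 2 * ((yukawa k (y - x) : ℂ) * u y) := fun y => by
    rw [← profile_deriv_div]
    push_cast
    ring
  have e0 : 4 * Real.pi * yukawaProfile k 0 = -1 := by
    simp [yukawaProfile]
    field_simp
  simp only [e, e0] at hx
  rw [integral_const_mul] at hx
  push_cast at hx
  unfold yukawaGrad
  linear_combination hx

/-- The Yukawa potential of `u` in terms of the gradient of `u`. -/
theorem HasWeakGradient.ae_yukawa_eq {k : ℝ} (hk : 0 < k) {u : E3 → ℂ} {g : E3 → C3}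
    (h : HasWeakGradient u g) (hu : Integrable fun y => decay y * ‖u y‖)
    (hg : Integrable fun y => decay y * ‖g y‖) :
    ∀ᵐ x, ∫ y, (yukawa k (y - x) : ℂ) * u y
      = -∫ y, (inner ℂ (cplx (radialField (primitiveProfile k) (y - x))) (g y) : ℂ) := by
  have hd : ∀ r, 0 ≤ r → |r * Real.exp (-(k * r)) / (4 * Real.pi)| ≤ k⁻¹ := fun r hr => by
    rw [abs_of_nonneg (by positivity), div_eq_mul_inv]
    have h1 := mul_exp_neg_le (s := k * r)
    calc r * Real.exp (-(k * r)) * (4 * Real.pi)⁻¹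
        = k⁻¹ * (k * r * Real.exp (-(k * r))) * (4 * Real.pi)⁻¹ := by field_simp
      _ ≤ k⁻¹ * 1 * 1 := by
        refine mul_le_mul (mul_le_mul_of_nonneg_left h1 (by positivity)) four_pi_inv_le_one
          (by positivity) (by positivity)
      _ = k⁻¹ := by ring
  have key := h.ae_radialField (C := max (4 * Real.pi * k ^ 2)⁻¹ k⁻¹)
    (hasDerivAt_primitiveProfile hk) (by fun_prop)
    (fun r hr => (abs_primitiveProfile_le hk r hr).trans (le_max_left _ _))
    (fun r hr => (hd r hr).trans (le_max_right _ _)) hu hg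
  filter_upwards [key] with x hx
  -- This primitive vanishes at the origin, so its divergence has no delta term and u enters only
  -- through its Yukawa potential.
  have e0 : primitiveProfile k 0 = 0 := by simp [primitiveProfile]
  simp only [profile_deriv_div, e0, mul_zero, Complex.ofReal_zero, zero_mul, add_zero] at hx
  exact hx.symm

/-- The regularised kernel is smooth with explicit gradient. -/
theorem hasFDerivAt_exp_sqrt_div (k : ℝ) {ε : ℝ} (hε : 0 < ε) (x : E3) :
    HasFDerivAt (fun x : E3 => Real.exp (-(k * √(‖x‖ ^ 2 + ε))) / (4 * Real.pi * √(‖x‖ ^ 2 + ε)))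
      ((yukawaProfile k (√(‖x‖ ^ 2 + ε)) / √(‖x‖ ^ 2 + ε) ^ 3) • innerSL ℝ x) x := by
  have hp : 0 < ‖x‖ ^ 2 + ε := by positivity
  have hs : 0 < √(‖x‖ ^ 2 + ε) := Real.sqrt_pos.2 hp
  have h1 : HasFDerivAt (fun x : E3 => ‖x‖ ^ 2 + ε) (2 • innerSL ℝ x) x :=
    (hasStrictFDerivAt_norm_sq x).hasFDerivAt.add_const ε
  have h2 := h1.sqrt hp.ne'
  have h3 : HasDerivAt (fun r => Real.exp (-(k * r)) / (4 * Real.pi * r))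
      (yukawaProfile k (√(‖x‖ ^ 2 + ε)) / √(‖x‖ ^ 2 + ε) ^ 2) (√(‖x‖ ^ 2 + ε)) := by
    generalize √(‖x‖ ^ 2 + ε) = r at hs
    have a1 : HasDerivAt (fun r => k * r) k r := by simpa using (hasDerivAt_id r).const_mul k
    have a2 : HasDerivAt (fun r => 4 * Real.pi * r) (4 * Real.pi) r := by
      simpa using (hasDerivAt_id r).const_mul (4 * Real.pi)
    refine (a1.neg.exp.div a2 (by positivity)).congr_deriv ?_
    simp only [yukawaProfile, Pi.neg_apply]
    field_simp
    ring
  refine (h3.comp_hasFDerivAt x h2).congr_fderiv ?_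
  ext v
  simp
  field_simp

/-- The kernel is singular at the origin, so |x| is replaced by √(|x|² + ε), for which classical
integration by parts is available. Since √(|x|² + ε) ≥ |x|, the bounds by |x|⁻² are uniform in ε and
dominate both sides as ε → 0. -/
theorem integral_fderiv_yukawa {k : ℝ} (hk : 0 < k) {η : E3 → ℝ} (hη : ContDiff ℝ 1 η)
    (hc : HasCompactSupport η) (i : Fin 3) :
    ∫ x, fderiv ℝ η x (EuclideanSpace.single i 1) * yukawa k x
      = -∫ x, η x * yukawaGrad k x i := by
  let e : E3 := EuclideanSpace.single i 1
  let ε : ℕ → ℝ := fun n => 1 / ((n : ℝ) + 1)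
  have hε : ∀ n, 0 < ε n := fun n => by positivity
  have hε0 : Tendsto ε atTop (𝓝 0) := tendsto_one_div_add_atTop_nhds_zero_nat
  let ρ : ℕ → E3 → ℝ := fun n x => √(‖x‖ ^ 2 + ε n)
  have hρpos : ∀ n x, 0 < ρ n x := fun n x => Real.sqrt_pos.2 (by have := hε n; positivity)
  have hρge : ∀ n x, ‖x‖ ≤ ρ n x := fun n x => Real.le_sqrt_of_sq_le (by linarith [hε n])
  have hρc : ∀ n, Continuous (ρ n) := fun n => by fun_prop
  have hρl : ∀ x, Tendsto (fun n => ρ n x) atTop (𝓝 ‖x‖) := fun x => by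
    have : Tendsto (fun n => ‖x‖ ^ 2 + ε n) atTop (𝓝 (‖x‖ ^ 2 + 0)) := hε0.const_add _
    have h2 := (Real.continuous_sqrt.tendsto _).comp this
    rw [add_zero, Real.sqrt_sq (norm_nonneg _)] at h2
    exact h2
  let G : ℕ → E3 → ℝ := fun n x => Real.exp (-(k * ρ n x)) / (4 * Real.pi * ρ n x)
  let Γ : ℕ → E3 → ℝ := fun n x => yukawaProfile k (ρ n x) / ρ n x ^ 3 * x i
  have hGd : ∀ n x, HasFDerivAt (G n)
      ((yukawaProfile k (ρ n x) / ρ n x ^ 3) • innerSL ℝ x) x := fun n x =>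
    hasFDerivAt_exp_sqrt_div k (hε n) x
  have hGc : ∀ n, Continuous (G n) := fun n =>
    continuous_iff_continuousAt.2 fun x => (hGd n x).continuousAt
  have hΓ : ∀ n x, fderiv ℝ (G n) x e = Γ n x := fun n x => by
    rw [(hGd n x).fderiv]
    simp [e, Γ, EuclideanSpace.inner_single_right]
  have hΓc : ∀ n, Continuous (Γ n) := fun n => by
    have h1 : Continuous (yukawaProfile k) := by unfold yukawaProfile; fun_prop
    exact ((h1.comp (hρc n)).div ((hρc n).pow 3) fun x => (pow_pos (hρpos n x) 3).ne').mul
      (by fun_prop)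
  have hηc' : Continuous fun x => fderiv ℝ η x e :=
    (hη.continuous_fderiv (by simp)).clm_apply continuous_const
  have hcs' : HasCompactSupport fun x => fderiv ℝ η x e := hc.fderiv_apply (𝕜 := ℝ) _
  have parts : ∀ n, ∫ x, fderiv ℝ η x e * G n x = -∫ x, η x * Γ n x := fun n => by
    have h := integral_mul_fderiv_eq_neg_fderiv_mul_of_integrable (μ := (volume : Measure E3))
      (f := η) (g := G n) (v := e)
      ((hηc'.mul (hGc n)).integrable_of_hasCompactSupport hcs'.mul_right)
      (by simp only [hΓ]
          exact (hη.continuous.mul (hΓc n)).integrable_of_hasCompactSupport hc.mul_right)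
      ((hη.continuous.mul (hGc n)).integrable_of_hasCompactSupport hc.mul_right)
      (fun x _ => hη.differentiable (by simp) x) (fun x _ => (hGd n x).differentiableAt)
    simp only [hΓ] at h
    rw [h, neg_neg]
  have hne : ∀ᵐ x : E3, x ≠ 0 := by
    simp [ae_iff, measure_singleton]
  have dom : ∀ {f : E3 → ℝ} (_ : Continuous f) (_ : HasCompactSupport f) (c : ℝ),
      Integrable fun x => ‖f x‖ * (c * (‖x‖ ^ 2)⁻¹) := fun hf hfc c => by
    have := (locallyIntegrable_norm_sq_inv.smul c).integrable_smul_left_of_hasCompactSupport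
      hf.norm hfc.norm
    exact this
  have hinv : ∀ n x, x ≠ 0 → (ρ n x ^ 2)⁻¹ ≤ (‖x‖ ^ 2)⁻¹ := fun n x hx =>
    inv_anti₀ (by positivity) (pow_le_pow_left₀ (norm_nonneg _) (hρge n x) 2)
  have L : Tendsto (fun n => ∫ x, fderiv ℝ η x e * G n x) atTop
      (𝓝 (∫ x, fderiv ℝ η x e * yukawa k x)) := by
    refine tendsto_integral_of_dominated_convergence _
      (fun n => (hηc'.mul (hGc n)).aestronglyMeasurable) (dom hηc' hcs' k⁻¹) (fun n => ?_) ?_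
    · filter_upwards [hne] with x hx
      rw [norm_mul, Real.norm_of_nonneg (by positivity [hρpos n x] : 0 ≤ G n x)]
      refine mul_le_mul_of_nonneg_left ((exp_div_le hk (hρpos n x)).trans ?_) (norm_nonneg _)
      exact mul_le_mul_of_nonneg_left (hinv n x hx) (by positivity)
    · filter_upwards [hne] with x hx
      have hx' : ‖x‖ ≠ 0 := norm_ne_zero_iff.2 hx
      refine Tendsto.const_mul _ ?_
      have h1 := ((hρl x).const_mul k).neg
      exact ((Real.continuous_exp.tendsto _).comp h1).div ((hρl x).const_mul _) (by positivity)
  have R : Tendsto (fun n => -∫ x, η x * Γ n x) atTop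
      (𝓝 (-∫ x, η x * yukawaGrad k x i)) := by
    refine Tendsto.neg (tendsto_integral_of_dominated_convergence _
      (fun n => (hη.continuous.mul (hΓc n)).aestronglyMeasurable)
      (dom hη.continuous hc (4 * Real.pi)⁻¹) (fun n => ?_) ?_)
    · filter_upwards [hne] with x hx
      rw [norm_mul]
      refine mul_le_mul_of_nonneg_left ?_ (norm_nonneg _)
      have h1 := abs_yukawaProfile_le hk (ρ n x) (hρpos n x).le
      have h2 : ‖x i‖ ≤ ρ n x := (PiLp.norm_apply_le x i).trans (hρge n x)
      have hp := hρpos n x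
      calc ‖Γ n x‖ = |yukawaProfile k (ρ n x)| * (‖x i‖ / ρ n x ^ 3) := by
            simp only [Γ, norm_mul, norm_div, Real.norm_eq_abs, abs_of_pos (pow_pos hp 3)]
            ring
        _ ≤ (4 * Real.pi)⁻¹ * (ρ n x ^ 2)⁻¹ := by
            refine mul_le_mul h1 ?_ (by positivity) (by positivity)
            rw [div_le_iff₀ (by positivity)]
            refine h2.trans (le_of_eq ?_)
            field_simp
        _ ≤ _ := mul_le_mul_of_nonneg_left (hinv n x hx) (by positivity)
    · filter_upwards [hne] with x hx
      have hx' : ‖x‖ ≠ 0 := norm_ne_zero_iff.2 hx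
      have h1 : Continuous (yukawaProfile k) := by unfold yukawaProfile; fun_prop
      refine Tendsto.const_mul _ ?_
      have h2 := (((h1.tendsto _).comp (hρl x)).div ((hρl x).pow 3) (pow_ne_zero 3 hx')).mul_const
        (x i)
      simpa [yukawaGrad, radialField] using h2
  refine tendsto_nhds_unique L ?_
  simp only [parts]
  exact R

theorem integral_fderiv_yukawa_sub {k : ℝ} (hk : 0 < k) {η : E3 → ℝ} (hη : ContDiff ℝ 1 η)
    (hc : HasCompactSupport η) (i : Fin 3) (x : E3) :
    ∫ y, fderiv ℝ η y (EuclideanSpace.single i 1) * yukawa k (y - x)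
      = -∫ y, η y * yukawaGrad k (y - x) i := by
  have h := integral_fderiv_yukawa hk (η := fun y => η (y + x))
    (hη.comp (contDiff_id.add contDiff_const)) (hc.comp_homeomorph (Homeomorph.addRight x)) i
  simp only [fderiv_comp_add_right] at h
  rw [← integral_add_right_eq_self (fun y => fderiv ℝ η y (EuclideanSpace.single i 1)
      * yukawa k (y - x)) x, ← integral_add_right_eq_self (fun y => η y * yukawaGrad k (y - x) i) x]
  simpa using h

end Yukawa

/-! ### Yukawa potentials of bounded functions with bounded support. -/

section YukawaPotential

open Set Metric Filter Topology

/-- Measurable bounded functions with bounded support. -/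
structure BoundedSupport (h : E3 → ℂ) : Prop where
  meas : AEStronglyMeasurable h (volume : Measure E3)
  bound : ∃ M ρ : ℝ, (∀ x, ‖h x‖ ≤ M) ∧ ∀ x, ρ ≤ ‖x‖ → h x = 0

/-- The Yukawa potential `G * h`. -/
def yukawaPot (k : ℝ) (h : E3 → ℂ) (y : E3) : ℂ := ∫ x, h x * (yukawa k (y - x) : ℂ)

/-- The gradient `∇G * h` of the Yukawa potential. -/
def yukawaPotGrad (k : ℝ) (h : E3 → ℂ) (y : E3) : C3 := ∫ x, h x • cplx (yukawaGrad k (y - x))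

variable {k : ℝ} {h : E3 → ℂ}

theorem BoundedSupport.integrable_smul {F : Type*} [NormedAddCommGroup F] [NormedSpace ℂ F]
    [SecondCountableTopology F] [MeasurableSpace F] [BorelSpace F]
    (hh : BoundedSupport h) {K : E3 → F} (hKm : Measurable K) {C : ℝ}
    (hK : ∀ z, ‖K z‖ ≤ C * (‖z‖ ^ 2)⁻¹) (y : E3) : Integrable fun x => h x • K (y - x) := by
  obtain ⟨M, ρ, hM, hρ⟩ := hh.bound
  refine ((integrable_indicator_kernel (h := fun x => ‖h x‖) hh.meas.norm (M := M) (ρ := ρ)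
    (by simpa using hM) (fun x hx => by simp [hρ x hx]) y).const_mul C).mono' ?_
    (Filter.Eventually.of_forall fun x => ?_)
  · exact hh.meas.smul
      (hKm.comp (measurable_const.sub measurable_id)).stronglyMeasurable.aestronglyMeasurable
  · rw [norm_smul, mul_left_comm]
    exact mul_le_mul_of_nonneg_left (hK _) (norm_nonneg _)

theorem BoundedSupport.exists_integral_le {F : Type*} [NormedAddCommGroup F] [NormedSpace ℂ F]
    (hh : BoundedSupport h) {K : E3 → F} {C : ℝ} (hC : 0 ≤ C)
    (hK : ∀ z, ‖K z‖ ≤ C * (‖z‖ ^ 2)⁻¹) :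
    ∃ D, ∀ y, ‖∫ x, h x • K (y - x)‖ ≤ D * decay y := by
  obtain ⟨M, ρ, hM, hρ⟩ := hh.bound
  have h1 : AEStronglyMeasurable (fun x => ‖h x‖) (volume : Measure E3) := hh.meas.norm
  have h2 : ∀ x, |‖h x‖| ≤ M := by simpa using hM
  have h3 : ∀ x, ρ ≤ ‖x‖ → ‖h x‖ = 0 := fun x hx => by simp [hρ x hx]
  obtain ⟨D, hD0, hD⟩ := exists_integral_kernel_le h1 h2 h3
  refine ⟨C * D, fun y => (norm_integral_le_integral_norm _).trans ?_⟩
  rw [mul_assoc]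
  refine le_trans ?_ (mul_le_mul_of_nonneg_left (hD y) hC)
  rw [← integral_const_mul]
  refine integral_mono_of_nonneg (Filter.Eventually.of_forall fun x => norm_nonneg _)
    ((integrable_indicator_kernel h1 h2 h3 y).norm.const_mul C)
    (Filter.Eventually.of_forall fun x => ?_)
  simp only [norm_mul, norm_smul, norm_norm]
  rw [mul_left_comm C, Real.norm_of_nonneg (by positivity : 0 ≤ (‖y - x‖ ^ 2)⁻¹)]
  exact mul_le_mul_of_nonneg_left (hK _) (norm_nonneg _)

theorem measurable_cplx_yukawaGrad (k : ℝ) : Measurable fun z => cplx (yukawaGrad k z) :=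
  continuous_cplx.measurable.comp (measurable_yukawaGrad k)

theorem norm_cplx_yukawaGrad_le (hk : 0 < k) (z : E3) :
    ‖cplx (yukawaGrad k z)‖ ≤ (4 * Real.pi)⁻¹ * (‖z‖ ^ 2)⁻¹ := by
  rw [norm_cplx]
  exact norm_yukawaGrad_le hk z

theorem norm_ofReal_yukawa_le (hk : 0 < k) (z : E3) :
    ‖(yukawa k z : ℂ)‖ ≤ k⁻¹ * (‖z‖ ^ 2)⁻¹ := by
  rw [Complex.norm_real]
  exact norm_yukawa_le hk z

theorem BoundedSupport.aestronglyMeasurable_pot (hh : BoundedSupport h) (k : ℝ) :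
    AEStronglyMeasurable (yukawaPot k h) (volume : Measure E3) := by
  have : AEStronglyMeasurable (fun p : E3 × E3 => h p.2 * (yukawa k (p.1 - p.2) : ℂ))
      (volume.prod volume) :=
    hh.meas.comp_snd.mul (Complex.measurable_ofReal.comp ((measurable_yukawa k).comp
      (measurable_fst.sub measurable_snd))).aestronglyMeasurable
  exact this.integral_prod_right'

theorem BoundedSupport.aestronglyMeasurable_potGrad (hh : BoundedSupport h) (k : ℝ) :
    AEStronglyMeasurable (yukawaPotGrad k h) (volume : Measure E3) := by
  have : AEStronglyMeasurable (fun p : E3 × E3 => h p.2 • cplx (yukawaGrad k (p.1 - p.2)))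
      (volume.prod volume) :=
    hh.meas.comp_snd.smul ((measurable_cplx_yukawaGrad k).comp
      (measurable_fst.sub measurable_snd)).aestronglyMeasurable
  exact this.integral_prod_right'

theorem memLp_two_of_le_decay {F : Type*} [NormedAddCommGroup F] {a : E3 → F} {D : ℝ}
    (ha : AEStronglyMeasurable a (volume : Measure E3)) (hD : ∀ y, ‖a y‖ ≤ D * decay y) :
    MemLp a 2 (volume : Measure E3) :=
  (memLp_decay.const_mul D).mono' ha (Filter.Eventually.of_forall hD)

theorem BoundedSupport.exists_pot_le (hh : BoundedSupport h) (hk : 0 < k) :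
    ∃ D, ∀ y, ‖yukawaPot k h y‖ ≤ D * decay y :=
  hh.exists_integral_le (K := fun z => (yukawa k z : ℂ)) (by positivity) (norm_ofReal_yukawa_le hk)

theorem BoundedSupport.memLp_pot (hh : BoundedSupport h) (hk : 0 < k) :
    MemLp (yukawaPot k h) 2 (volume : Measure E3) := by
  obtain ⟨D, hD⟩ := hh.exists_pot_le hk
  exact memLp_two_of_le_decay (hh.aestronglyMeasurable_pot k) hD

theorem BoundedSupport.memLp_potGrad (hh : BoundedSupport h) (hk : 0 < k) :
    MemLp (yukawaPotGrad k h) 2 (volume : Measure E3) := by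
  obtain ⟨D, hD⟩ := hh.exists_integral_le (K := fun z => cplx (yukawaGrad k z)) (by positivity)
    (norm_cplx_yukawaGrad_le hk)
  exact memLp_two_of_le_decay (hh.aestronglyMeasurable_potGrad k) hD

theorem BoundedSupport.potGrad_apply (hh : BoundedSupport h) (hk : 0 < k) (y : E3) (i : Fin 3) :
    yukawaPotGrad k h y i = ∫ x, h x * (yukawaGrad k (y - x) i : ℂ) := by
  have hi := hh.integrable_smul (measurable_cplx_yukawaGrad k) (norm_cplx_yukawaGrad_le hk) y
  have := (EuclideanSpace.proj (𝕜 := ℂ) i).integral_comp_comm hi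
  exact this.symm

theorem integrable_decay_mul_of_continuous {η : E3 → ℝ} (hη : Continuous η)
    (hc : HasCompactSupport η) : Integrable fun y => decay y * ‖η y‖ :=
  integrable_decay_mul_of_integrable (hη.integrable_of_hasCompactSupport hc)

/-- The Yukawa potential of a bounded function with bounded support has a weak gradient. -/
theorem BoundedSupport.hasWeakGradient_pot (hh : BoundedSupport h) (hk : 0 < k) :
    HasWeakGradient (yukawaPot k h) (yukawaPotGrad k h) where
  locInt := (hh.memLp_pot hk).locallyIntegrable (by norm_num)
  locInt_grad := (hh.memLp_potGrad hk).locallyIntegrable (by norm_num)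
  integral_eq η hη hc i := by
    obtain ⟨M, ρ, hM, hρ⟩ := hh.bound
    have hc' : HasCompactSupport fun y => fderiv ℝ η y (EuclideanSpace.single i 1) :=
      hc.fderiv_apply (𝕜 := ℝ) _
    have hη' : Continuous fun y => fderiv ℝ η y (EuclideanSpace.single i 1) :=
      (hη.continuous_fderiv (by simp)).clm_apply continuous_const
    have e₁ := integral_mul_potential (h := h) (C := k⁻¹)
      (Q := fun p => ((fderiv ℝ η p.2 (EuclideanSpace.single i 1) * yukawa k (p.2 - p.1) : ℝ) : ℂ))
      (w := fun y => fderiv ℝ η y (EuclideanSpace.single i 1))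
      (Complex.measurable_ofReal.comp ((hη'.measurable.comp measurable_snd).mul
        ((measurable_yukawa k).comp (measurable_snd.sub measurable_fst)))).aestronglyMeasurable
      hη'.aestronglyMeasurable (integrable_decay_mul_of_continuous hη' hc')
      (fun p => by
        rw [Complex.norm_real, norm_mul, mul_comm, ← mul_assoc]
        exact mul_le_mul_of_nonneg_right (norm_yukawa_le hk _) (norm_nonneg _))
      hh.meas hM hρ
    have e₂ := integral_mul_potential (h := h) (C := (4 * Real.pi)⁻¹)
      (Q := fun p => ((η p.2 * yukawaGrad k (p.2 - p.1) i : ℝ) : ℂ))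
      (w := η)
      (Complex.measurable_ofReal.comp ((hη.continuous.measurable.comp measurable_snd).mul
        ((EuclideanSpace.proj (𝕜 := ℝ) i).continuous.measurable.comp ((measurable_yukawaGrad k).comp
          (measurable_snd.sub measurable_fst))))).aestronglyMeasurable
      hη.continuous.aestronglyMeasurable (integrable_decay_mul_of_continuous hη.continuous hc)
      (fun p => by
        rw [Complex.norm_real, norm_mul, mul_comm, ← mul_assoc]
        exact mul_le_mul_of_nonneg_right ((PiLp.norm_apply_le (yukawaGrad k (p.2 - p.1)) i).trans
          (norm_yukawaGrad_le hk _)) (norm_nonneg _))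
      hh.meas hM hρ
    have a₁ : ∀ y, ((fderiv ℝ η y (EuclideanSpace.single i 1) : ℝ) : ℂ) * yukawaPot k h y
        = ∫ x, h x * ((fderiv ℝ η y (EuclideanSpace.single i 1) * yukawa k (y - x) : ℝ) : ℂ) := by
      intro y
      rw [yukawaPot, ← integral_const_mul]
      congr 1 with x
      push_cast
      ring
    have a₂ : ∀ y, (η y : ℂ) * yukawaPotGrad k h y i
        = ∫ x, h x * ((η y * yukawaGrad k (y - x) i : ℝ) : ℂ) := by
      intro y
      rw [hh.potGrad_apply hk, ← integral_const_mul]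
      congr 1 with x
      push_cast
      ring
    simp only [a₁, a₂]
    rw [← e₁, ← e₂, ← integral_neg]
    congr 1 with x
    rw [integral_complex_ofReal, integral_complex_ofReal,
      integral_fderiv_yukawa_sub hk (hη.of_le (by simp)) hc i x]
    push_cast
    ring

/-- The equation `(-Δ + k²) (G * h) = h` in weak form. -/
theorem BoundedSupport.integral_conj_mul (hh : BoundedSupport h) (hk : 0 < k) {u : E3 → ℂ}
    {g : E3 → C3} (hug : HasWeakGradient u g) (hu : Integrable fun y => decay y * ‖u y‖)
    (hg : Integrable fun y => decay y * ‖g y‖) :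
    ∫ x, conj (h x) * u x = (∫ y, (inner ℂ (yukawaPotGrad k h y) (g y) : ℂ))
      + (k : ℂ) ^ 2 * ∫ y, conj (yukawaPot k h y) * u y := by
  obtain ⟨M, ρ, hM, hρ⟩ := hh.bound
  have hgm := hug.locInt_grad.aestronglyMeasurable
  have hum := hug.locInt.aestronglyMeasurable
  let Q₁ : E3 × E3 → ℂ := fun p => inner ℂ (cplx (yukawaGrad k (p.2 - p.1))) (g p.2)
  let Q₂ : E3 × E3 → ℂ := fun p => (yukawa k (p.2 - p.1) : ℂ) * u p.2
  have hQ₁m : AEStronglyMeasurable Q₁ (volume.prod volume) := by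
    refine AEStronglyMeasurable.inner ?_ hgm.comp_snd
    exact ((measurable_cplx_yukawaGrad k).comp
      (measurable_snd.sub measurable_fst)).aestronglyMeasurable
  have hQ₂m : AEStronglyMeasurable Q₂ (volume.prod volume) := by
    refine AEStronglyMeasurable.mul ?_ hum.comp_snd
    exact (Complex.measurable_ofReal.comp ((measurable_yukawa k).comp
      (measurable_snd.sub measurable_fst))).aestronglyMeasurable
  have hb₁ : ∀ p, ‖Q₁ p‖ ≤ (4 * Real.pi)⁻¹ * ((‖p.2 - p.1‖ ^ 2)⁻¹ * ‖g p.2‖) := fun p => by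
    refine (norm_inner_cplx_le _ _).trans ?_
    rw [← mul_assoc]
    exact mul_le_mul_of_nonneg_right (norm_yukawaGrad_le hk _) (norm_nonneg _)
  have hb₂ : ∀ p, ‖Q₂ p‖ ≤ k⁻¹ * ((‖p.2 - p.1‖ ^ 2)⁻¹ * ‖u p.2‖) := fun p => by
    rw [norm_mul, ← mul_assoc]
    exact mul_le_mul_of_nonneg_right (norm_ofReal_yukawa_le hk _) (norm_nonneg _)
  have hcm : AEStronglyMeasurable (fun x => conj (h x)) (volume : Measure E3) :=
    Complex.continuous_conj.comp_aestronglyMeasurable hh.meas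
  have hcM : ∀ x, ‖conj (h x)‖ ≤ M := by simpa using hM
  have hcρ : ∀ x, ρ ≤ ‖x‖ → conj (h x) = 0 := fun x hx => by simp [hρ x hx]
  have i₁ := integrable_mul_integral_potential hQ₁m hgm hg hb₁ hcm hcM hcρ
  have i₂ := integrable_mul_integral_potential hQ₂m hum hu hb₂ hcm hcM hcρ
  have e₁ := integral_mul_potential hQ₁m hgm hg hb₁ hcm hcM hcρ
  have e₂ := integral_mul_potential hQ₂m hum hu hb₂ hcm hcM hcρ
  calc ∫ x, conj (h x) * u x
      = ∫ x, (conj (h x) * (∫ y, Q₁ (x, y)) + (k : ℂ) ^ 2 * (conj (h x) * ∫ y, Q₂ (x, y))) := by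
        refine integral_congr_ae ?_
        filter_upwards [hug.ae_eq_yukawa hk hu hg] with x hx
        rw [hx]
        ring
    _ = (∫ y, ∫ x, conj (h x) * Q₁ (x, y)) + (k : ℂ) ^ 2 * ∫ y, ∫ x, conj (h x) * Q₂ (x, y) := by
        rw [integral_add i₁ (i₂.const_mul _), integral_const_mul, e₁, e₂]
    _ = _ := by
        congr 2
        · ext y
          have hi := hh.integrable_smul (measurable_cplx_yukawaGrad k) (norm_cplx_yukawaGrad_le hk) y
          rw [← inner_conj_symm, yukawaPotGrad, ← integral_inner hi, ← integral_conj]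
          congr 1 with x
          rw [inner_conj_symm, inner_smul_left]
        · congr 1 with y
          rw [yukawaPot, ← integral_conj, ← integral_mul_const]
          congr 1 with x
          simp only [Q₂, map_mul, Complex.conj_ofReal]
          ring

end YukawaPotential

/-! ### The Kato inequality, by Schur's test and an energy identity. -/

section KatoInequality

open Set Metric Filter Topology

/-- A measurable potential whose global Kato norm is at most `4πκ`, with `κ > 0`. -/
structure KatoBound (V : E3 → ℝ) (κ : ℝ) : Prop where
  meas : Measurable V
  pos : 0 < κ
  le : ∀ y : E3, ∫⁻ x, ‖V x‖ₑ / ‖x - y‖ₑ ≤ ENNReal.ofReal (4 * Real.pi * κ)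

/-- The maximum with 1/2 only serves to make κ positive, so that one may divide by κ even when V =
0. -/
theorem exists_katoBound {V : E3 → ℝ} (hV : Measurable V)
    (hK : katoNorm V < ENNReal.ofReal (4 * Real.pi)) : ∃ κ, κ < 1 ∧ KatoBound V κ := by
  have hp : 0 < 4 * Real.pi := by positivity
  refine ⟨max ((katoNorm V).toReal / (4 * Real.pi)) (1 / 2), max_lt ?_ (by norm_num),
    hV, lt_max_of_lt_right (by norm_num), fun y => ?_⟩
  · rw [div_lt_one hp]
    have := (ENNReal.toReal_lt_toReal hK.ne_top ENNReal.ofReal_ne_top).2 hK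
    rwa [ENNReal.toReal_ofReal hp.le] at this
  · refine (le_iSup (fun y : E3 => ∫⁻ x, ‖V x‖ₑ / ‖x - y‖ₑ) y).trans ?_
    change katoNorm V ≤ _
    refine (ENNReal.ofReal_toReal hK.ne_top).symm.le.trans (ENNReal.ofReal_le_ofReal ?_)
    calc (katoNorm V).toReal = 4 * Real.pi * ((katoNorm V).toReal / (4 * Real.pi)) := by field_simp
      _ ≤ _ := mul_le_mul_of_nonneg_left (le_max_left _ (1 / 2)) hp.le

/-- The Newtonian kernel `1 / (4π|z|)`. -/
def newton (z : E3) : ℝ := (4 * Real.pi * ‖z‖)⁻¹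

theorem newton_nonneg (z : E3) : 0 ≤ newton z := by
  unfold newton
  positivity

theorem measurable_newton : Measurable newton := by
  unfold newton
  fun_prop

theorem newton_sub_comm (x y : E3) : newton (x - y) = newton (y - x) := by
  simp [newton, norm_sub_rev]

/-- Equality fails only at the origin, where `newton` takes the value 0 and the right side is
infinite. -/
theorem enorm_newton_le (z : E3) : ‖newton z‖ₑ ≤ ENNReal.ofReal (4 * Real.pi)⁻¹ * ‖z‖ₑ⁻¹ := by
  rcases eq_or_ne z 0 with rfl | hz
  · simp [newton]
  · rw [← ofReal_norm, ← ofReal_norm, Real.norm_of_nonneg (newton_nonneg z),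
      ← ENNReal.ofReal_inv_of_pos (norm_pos_iff.2 hz), ← ENNReal.ofReal_mul (by positivity),
      newton, mul_inv]

theorem KatoBound.lintegral_newton_le {V : E3 → ℝ} {κ : ℝ} (hV : KatoBound V κ) (y : E3) :
    ∫⁻ x, ‖V x‖ₑ * ‖newton (x - y)‖ₑ ≤ ENNReal.ofReal κ := by
  calc ∫⁻ x, ‖V x‖ₑ * ‖newton (x - y)‖ₑ
      ≤ ∫⁻ x, ENNReal.ofReal (4 * Real.pi)⁻¹ * (‖V x‖ₑ / ‖x - y‖ₑ) := by
        refine lintegral_mono fun x => ?_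
        rw [div_eq_mul_inv, mul_left_comm]
        exact mul_le_mul_right (enorm_newton_le _) _
    _ = ENNReal.ofReal (4 * Real.pi)⁻¹ * ∫⁻ x, ‖V x‖ₑ / ‖x - y‖ₑ := by
        rw [lintegral_const_mul']
        exact ENNReal.ofReal_ne_top
    _ ≤ ENNReal.ofReal (4 * Real.pi)⁻¹ * ENNReal.ofReal (4 * Real.pi * κ) :=
        mul_le_mul_right (hV.le y) _
    _ = ENNReal.ofReal κ := by
        rw [← ENNReal.ofReal_mul (by positivity)]
        congr 1
        field_simp

theorem yukawa_le_newton {k : ℝ} (hk : 0 ≤ k) (z : E3) : yukawa k z ≤ newton z := by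
  unfold yukawa newton
  rw [div_eq_mul_inv]
  refine mul_le_of_le_one_left (by positivity) (Real.exp_le_one_iff.2 ?_)
  have := mul_nonneg hk (norm_nonneg z)
  linarith

theorem enorm_yukawa_le_newton {k : ℝ} (hk : 0 ≤ k) (z : E3) : ‖yukawa k z‖ₑ ≤ ‖newton z‖ₑ := by
  rw [← ofReal_norm, ← ofReal_norm, Real.norm_of_nonneg (newton_nonneg z),
    Real.norm_of_nonneg (yukawa_nonneg k z)]
  exact ENNReal.ofReal_le_ofReal (yukawa_le_newton hk z)

/-- Schur's test for a symmetric kernel. -/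
theorem lintegral_schur_le {a : E3 → ℝ≥0∞} {b : E3 → NNReal} {N : E3 → E3 → ℝ≥0∞}
    (ha : Measurable a) (hb : Measurable b) (hN : Measurable (Function.uncurry N))
    (hsymm : ∀ x y, N x y = N y x) {κ : ℝ≥0∞} (hκ : ∀ x, ∫⁻ y, a y * N y x ≤ κ) :
    ∫⁻ x, ∫⁻ y, (a x * b x) * ((a y * b y) * N x y) ≤ κ * ∫⁻ x, a x * (b x : ℝ≥0∞) ^ 2 := by
  have hN2 : ∀ x, Measurable (N x) := fun x => hN.of_uncurry_left
  have key : ∫⁻ x, ∫⁻ y, (a x * (b x : ℝ≥0∞) ^ 2) * (a y * N x y)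
      ≤ κ * ∫⁻ x, a x * (b x : ℝ≥0∞) ^ 2 := by
    rw [← lintegral_const_mul (f := fun x => a x * (b x : ℝ≥0∞) ^ 2) _
      (ha.mul (hb.coe_nnreal_ennreal.pow_const 2))]
    refine lintegral_mono fun x => ?_
    rw [lintegral_const_mul (f := fun y => a y * N x y) _ (ha.mul (hN2 x)), mul_comm κ]
    refine mul_le_mul_right ?_ _
    simp only [hsymm x]
    exact hκ x
  have hm : Measurable (Function.uncurry fun x y => (a x * (b x : ℝ≥0∞) ^ 2) * (a y * N x y)) :=
    ((ha.comp measurable_fst).mul ((hb.coe_nnreal_ennreal.pow_const 2).comp measurable_fst)).mul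
      ((ha.comp measurable_snd).mul hN)
  have swap : ∫⁻ x, ∫⁻ y, (a y * (b y : ℝ≥0∞) ^ 2) * (a x * N x y)
      = ∫⁻ x, ∫⁻ y, (a x * (b x : ℝ≥0∞) ^ 2) * (a y * N x y) := by
    rw [lintegral_lintegral_swap]
    · exact lintegral_congr fun x => lintegral_congr fun y => by rw [hsymm]
    · exact (((ha.comp measurable_snd).mul
        ((hb.coe_nnreal_ennreal.pow_const 2).comp measurable_snd)).mul
        ((ha.comp measurable_fst).mul hN)).aemeasurable
  -- From 2 b(x) b(y) ≤ b(x)² + b(y)²; by symmetry of the kernel the two resulting double integrals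
  -- coincide, and each is controlled by `key`.
  have hpt : ∀ x y, 2 * ((a x * b x) * ((a y * b y) * N x y))
      ≤ (a x * (b x : ℝ≥0∞) ^ 2) * (a y * N x y) + (a y * (b y : ℝ≥0∞) ^ 2) * (a x * N x y) := by
    intro x y
    have h1 : (2 * (b x : ℝ≥0∞) * b y) ≤ (b x : ℝ≥0∞) ^ 2 + (b y : ℝ≥0∞) ^ 2 := by
      exact_mod_cast two_mul_le_add_sq (b x) (b y)
    calc 2 * ((a x * b x) * ((a y * b y) * N x y))
        = (a x * a y * N x y) * (2 * (b x : ℝ≥0∞) * b y) := by ring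
      _ ≤ (a x * a y * N x y) * ((b x : ℝ≥0∞) ^ 2 + (b y : ℝ≥0∞) ^ 2) := mul_le_mul_right h1 _
      _ = _ := by ring
  have h2 : 2 * ∫⁻ x, ∫⁻ y, (a x * b x) * ((a y * b y) * N x y)
      ≤ 2 * (κ * ∫⁻ x, a x * (b x : ℝ≥0∞) ^ 2) := by
    calc 2 * ∫⁻ x, ∫⁻ y, (a x * b x) * ((a y * b y) * N x y)
        = ∫⁻ x, ∫⁻ y, 2 * ((a x * b x) * ((a y * b y) * N x y)) := by
          rw [← lintegral_const_mul' _ _ (by simp)]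
          exact lintegral_congr fun x => (lintegral_const_mul' _ _ (by simp)).symm
      _ ≤ ∫⁻ x, ∫⁻ y, ((a x * (b x : ℝ≥0∞) ^ 2) * (a y * N x y)
            + (a y * (b y : ℝ≥0∞) ^ 2) * (a x * N x y)) :=
          lintegral_mono fun x => lintegral_mono fun y => hpt x y
      _ = (∫⁻ x, ∫⁻ y, (a x * (b x : ℝ≥0∞) ^ 2) * (a y * N x y))
            + ∫⁻ x, ∫⁻ y, (a y * (b y : ℝ≥0∞) ^ 2) * (a x * N x y) := by
          have hm' : Measurable fun x => ∫⁻ y, (a x * (b x : ℝ≥0∞) ^ 2) * (a y * N x y) :=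
            hm.lintegral_prod_right'
          rw [← lintegral_add_left hm']
          exact lintegral_congr fun x => lintegral_add_left hm.of_uncurry_left _
      _ ≤ _ := by
          rw [swap, two_mul]
          exact add_le_add key key
  exact (ENNReal.mul_le_mul_iff_right (by simp) (by simp)).1 h2

/-- Cauchy–Schwarz with a free weight; the choice l = κ⁻¹ makes the absorption in
`KatoBound.integral_indicator_le` produce exactly the constant κ. -/
theorem norm_integral_inner_le {E : Type*} [NormedAddCommGroup E] [InnerProductSpace ℂ E]
    {F G : E3 → E} (hF : MemLp F 2 (volume : Measure E3)) (hG : MemLp G 2 (volume : Measure E3))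
    {l : ℝ} (hl : 0 < l) :
    ‖∫ x, (inner ℂ (F x) (G x) : ℂ)‖ ≤ (l * (∫ x, ‖F x‖ ^ 2) + l⁻¹ * ∫ x, ‖G x‖ ^ 2) / 2 := by
  have hF2 := (memLp_two_iff_integrable_sq_norm hF.1).1 hF
  have hG2 := (memLp_two_iff_integrable_sq_norm hG.1).1 hG
  calc ‖∫ x, (inner ℂ (F x) (G x) : ℂ)‖ ≤ ∫ x, ‖(inner ℂ (F x) (G x) : ℂ)‖ :=
        norm_integral_le_integral_norm _
    _ ≤ ∫ x, (l * ‖F x‖ ^ 2 + l⁻¹ * ‖G x‖ ^ 2) / 2 := by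
        refine integral_mono_of_nonneg (Eventually.of_forall fun x => norm_nonneg _)
          (((hF2.const_mul l).add (hG2.const_mul l⁻¹)).div_const 2)
          (Eventually.of_forall fun x => (norm_inner_le_norm _ _).trans ?_)
        have h1 := mul_nonneg (inv_nonneg.2 hl.le) (sq_nonneg (l * ‖F x‖ - ‖G x‖))
        have h2 : l⁻¹ * (l * ‖F x‖ - ‖G x‖) ^ 2
            = l * ‖F x‖ ^ 2 + l⁻¹ * ‖G x‖ ^ 2 - 2 * (‖F x‖ * ‖G x‖) := by
          field_simp
          ring
        simp only
        linarith
    _ = _ := by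
        rw [integral_div, integral_add (hF2.const_mul l) (hG2.const_mul l⁻¹), integral_const_mul,
          integral_const_mul]

variable {V : E3 → ℝ} {κ k : ℝ}

/-- The energy of the Yukawa potential of the restriction of `|V| u` to `S`. -/
theorem KatoBound.energy_le (hV : KatoBound V κ) (hk : 0 < k) {u : E3 → ℂ} (hu : Measurable u)
    {S : Set E3} (hS : MeasurableSet S)
    (hb : BoundedSupport (S.indicator fun x => ((|V x| : ℝ) : ℂ) * u x))
    (hi : Integrable (S.indicator fun x => |V x| * ‖u x‖ ^ 2)) :
    (∫ y, ‖yukawaPotGrad k (S.indicator fun x => ((|V x| : ℝ) : ℂ) * u x) y‖ ^ 2)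
      + k ^ 2 * (∫ y, ‖yukawaPot k (S.indicator fun x => ((|V x| : ℝ) : ℂ) * u x) y‖ ^ 2)
      ≤ κ * ∫ x, S.indicator (fun x => |V x| * ‖u x‖ ^ 2) x := by
  set h := S.indicator fun x => ((|V x| : ℝ) : ℂ) * u x with hh
  -- The equation for G * h is tested with G * h itself: the energy equals ⟨h, G * h⟩, a double
  -- integral that Schur's test bounds because G is below the Newtonian kernel.
  have hid := hb.integral_conj_mul hk (hb.hasWeakGradient_pot hk)
    (integrable_decay_mul_of_memLp (hb.memLp_pot hk))
    (integrable_decay_mul_of_memLp (hb.memLp_potGrad hk))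
  have e1 : (∫ y, (inner ℂ (yukawaPotGrad k h y) (yukawaPotGrad k h y) : ℂ))
      = ((∫ y, ‖yukawaPotGrad k h y‖ ^ 2 : ℝ) : ℂ) := by
    rw [← integral_complex_ofReal]
    congr 1 with y
    rw [inner_self_eq_norm_sq_to_K]
    push_cast
    rfl
  have e2 : (∫ y, conj (yukawaPot k h y) * yukawaPot k h y)
      = ((∫ y, ‖yukawaPot k h y‖ ^ 2 : ℝ) : ℂ) := by
    rw [← integral_complex_ofReal]
    congr 1 with y
    rw [Complex.conj_mul']
    push_cast
    rfl
  rw [e1, e2] at hid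
  set A := (∫ y, ‖yukawaPotGrad k h y‖ ^ 2) + k ^ 2 * (∫ y, ‖yukawaPot k h y‖ ^ 2) with hA
  have hA0 : 0 ≤ A := by
    have h1 : 0 ≤ ∫ y, ‖yukawaPotGrad k h y‖ ^ 2 := integral_nonneg fun y => by positivity
    have h2 : 0 ≤ ∫ y, ‖yukawaPot k h y‖ ^ 2 := integral_nonneg fun y => by positivity
    positivity
  have hid' : ∫ x, conj (h x) * yukawaPot k h x = (A : ℂ) := by
    rw [hid, hA]
    push_cast
    rfl
  have hI0 : 0 ≤ ∫ x, S.indicator (fun x => |V x| * ‖u x‖ ^ 2) x :=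
    integral_nonneg fun x => indicator_nonneg (fun x _ => by positivity) x
  have main : ENNReal.ofReal A
      ≤ ENNReal.ofReal κ * ENNReal.ofReal (∫ x, S.indicator (fun x => |V x| * ‖u x‖ ^ 2) x) := by
    let a : E3 → ℝ≥0∞ := S.indicator fun x => ‖V x‖ₑ
    let b : E3 → NNReal := fun x => ‖u x‖₊
    have ha : Measurable a := hV.meas.enorm.indicator hS
    have hbm : Measurable b := hu.nnnorm
    have hab : ∀ x, ‖h x‖ₑ = a x * b x := fun x => by
      by_cases hx : x ∈ S
      · simp only [hh, a, b, indicator_of_mem hx, enorm_mul]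
        congr 1
        rw [← ofReal_norm, ← ofReal_norm, Complex.norm_real, Real.norm_eq_abs, abs_abs,
          Real.norm_eq_abs]
      · simp [hh, a, indicator_of_notMem hx]
    have hs := lintegral_schur_le (N := fun x y => ‖yukawa k (x - y)‖ₑ) ha hbm
      (((measurable_yukawa k).comp (measurable_fst.sub measurable_snd)).enorm)
      (fun x y => by rw [yukawa_sub_comm]) (κ := ENNReal.ofReal κ) (fun x => by
        refine le_trans (lintegral_mono fun y => ?_) (hV.lintegral_newton_le x)
        refine mul_le_mul' (indicator_le_self _ _ _) (enorm_yukawa_le_newton hk.le _))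
    calc ENNReal.ofReal A = ‖(A : ℂ)‖ₑ := by
          rw [← ofReal_norm, Complex.norm_real, Real.norm_of_nonneg hA0]
      _ ≤ ∫⁻ x, ‖conj (h x) * yukawaPot k h x‖ₑ := by
          rw [← hid']
          exact enorm_integral_le_lintegral_enorm _
      _ ≤ ∫⁻ x, ∫⁻ y, (a x * b x) * ((a y * b y) * ‖yukawa k (x - y)‖ₑ) := by
          refine lintegral_mono fun x => ?_
          simp only [enorm_mul]
          have : ‖conj (h x)‖ₑ = a x * b x := by
            rw [← hab, ← ofReal_norm, ← ofReal_norm, RCLike.norm_conj]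
          have hm : Measurable fun y => (a y * b y) * ‖yukawa k (x - y)‖ₑ :=
            (ha.mul hbm.coe_nnreal_ennreal).mul
              ((measurable_yukawa k).comp (measurable_const.sub measurable_id)).enorm
          rw [this, lintegral_const_mul _ hm]
          refine mul_le_mul_right ((enorm_integral_le_lintegral_enorm _).trans
            (le_of_eq (lintegral_congr fun y => ?_))) _
          rw [enorm_mul, hab]
          congr 1
          rw [← ofReal_norm, ← ofReal_norm, Complex.norm_real]
      _ ≤ _ := hs
      _ = _ := by
          congr 1
          rw [ofReal_integral_eq_lintegral_ofReal hi
            (Eventually.of_forall fun x => indicator_nonneg (fun x _ => by positivity) x)]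
          refine lintegral_congr fun x => ?_
          by_cases hx : x ∈ S
          · simp only [a, b, indicator_of_mem hx]
            rw [ENNReal.ofReal_mul (abs_nonneg _), ENNReal.ofReal_pow (norm_nonneg _),
              ofReal_norm, ← Real.norm_eq_abs, ofReal_norm]
            rfl
          · simp [a, indicator_of_notMem hx]
  rw [← ENNReal.ofReal_mul hV.pos.le] at main
  exact (ENNReal.ofReal_le_ofReal_iff (mul_nonneg hV.pos.le hI0)).1 main

/-- Let h = |V| u on S and I = ∫_S |V||u|². Then I = ⟨h, u⟩ = ⟨∇(G * h), ∇u⟩ + k²⟨G * h, u⟩, which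
is at most half of κ⁻¹ times the energy of G * h plus half of κ times that of u. By
`KatoBound.energy_le` the first half is at most I/2 and is absorbed. -/
theorem KatoBound.integral_indicator_le (hV : KatoBound V κ) (hk : 0 < k) {u : E3 → ℂ}
    (hu : Measurable u) {S : Set E3} (hS : MeasurableSet S)
    (hb : BoundedSupport (S.indicator fun x => ((|V x| : ℝ) : ℂ) * u x))
    (hi : Integrable (S.indicator fun x => |V x| * ‖u x‖ ^ 2))
    {g : E3 → C3} (hug : HasWeakGradient u g) (hu2 : MemLp u 2 (volume : Measure E3))
    (hg2 : MemLp g 2 (volume : Measure E3)) :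
    ∫ x, S.indicator (fun x => |V x| * ‖u x‖ ^ 2) x
      ≤ κ * ((∫ x, ‖g x‖ ^ 2) + k ^ 2 * ∫ x, ‖u x‖ ^ 2) := by
  have hA := hV.energy_le hk hu hS hb hi
  have hid := hb.integral_conj_mul hk hug (integrable_decay_mul_of_memLp hu2)
    (integrable_decay_mul_of_memLp hg2)
  set h := S.indicator fun x => ((|V x| : ℝ) : ℂ) * u x with hh
  set I := ∫ x, S.indicator (fun x => |V x| * ‖u x‖ ^ 2) x with hI
  have hI0 : 0 ≤ I := integral_nonneg fun x => indicator_nonneg (fun x _ => by positivity) x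
  have e : ∫ x, conj (h x) * u x = (I : ℂ) := by
    rw [hI, ← integral_complex_ofReal]
    congr 1 with x
    by_cases hx : x ∈ S
    · simp only [hh, indicator_of_mem hx, map_mul, Complex.conj_ofReal]
      rw [mul_assoc, Complex.conj_mul']
      push_cast
      rfl
    · simp [hh, indicator_of_notMem hx]
  rw [e] at hid
  have hκi : 0 < κ⁻¹ := inv_pos.2 hV.pos
  have b1 := norm_integral_inner_le (hb.memLp_potGrad hk) hg2 hκi
  have b2 := norm_integral_inner_le (hb.memLp_pot hk) hu2 hκi
  have e2 : ∫ y, (inner ℂ (yukawaPot k h y) (u y) : ℂ) = ∫ y, conj (yukawaPot k h y) * u y := by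
    congr 1 with y
    rw [RCLike.inner_apply, mul_comm]
  rw [e2] at b2
  rw [inv_inv] at b1 b2
  have hn : I ≤ ‖∫ y, (inner ℂ (yukawaPotGrad k h y) (g y) : ℂ)‖
      + k ^ 2 * ‖∫ y, conj (yukawaPot k h y) * u y‖ := by
    calc I = ‖(I : ℂ)‖ := by rw [Complex.norm_real, Real.norm_of_nonneg hI0]
      _ ≤ _ := by
        rw [hid]
        refine (norm_add_le _ _).trans (le_of_eq ?_)
        rw [norm_mul, norm_pow, Complex.norm_real, Real.norm_of_nonneg hk.le]
  have b3 := mul_le_mul_of_nonneg_left b2 (sq_nonneg k)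
  have b4 := mul_le_mul_of_nonneg_left hA hκi.le
  rw [← mul_assoc, inv_mul_cancel₀ hV.pos.ne', one_mul] at b4
  linarith

/-- The truncation makes |V| u bounded with bounded support and the left side finite, so the
absorption is legitimate; then k → 0⁺ removes the mass term. -/
theorem KatoBound.setLIntegral_le_aux (hV : KatoBound V κ) {u : E3 → ℂ}
    (hu : Measurable u) {g : E3 → C3} (hug : HasWeakGradient u g)
    (hu2 : MemLp u 2 (volume : Measure E3)) (hg2 : MemLp g 2 (volume : Measure E3)) (n : ℕ) :
    ∫⁻ x in {x | |V x| ≤ n ∧ ‖u x‖ ≤ n ∧ ‖x‖ < n}, ENNReal.ofReal (|V x| * ‖u x‖ ^ 2)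
      ≤ ENNReal.ofReal (κ * ∫ x, ‖g x‖ ^ 2) := by
  set S := {x : E3 | |V x| ≤ n ∧ ‖u x‖ ≤ n ∧ ‖x‖ < n} with hS'
  have hn0 : (0 : ℝ) ≤ n := Nat.cast_nonneg n
  have hS : MeasurableSet S :=
    (measurableSet_le hV.meas.abs measurable_const).inter
      ((measurableSet_le hu.norm measurable_const).inter
        (measurableSet_lt measurable_norm measurable_const))
  have hb : BoundedSupport (S.indicator fun x => ((|V x| : ℝ) : ℂ) * u x) := by
    refine ⟨?_, n * n, n, fun x => ?_, fun x hx => ?_⟩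
    · exact (((Complex.measurable_ofReal.comp hV.meas.abs).mul hu).indicator
        hS).aestronglyMeasurable
    · by_cases hx : x ∈ S
      · rw [indicator_of_mem hx, norm_mul, Complex.norm_real, Real.norm_eq_abs, abs_abs]
        exact mul_le_mul hx.1 hx.2.1 (norm_nonneg _) hn0
      · rw [indicator_of_notMem hx, norm_zero]
        positivity
    · exact indicator_of_notMem (fun h => absurd h.2.2 (not_lt.2 hx)) _
  have hfin : volume S < ⊤ :=
    (measure_mono fun x hx => by simpa using hx.2.2).trans_lt
      (measure_ball_lt_top (x := (0 : E3)) (r := n))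
  have hi : Integrable (S.indicator fun x => |V x| * ‖u x‖ ^ 2) := by
    refine (integrable_indicator_iff hS).2 ?_
    refine Measure.integrableOn_of_bounded (M := n * n ^ 2) hfin.ne
      ((hV.meas.abs.mul (hu.norm.pow_const 2)).aestronglyMeasurable) ?_
    refine (ae_restrict_iff' hS).2 (Eventually.of_forall fun x hx => ?_)
    rw [norm_mul, Real.norm_eq_abs, abs_abs, norm_pow, norm_norm]
    exact mul_le_mul hx.1 (pow_le_pow_left₀ (norm_nonneg _) hx.2.1 2) (by positivity) hn0
  have hle : ∫ x, S.indicator (fun x => |V x| * ‖u x‖ ^ 2) x ≤ κ * ∫ x, ‖g x‖ ^ 2 := by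
    have hl : Tendsto (fun k : ℝ => κ * ((∫ x, ‖g x‖ ^ 2) + k ^ 2 * ∫ x, ‖u x‖ ^ 2)) (𝓝[>] 0)
        (𝓝 (κ * ((∫ x, ‖g x‖ ^ 2) + 0 ^ 2 * ∫ x, ‖u x‖ ^ 2))) := by
      refine Tendsto.mono_left (Continuous.tendsto ?_ 0) nhdsWithin_le_nhds
      fun_prop
    have := ge_of_tendsto hl (eventually_nhdsWithin_of_forall fun k hk =>
      hV.integral_indicator_le hk hu hS hb hi hug hu2 hg2)
    simpa using this
  rw [integral_indicator hS] at hle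
  rw [← ofReal_integral_eq_lintegral_ofReal ((integrable_indicator_iff hS).1 hi)
    (Eventually.of_forall fun x => by positivity)]
  exact ENNReal.ofReal_le_ofReal hle

/-- The Kato inequality `∫ |V| |u|² ≤ κ ∫ |∇u|²` on `H¹(ℝ³)`. -/
theorem KatoBound.integral_le (hV : KatoBound V κ) {u : E3 → ℂ} {g : E3 → C3}
    (hug : HasWeakGradient u g) (hu2 : MemLp u 2 (volume : Measure E3))
    (hg2 : MemLp g 2 (volume : Measure E3)) :
    Integrable (fun x => |V x| * ‖u x‖ ^ 2) ∧
      ∫ x, |V x| * ‖u x‖ ^ 2 ≤ κ * ∫ x, ‖g x‖ ^ 2 := by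
  wlog hu : Measurable u generalizing u
  · have hm := hu2.1.aemeasurable
    have hae := hm.ae_eq_mk
    have h1 := this (hug.congr hae Filter.EventuallyEq.rfl) (hu2.ae_eq hae) hm.measurable_mk
    have hc : (fun x => |V x| * ‖u x‖ ^ 2) =ᵐ[volume] fun x => |V x| * ‖hm.mk u x‖ ^ 2 := by
      filter_upwards [hae] with x hx
      rw [hx]
    exact ⟨h1.1.congr hc.symm, (integral_congr_ae hc).trans_le h1.2⟩
  -- The truncation sets increase to the whole space and the bound does not depend on n, so monotone
  -- convergence yields integrability and the inequality together.
  have hmono : Monotone fun n : ℕ => {x : E3 | |V x| ≤ n ∧ ‖u x‖ ≤ n ∧ ‖x‖ < n} := by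
    intro n m hnm x hx
    have : (n : ℝ) ≤ m := by exact_mod_cast hnm
    exact ⟨hx.1.trans this, hx.2.1.trans this, hx.2.2.trans_le this⟩
  have hU : (⋃ n : ℕ, {x : E3 | |V x| ≤ n ∧ ‖u x‖ ≤ n ∧ ‖x‖ < n}) = univ := by
    refine eq_univ_of_forall fun x => mem_iUnion.2 ?_
    obtain ⟨n, hn⟩ := exists_nat_gt (|V x| + ‖u x‖ + ‖x‖)
    have := abs_nonneg (V x)
    have := norm_nonneg (u x)
    have := norm_nonneg x
    exact ⟨n, by linarith, by linarith, by linarith⟩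
  have hle : ∫⁻ x, ENNReal.ofReal (|V x| * ‖u x‖ ^ 2) ≤ ENNReal.ofReal (κ * ∫ x, ‖g x‖ ^ 2) := by
    rw [← setLIntegral_univ, ← hU, setLIntegral_iUnion_of_directed _ hmono.directed_le]
    exact iSup_le fun n => hV.setLIntegral_le_aux hu hug hu2 hg2 n
  have hm : AEStronglyMeasurable (fun x => |V x| * ‖u x‖ ^ 2) (volume : Measure E3) :=
    (hV.meas.abs.mul (hu.norm.pow_const 2)).aestronglyMeasurable
  have hint : Integrable fun x => |V x| * ‖u x‖ ^ 2 := by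
    refine ⟨hm, ?_⟩
    rw [hasFiniteIntegral_iff_ofReal (Eventually.of_forall fun x => by positivity)]
    exact hle.trans_lt ENNReal.ofReal_lt_top
  refine ⟨hint, ?_⟩
  rw [← ofReal_integral_eq_lintegral_ofReal hint
    (Eventually.of_forall fun x => by positivity)] at hle
  refine (ENNReal.ofReal_le_ofReal_iff (mul_nonneg hV.pos.le ?_)).1 hle
  exact integral_nonneg fun x => by positivity

end KatoInequality

/-! ### An operator recovered from its bounded resolvent. -/

section Resolvent

variable {X : Type*} [NormedAddCommGroup X] [InnerProductSpace ℂ X]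

/-- `R` is a symmetric injective operator with `0 ≤ R ≤ 1`, and `g` is the graph of `R⁻¹ - 1`. -/
structure IsResolventOf (g : Submodule ℂ (X × X)) (R : X →L[ℂ] X) : Prop where
  mem_iff : ∀ u h, (u, h) ∈ g ↔ R (h + u) = u
  inj : ∀ f, R f = 0 → f = 0
  symm : ∀ f f', (inner ℂ (R f) f' : ℂ) = inner ℂ f (R f')
  norm_sq_le : ∀ f, ‖R f‖ ^ 2 ≤ (inner ℂ (R f) f : ℂ).re

namespace IsResolventOf

variable {g : Submodule ℂ (X × X)} {R : X →L[ℂ] X}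

theorem snd_eq_zero (h : IsResolventOf g R) (x : X × X) (hx : x ∈ g) (hx' : x.1 = 0) : x.2 = 0 := by
  have := (h.mem_iff x.1 x.2).1 hx
  rw [hx', add_zero] at this
  exact h.inj _ this

theorem graph_eq (h : IsResolventOf g R) : g.toLinearPMap.graph = g :=
  Submodule.toLinearPMap_graph_eq g h.snd_eq_zero

theorem mem_domain_iff (h : IsResolventOf g R) (u : X) :
    u ∈ g.toLinearPMap.domain ↔ ∃ f, R f = u := by
  rw [Submodule.toLinearPMap_domain, Submodule.mem_map]
  constructor
  · rintro ⟨⟨u', k⟩, hx, rfl⟩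
    exact ⟨_, (h.mem_iff _ _).1 hx⟩
  · rintro ⟨f, rfl⟩
    exact ⟨(R f, f - R f), (h.mem_iff _ _).2 (by rw [sub_add_cancel]), rfl⟩

theorem apply_eq (h : IsResolventOf g R) (u : g.toLinearPMap.domain) :
    R (g.toLinearPMap u + u) = u := by
  rw [← h.mem_iff]
  exact Submodule.mem_graph_toLinearPMap h.snd_eq_zero u

theorem norm_le_one (h : IsResolventOf g R) : ‖R‖ ≤ 1 := by
  refine R.opNorm_le_bound zero_le_one fun f => ?_
  rw [one_mul]
  rcases (norm_nonneg (R f)).eq_or_lt with h0 | h0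
  · rw [← h0]; exact norm_nonneg f
  · have h1 := (h.norm_sq_le f).trans ((Complex.re_le_norm _).trans (norm_inner_le_norm _ _))
    rw [sq] at h1
    exact le_of_mul_le_mul_left h1 h0

/-- With f = Au + u one has Rf = u, and ‖Rf‖² ≤ Re⟨Rf, f⟩ reads ‖u‖² ≤ Re⟨u, Au⟩ + ‖u‖². -/
theorem re_inner_nonneg (h : IsResolventOf g R) (u : g.toLinearPMap.domain) :
    0 ≤ (inner ℂ (u : X) (g.toLinearPMap u) : ℂ).re := by
  have h1 := h.norm_sq_le (g.toLinearPMap u + u)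
  rw [h.apply_eq, inner_add_right, Complex.add_re] at h1
  have h2 : (inner ℂ (u : X) (u : X) : ℂ).re = ‖(u : X)‖ ^ 2 := by
    have := inner_self_eq_norm_sq (𝕜 := ℂ) (u : X)
    simpa using this
  linarith

theorem isShiftedInverse (h : IsResolventOf g R) : IsShiftedInverse g.toLinearPMap R := by
  intro f u
  constructor
  · rintro rfl
    have hm : R f ∈ g.toLinearPMap.domain := (h.mem_domain_iff _).2 ⟨f, rfl⟩
    refine ⟨hm, ?_⟩
    have h1 := h.apply_eq ⟨R f, hm⟩
    simp only at h1
    rw [← sub_eq_zero, ← map_sub] at h1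
    exact sub_eq_zero.1 (h.inj _ h1)
  · rintro ⟨hu, rfl⟩
    exact h.apply_eq ⟨u, hu⟩

/-- The choice in `shiftedInverse` is harmless: the equivalence in `IsShiftedInverse` determines the
operator. -/
theorem shiftedInverse_eq (h : IsResolventOf g R) : shiftedInverse g.toLinearPMap = R := by
  have hex : ∃ R, IsShiftedInverse g.toLinearPMap R := ⟨R, h.isShiftedInverse⟩
  rw [shiftedInverse, dif_pos hex]
  ext f
  exact (hex.choose_spec f (R f)).2 ((h.isShiftedInverse f (R f)).1 rfl)

variable [CompleteSpace X]

/-- A vector x orthogonal to the range of R satisfies ‖Rx‖² = ⟨R(Rx), x⟩ = 0, hence x = 0 by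
injectivity. -/
theorem dense_domain (h : IsResolventOf g R) : Dense (g.toLinearPMap.domain : Set X) := by
  rw [Submodule.dense_iff_topologicalClosure_eq_top, Submodule.topologicalClosure_eq_top_iff,
    Submodule.eq_bot_iff]
  intro x hx
  apply h.inj
  have h1 := (Submodule.mem_orthogonal _ _).1 hx (R (R x)) ((h.mem_domain_iff _).2 ⟨_, rfl⟩)
  rw [h.symm] at h1
  exact inner_self_eq_zero.1 h1

/-- The graph consists of the pairs (Rf, f - Rf). By symmetry of R, pairing (a, b) with all of them
amounts to ⟨f, a⟩ = ⟨f, R(b + a)⟩ for every f, that is a = R(b + a), which is membership in the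
graph itself. -/
theorem isSelfAdjoint (h : IsResolventOf g R) : IsSelfAdjoint g.toLinearPMap := by
  rw [LinearPMap.isSelfAdjoint_def]
  refine LinearPMap.eq_of_eq_graph ?_
  rw [LinearPMap.adjoint_graph_eq_graph_adjoint h.dense_domain, h.graph_eq]
  ext ⟨a, b⟩
  rw [Submodule.mem_adjoint_iff, h.mem_iff]
  have key : (∀ u k, (u, k) ∈ g → (inner ℂ k a : ℂ) - inner ℂ u b = 0)
      ↔ ∀ f, (inner ℂ f a : ℂ) = inner ℂ f (R (b + a)) := by
    constructor
    · intro H f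
      have h1 := H (R f) (f - R f) ((h.mem_iff _ _).2 (by rw [sub_add_cancel]))
      rw [← h.symm, inner_add_right]
      rw [inner_sub_left] at h1
      linear_combination h1
    · intro H u k huk
      have h2 := (h.mem_iff _ _).1 huk
      have h1 := H (k + u)
      rw [← h.symm, h2, inner_add_right, inner_add_left] at h1
      linear_combination h1
  constructor
  · intro H
    exact (ext_inner_left ℂ fun f => key.1 H f).symm
  · intro H
    exact key.2 fun f => by rw [H]

theorem isSelfAdjoint_resolvent (h : IsResolventOf g R) : IsSelfAdjoint R := by
  rw [ContinuousLinearMap.isSelfAdjoint_iff_isSymmetric]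
  exact fun f f' => h.symm f f'

/-- From R ≥ 0 and ‖R‖ ≤ 1. Functions of R thus depend only on their values on [0, 1], the set on
which `resolventSine` is shown to be continuous. -/
theorem spectrum_subset (h : IsResolventOf g R) :
    spectrum ℝ R ⊆ Set.Icc 0 1 := by
  intro r hr
  have hpos : 0 ≤ R := by
    rw [ContinuousLinearMap.nonneg_iff_isPositive, ContinuousLinearMap.isPositive_def']
    exact ⟨h.isSelfAdjoint_resolvent, fun f => (sq_nonneg _).trans (h.norm_sq_le f)⟩
  refine ⟨spectrum_nonneg_of_nonneg hpos hr, ?_⟩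
  have h1 := spectrum.norm_le_norm_mul_of_mem hr
  exact (le_abs_self r).trans (h1.trans (mul_le_one₀ h.norm_le_one (norm_nonneg _)
    ContinuousLinearMap.norm_id_le))

end IsResolventOf

end Resolvent

/-! ### H¹ as a Hilbert space, and the potential as an operator on it. -/

section FormSpace

open Set Filter Topology

theorem Lp.locallyIntegrable_two {F : Type*} [NormedAddCommGroup F]
    (f : Lp F 2 (volume : Measure E3)) : LocallyIntegrable f :=
  (Lp.memLp f).locallyIntegrable (by norm_num)

/-- Turns each identity defining a weak gradient into an equation between inner products with fixed
vectors, a closed condition; this is what makes H¹ complete. -/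
theorem exists_inner_eq_integral {a : E3 → ℝ} (ha : Continuous a) (hc : HasCompactSupport a) :
    ∃ A : L2, ∀ f : L2, (inner ℂ A f : ℂ) = ∫ x, (a x : ℂ) * f x := by
  have hm : MemLp (fun x => (a x : ℂ)) 2 (volume : Measure E3) :=
    (Complex.continuous_ofReal.comp ha).memLp_of_hasCompactSupport
      (hc.comp_left Complex.ofReal_zero)
  refine ⟨hm.toLp _, fun f => ?_⟩
  rw [L2.inner_def]
  refine integral_congr_ae ?_
  filter_upwards [hm.coeFn_toLp] with x hx
  rw [hx, RCLike.inner_apply, Complex.conj_ofReal, mul_comm]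

theorem exists_inner_eq_integral_apply {a : E3 → ℝ} (ha : Continuous a)
    (hc : HasCompactSupport a) (i : Fin 3) :
    ∃ A : L2vec, ∀ f : L2vec, (inner ℂ A f : ℂ) = ∫ x, (a x : ℂ) * f x i := by
  have hm : MemLp (fun x => EuclideanSpace.single i (a x : ℂ)) 2 (volume : Measure E3) := by
    refine Continuous.memLp_of_hasCompactSupport ?_ (hc.comp_left (g := fun r : ℝ =>
      (EuclideanSpace.single i (r : ℂ) : C3)) (by simp))
    have h1 : Continuous fun c : ℂ => (EuclideanSpace.single i c : C3) := by
      exact (PiLp.continuous_toLp 2 _).comp (continuous_single (A := fun _ : Fin 3 => ℂ) i)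
    exact h1.comp (Complex.continuous_ofReal.comp ha)
  refine ⟨hm.toLp _, fun f => ?_⟩
  rw [L2.inner_def]
  refine integral_congr_ae ?_
  filter_upwards [hm.coeFn_toLp] with x hx
  rw [hx, EuclideanSpace.inner_single_left, Complex.conj_ofReal]

/-- The Sobolev space `H¹(ℝ³)`, as the space of pairs `(u, ∇u)` in `L² × L²`. -/
def formSpace : Submodule ℂ (WithLp 2 (L2 × L2vec)) where
  carrier := {p | HasWeakGradient p.fst p.snd}
  zero_mem' := (InFormDomain.zero 0).grad
  add_mem' := fun {p q} hp hq =>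
    (HasWeakGradient.add hp hq).congr (Lp.coeFn_add p.fst q.fst).symm (Lp.coeFn_add p.snd q.snd).symm
  smul_mem' := fun c p hp =>
    (HasWeakGradient.const_smul c hp).congr (Lp.coeFn_smul c p.fst).symm
      (Lp.coeFn_smul c p.snd).symm

theorem isClosed_formSpace : IsClosed (formSpace : Set (WithLp 2 (L2 × L2vec))) := by
  have h : (formSpace : Set (WithLp 2 (L2 × L2vec))) = {p | ∀ φ : E3 → ℝ, ∀ _ : ContDiff ℝ ∞ φ,
      ∀ _ : HasCompactSupport φ, ∀ i : Fin 3,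
      ∫ x, ((fderiv ℝ φ x (EuclideanSpace.single i 1) : ℝ) : ℂ) * p.fst x
        = - ∫ x, (φ x : ℂ) * p.snd x i} := by
    ext p
    exact ⟨fun hp => HasWeakGradient.integral_eq hp, fun hp =>
      ⟨Lp.locallyIntegrable_two _, Lp.locallyIntegrable_two _, hp⟩⟩
  rw [h]
  simp only [ofPred_forall]
  refine isClosed_iInter fun φ => isClosed_iInter fun hφ => isClosed_iInter fun hc =>
    isClosed_iInter fun i => ?_
  obtain ⟨A, hA⟩ := exists_inner_eq_integral (a := fun x => fderiv ℝ φ x (EuclideanSpace.single i 1))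
    ((hφ.continuous_fderiv (by simp)).clm_apply continuous_const) (hc.fderiv_apply (𝕜 := ℝ) _)
  obtain ⟨B, hB⟩ := exists_inner_eq_integral_apply hφ.continuous hc i
  simp only [← hA, ← hB]
  exact isClosed_eq
    (continuous_const.inner (WithLp.fstL 2 ℂ L2 L2vec).continuous)
    (continuous_const.inner (WithLp.sndL 2 ℂ L2 L2vec).continuous).neg

instance completeSpace_formSpace : CompleteSpace formSpace :=
  isClosed_formSpace.completeSpace_coe

/-- The embedding of `H¹` into `L²`. -/
def formSpaceFst : formSpace →L[ℂ] L2 := (WithLp.fstL 2 ℂ L2 L2vec).comp formSpace.subtypeL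

theorem formSpaceFst_apply (p : formSpace) : formSpaceFst p = p.1.fst := rfl

theorem norm_sq_L2 {F : Type*} [NormedAddCommGroup F] [InnerProductSpace ℂ F]
    (f : Lp F 2 (volume : Measure E3)) : ‖f‖ ^ 2 = ∫ x, ‖f x‖ ^ 2 := by
  have h := inner_self_eq_norm_sq_to_K (𝕜 := ℂ) f
  rw [L2.inner_def] at h
  have e : ∀ x, (inner ℂ (f x) (f x) : ℂ) = ((‖f x‖ ^ 2 : ℝ) : ℂ) := fun x => by
    rw [inner_self_eq_norm_sq_to_K]
    push_cast
    rfl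
  simp only [e] at h
  rw [integral_complex_ofReal] at h
  have h2 : ((∫ x, ‖f x‖ ^ 2 : ℝ) : ℂ) = ((‖f‖ ^ 2 : ℝ) : ℂ) := by
    rw [h]
    push_cast
    rfl
  exact_mod_cast h2.symm

variable {V : E3 → ℝ} {κ : ℝ}

theorem KatoBound.memLp_weight (hV : KatoBound V κ) {w : E3 → ℝ} (hw : Measurable w)
    (hwV : ∀ x, w x ^ 2 = |V x|) (p : formSpace) :
    MemLp (fun x => (w x : ℂ) * p.1.fst x) 2 (volume : Measure E3) := by
  have h := hV.integral_le p.2 (Lp.memLp _) (Lp.memLp _)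
  rw [memLp_two_iff_integrable_sq_norm]
  · refine h.1.congr (Eventually.of_forall fun x => ?_)
    simp only
    rw [norm_mul, Complex.norm_real, mul_pow, Real.norm_eq_abs, sq_abs, hwV]
  · exact (Complex.measurable_ofReal.comp hw).aestronglyMeasurable.mul (Lp.aestronglyMeasurable _)

/-- Multiplication by a function `w` with `w² = |V|`, as an operator from `H¹` to `L²`. -/
def KatoBound.weightMap (hV : KatoBound V κ) {w : E3 → ℝ} (hw : Measurable w)
    (hwV : ∀ x, w x ^ 2 = |V x|) : formSpace →L[ℂ] L2 :=
  LinearMap.mkContinuous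
    { toFun := fun p => (hV.memLp_weight hw hwV p).toLp _
      map_add' := fun p q => by
        rw [← MemLp.toLp_add]
        refine MemLp.toLp_congr _ _ ?_
        filter_upwards [Lp.coeFn_add p.1.fst q.1.fst] with x hx
        change (w x : ℂ) * (p.1.fst + q.1.fst : L2) x = _
        rw [hx]
        simp [mul_add]
      map_smul' := fun c p => by
        rw [RingHom.id_apply, ← MemLp.toLp_const_smul]
        refine MemLp.toLp_congr _ _ ?_
        filter_upwards [Lp.coeFn_smul c p.1.fst] with x hx
        change (w x : ℂ) * (c • p.1.fst : L2) x = _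
        rw [hx]
        simp [mul_left_comm] }
    √κ fun p => by
      have h := hV.integral_le p.2 (Lp.memLp _) (Lp.memLp _)
      have h1 : ‖(hV.memLp_weight hw hwV p).toLp _‖ ^ 2 = ∫ x, |V x| * ‖p.1.fst x‖ ^ 2 := by
        rw [norm_sq_L2]
        refine integral_congr_ae ?_
        filter_upwards [(hV.memLp_weight hw hwV p).coeFn_toLp] with x hx
        rw [hx, norm_mul, Complex.norm_real, mul_pow, Real.norm_eq_abs, sq_abs, hwV]
      have h2 : ‖p‖ ^ 2 = ‖p.1.fst‖ ^ 2 + ‖p.1.snd‖ ^ 2 := WithLp.prod_norm_sq_eq_of_L2 p.1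
      refine le_of_sq_le_sq ?_ (by positivity)
      rw [mul_pow, Real.sq_sqrt hV.pos.le]
      refine h1.le.trans (h.2.trans ?_)
      rw [← norm_sq_L2, h2]
      exact mul_le_mul_of_nonneg_left (by linarith [sq_nonneg ‖p.1.fst‖]) hV.pos.le

theorem KatoBound.weightMap_ae (hV : KatoBound V κ) {w : E3 → ℝ} (hw : Measurable w)
    (hwV : ∀ x, w x ^ 2 = |V x|) (p : formSpace) :
    hV.weightMap hw hwV p =ᵐ[volume] fun x => (w x : ℂ) * p.1.fst x :=
  (hV.memLp_weight hw hwV p).coeFn_toLp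

theorem KatoBound.norm_weightMap_le (hV : KatoBound V κ) {w : E3 → ℝ} (hw : Measurable w)
    (hwV : ∀ x, w x ^ 2 = |V x|) : ‖hV.weightMap hw hwV‖ ≤ √κ :=
  LinearMap.mkContinuous_norm_le _ (Real.sqrt_nonneg κ) _

/-- The operator `T` on `H¹` with `⟪p, T q⟫ = ∫ V p̄ q`. -/
theorem KatoBound.exists_form_operator (hV : KatoBound V κ) :
    ∃ T : formSpace →L[ℂ] formSpace, ‖T‖ ≤ κ ∧ ∀ p q : formSpace,
      (inner ℂ p (T q) : ℂ) = ∫ x, (V x : ℂ) * (conj (p.1.fst x) * q.1.fst x) := by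
  have hw₁ : Measurable fun x => √|V x| := hV.meas.abs.sqrt
  have hw₂ : Measurable fun x => V x / √|V x| := hV.meas.div hw₁
  have hs₁ : ∀ x, √|V x| ^ 2 = |V x| := fun x => Real.sq_sqrt (abs_nonneg _)
  have hs₂ : ∀ x, (V x / √|V x|) ^ 2 = |V x| := fun x => by
    rw [div_pow, hs₁, ← sq_abs, sq, mul_self_div_self]
  -- V is split as (V / √|V|) · √|V|. By the Kato inequality each factor maps H¹ to L² with norm at
  -- most √κ, so T = J₁* J₂ has norm at most κ.
  let J₁ := hV.weightMap hw₁ hs₁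
  let J₂ := hV.weightMap hw₂ hs₂
  refine ⟨(ContinuousLinearMap.adjoint J₁).comp J₂, ?_, fun p q => ?_⟩
  · refine (ContinuousLinearMap.opNorm_comp_le _ _).trans ?_
    rw [LinearIsometryEquiv.norm_map]
    calc ‖J₁‖ * ‖J₂‖ ≤ √κ * √κ := mul_le_mul (hV.norm_weightMap_le _ _)
          (hV.norm_weightMap_le _ _) (norm_nonneg J₂) (Real.sqrt_nonneg _)
      _ = κ := Real.mul_self_sqrt hV.pos.le
  · rw [ContinuousLinearMap.comp_apply, ContinuousLinearMap.adjoint_inner_right, L2.inner_def]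
    refine integral_congr_ae ?_
    filter_upwards [hV.weightMap_ae hw₁ hs₁ p, hV.weightMap_ae hw₂ hs₂ q] with x h1 h2
    rw [h1, h2, RCLike.inner_apply]
    have h3 : V x = V x / √|V x| * √|V x| := by
      rcases eq_or_ne (V x) 0 with h | h
      · simp [h]
      · have : √|V x| ≠ 0 := (Real.sqrt_pos.2 (abs_pos.2 h)).ne'
        field_simp
    have h4 : (V x : ℂ) = ((V x / √|V x| : ℝ) : ℂ) * ((√|V x| : ℝ) : ℂ) := by
      rw [← Complex.ofReal_mul, ← h3]
    rw [h4, map_mul, Complex.conj_ofReal]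
    ring

end FormSpace

/-! ### The operator of a small form perturbation of a Hilbert space inner product. -/

section AbstractForm

variable {M X : Type*} [NormedAddCommGroup M] [InnerProductSpace ℂ M] [CompleteSpace M]
  [NormedAddCommGroup X] [InnerProductSpace ℂ X] [CompleteSpace X]

/-- The operator associated with the form `⟪p, q⟫ + ⟪p, T q⟫ - ⟪ι p, ι q⟫` on a Hilbert space `M`
with an embedding `ι` into `X`. -/
theorem exists_isResolventOf {ι : M →L[ℂ] X} {T : M →L[ℂ] M} {g : Submodule ℂ (X × X)}
    (hT : ‖T‖ < 1) (hsymm : ∀ p q, (inner ℂ (T p) q : ℂ) = inner ℂ p (T q))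
    (hι : ∀ p, ‖ι p‖ ^ 2 ≤ (inner ℂ p p + inner ℂ p (T p) : ℂ).re)
    (hdense : ∀ f, (∀ p, (inner ℂ (ι p) f : ℂ) = 0) → f = 0)
    (hg : ∀ u h, (u, h) ∈ g ↔ ∃ p, ι p = u ∧
      ∀ q, (inner ℂ q p + inner ℂ q (T p) : ℂ) = inner ℂ (ι q) h + inner ℂ (ι q) u) :
    ∃ R : X →L[ℂ] X, IsResolventOf g R := by
  -- The form is ⟨q, (1 + T) p⟩, and a Neumann series inverts 1 + T because ‖T‖ < 1; the resolvent
  -- will be R = ι (1 + T)⁻¹ ι*.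
  have hunit : IsUnit (1 + T) := by
    have := isUnit_one_sub_of_norm_lt_one (x := -T) (by rwa [norm_neg])
    rwa [sub_neg_eq_add] at this
  obtain ⟨U, hU⟩ := hunit
  let W : M →L[ℂ] M := ↑U⁻¹
  have hW₁ : ∀ p, (1 + T) (W p) = p := fun p => by
    have : (1 + T) * W = 1 := by rw [← hU]; exact U.mul_inv
    exact congrArg (fun A : M →L[ℂ] M => A p) this
  have hW₂ : ∀ p, W ((1 + T) p) = p := fun p => by
    have : W * (1 + T) = 1 := by rw [← hU]; exact U.inv_mul
    exact congrArg (fun A : M →L[ℂ] M => A p) this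
  let ι' := ContinuousLinearMap.adjoint ι
  have hι' : ∀ p f, (inner ℂ p (ι' f) : ℂ) = inner ℂ (ι p) f := fun p f =>
    ContinuousLinearMap.adjoint_inner_right _ _ _
  have happ : ∀ p, (1 + T) p = p + T p := fun p => rfl
  have hchar : ∀ p f, W (ι' f) = p ↔ ∀ q,
      (inner ℂ q p : ℂ) + inner ℂ q (T p) = inner ℂ (ι q) f := by
    intro p f
    constructor
    · rintro rfl q
      rw [← inner_add_right, ← happ, hW₁, hι']
    · intro H
      have : (1 + T) p = ι' f := by
        refine ext_inner_left ℂ fun q => ?_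
        rw [happ, inner_add_right, H, hι']
      rw [← this, hW₂]
  have hRi : ∀ f, (inner ℂ (ι (W (ι' f))) f : ℂ)
      = inner ℂ (W (ι' f)) (W (ι' f)) + inner ℂ (W (ι' f)) (T (W (ι' f))) := fun f => by
    rw [(hchar _ f).1 rfl]
  refine ⟨(ι.comp W).comp ι', ⟨fun u h => ?_, fun f hf => ?_, fun f f' => ?_, fun f => ?_⟩⟩
  · rw [hg]
    simp only [← inner_add_right, ContinuousLinearMap.comp_apply]
    constructor
    · rintro ⟨p, hp, H⟩
      rw [(hchar p (h + u)).2 fun q => by rw [← inner_add_right]; exact H q, hp]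
    · intro H
      exact ⟨_, H, fun q => by rw [inner_add_right]; exact (hchar _ _).1 rfl q⟩
  · have hf' : ι (W (ι' f)) = 0 := hf
    have h1 := hRi f
    rw [hf', inner_zero_left] at h1
    have h2 : ‖(inner ℂ (W (ι' f)) (T (W (ι' f))) : ℂ)‖ ≤ ‖T‖ * ‖W (ι' f)‖ ^ 2 := by
      refine (norm_inner_le_norm _ _).trans ?_
      have := mul_le_mul_of_nonneg_left (T.le_opNorm (W (ι' f))) (norm_nonneg (W (ι' f)))
      refine this.trans (le_of_eq (by ring))
    have h3 : ‖W (ι' f)‖ ^ 2 = ‖(inner ℂ (W (ι' f)) (T (W (ι' f))) : ℂ)‖ := by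
      have h4 := congrArg norm (eq_neg_of_add_eq_zero_left h1.symm)
      rw [norm_neg, inner_self_eq_norm_sq_to_K] at h4
      simpa using h4
    -- With p = W (ι' f), the identity ‖p‖² = |⟨p, T p⟩| and ‖T‖ < 1 force p = 0; then ι* f = 0, and
    -- density of the range of ι gives f = 0.
    have h5 : W (ι' f) = 0 := by
      by_contra h0
      have : 0 < ‖W (ι' f)‖ ^ 2 := by positivity
      nlinarith
    have h8 : ι' f = 0 := by rw [← hW₁ (ι' f), h5, map_zero]
    exact hdense f fun p => by rw [← hι', h8, inner_zero_right]
  · have h1 := (hchar _ f').1 rfl (W (ι' f))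
    have h2 := (hchar _ f).1 rfl (W (ι' f'))
    simp only [ContinuousLinearMap.comp_apply]
    rw [← inner_conj_symm f (ι (W (ι' f'))), ← h2, map_add, inner_conj_symm, inner_conj_symm,
      hsymm, ← h1]
  · simp only [ContinuousLinearMap.comp_apply]
    rw [hRi]
    exact hι _

end AbstractForm

/-! ### The resolvent of the Schrödinger operator. -/

section SchrodingerResolvent

open Set Filter Topology

variable {V : E3 → ℝ} {κ : ℝ}

/-- By the Kato inequality the condition on V|u|² is automatic: the form domain is all of H¹. -/
theorem KatoBound.inFormDomain (hV : KatoBound V κ) {u : L2} {G : L2vec}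
    (h : HasWeakGradient u G) : InFormDomain V u G where
  grad := h
  pot := by
    refine (hV.integral_le h (Lp.memLp _) (Lp.memLp _)).1.mono
      (hV.meas.aestronglyMeasurable.mul ((Lp.aestronglyMeasurable u).norm.pow 2))
      (Eventually.of_forall fun x => ?_)
    simp

/-- A smooth function with compact support has its classical gradient as weak gradient. -/
theorem exists_formSpace_of_contDiff {φ : E3 → ℝ} (hφ : ContDiff ℝ ∞ φ) (hc : HasCompactSupport φ) :
    ∃ p : formSpace, p.1.fst =ᵐ[volume] fun x => (φ x : ℂ) := by
  let G : E3 → C3 := fun x => cplx (WithLp.toLp 2 fun i => fderiv ℝ φ x (EuclideanSpace.single i 1))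
  have hd : ∀ i, Continuous fun x => fderiv ℝ φ x (EuclideanSpace.single i 1) := fun i =>
    (hφ.continuous_fderiv (by simp)).clm_apply continuous_const
  have hG : Continuous G := continuous_cplx.comp
    ((PiLp.continuous_toLp 2 _).comp (continuous_pi fun i => hd i))
  have hGc : HasCompactSupport G := by
    refine (hc.fderiv (𝕜 := ℝ)).mono' ?_
    intro x hx
    refine subset_closure fun h0 => hx ?_
    simp only [G, h0, zero_apply]
    ext i
    simp [cplx_apply]
  have hφ2 : MemLp (fun x => (φ x : ℂ)) 2 (volume : Measure E3) :=
    (Complex.continuous_ofReal.comp hφ.continuous).memLp_of_hasCompactSupport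
      (hc.comp_left Complex.ofReal_zero)
  have hG2 : MemLp G 2 (volume : Measure E3) := hG.memLp_of_hasCompactSupport hGc
  have hw : HasWeakGradient (fun x => (φ x : ℂ)) G := by
    refine ⟨hφ2.locallyIntegrable (by norm_num), hG2.locallyIntegrable (by norm_num), ?_⟩
    intro η hη hηc i
    have hη' : Continuous fun x => fderiv ℝ η x (EuclideanSpace.single i 1) :=
      (hη.continuous_fderiv (by simp)).clm_apply continuous_const
    have h := integral_mul_fderiv_eq_neg_fderiv_mul_of_integrable (μ := (volume : Measure E3))
      (f := φ) (g := η) (v := EuclideanSpace.single i 1)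
      (((hd i).mul hη.continuous).integrable_of_hasCompactSupport hηc.mul_left)
      ((hφ.continuous.mul hη').integrable_of_hasCompactSupport hc.mul_right)
      ((hφ.continuous.mul hη.continuous).integrable_of_hasCompactSupport hc.mul_right)
      (fun x _ => hφ.differentiable (by simp) x) (fun x _ => hη.differentiable (by simp) x)
    have e1 : ∀ x, ((fderiv ℝ η x (EuclideanSpace.single i 1) : ℝ) : ℂ) * (φ x : ℂ)
        = ((φ x * fderiv ℝ η x (EuclideanSpace.single i 1) : ℝ) : ℂ) := fun x => by
      push_cast; ring
    have e2 : ∀ x, (η x : ℂ) * G x i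
        = ((fderiv ℝ φ x (EuclideanSpace.single i 1) * η x : ℝ) : ℂ) := fun x => by
      simp only [G, cplx_apply]
      push_cast; ring
    simp only [e1, e2, integral_complex_ofReal, h, Complex.ofReal_neg]
  refine ⟨⟨WithLp.toLp 2 (hφ2.toLp _, hG2.toLp _), ?_⟩, hφ2.coeFn_toLp⟩
  exact hw.congr hφ2.coeFn_toLp.symm hG2.coeFn_toLp.symm

/-- Density of H¹ in L², since H¹ contains the test functions. -/
theorem eq_zero_of_inner_formSpace {f : L2} (h : ∀ p : formSpace, (inner ℂ (formSpaceFst p) f : ℂ) = 0) :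
    f = 0 := by
  rw [Lp.eq_zero_iff_ae_eq_zero]
  refine ae_eq_zero_of_integral_contDiff_smul_eq_zero (Lp.locallyIntegrable_two f) ?_
  intro φ hφ hc
  obtain ⟨p, hp⟩ := exists_formSpace_of_contDiff hφ hc
  rw [← h p, L2.inner_def]
  refine integral_congr_ae ?_
  filter_upwards [hp] with x hx
  rw [formSpaceFst_apply, hx, RCLike.inner_apply, Complex.conj_ofReal, Complex.real_smul, mul_comm]

theorem inner_formSpace (p q : formSpace) :
    (inner ℂ p q : ℂ) = inner ℂ p.1.fst q.1.fst + inner ℂ p.1.snd q.1.snd := by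
  rw [Submodule.coe_inner, WithLp.prod_inner_apply]
  rfl

/-- The resolvent `(H + 1)⁻¹` of the Schrödinger operator. -/
theorem KatoBound.exists_resolvent (hV : KatoBound V κ) (hκ : κ < 1) :
    ∃ R : L2 →L[ℂ] L2, IsResolventOf (schrodingerGraph V) R := by
  obtain ⟨T, hT, hTi⟩ := hV.exists_form_operator
  refine exists_isResolventOf (ι := formSpaceFst) (T := T) (hT.trans_lt hκ) (fun p q => ?_)
    (fun p => ?_) (fun f => eq_zero_of_inner_formSpace) (fun u h => ?_)
  · refine (inner_conj_symm (𝕜 := ℂ) (T p) q).symm.trans ?_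
    rw [hTi, hTi, ← integral_conj]
    congr 1 with x
    simp only [map_mul, Complex.conj_ofReal, Complex.conj_conj]
    ring
  -- The potential term is at least -κ‖∇u‖², so ‖u‖² + ‖∇u‖² plus this term is still at least ‖u‖²;
  -- this is where κ ≤ 1 gives nonnegativity of H.
  · have h := hV.integral_le p.2 (Lp.memLp _) (Lp.memLp _)
    have h1 : ‖∫ x, (V x : ℂ) * (conj (p.1.fst x) * p.1.fst x)‖ ≤ κ * ‖p.1.snd‖ ^ 2 := by
      refine (norm_integral_le_integral_norm _).trans ?_
      rw [norm_sq_L2]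
      refine le_trans (le_of_eq ?_) h.2
      congr 1 with x
      simp [sq]
    have h2 := (abs_le.1 ((Complex.abs_re_le_norm _).trans h1)).1
    have e1 := inner_self_eq_norm_sq (𝕜 := ℂ) p.1.fst
    have e2 := inner_self_eq_norm_sq (𝕜 := ℂ) p.1.snd
    rw [RCLike.re_eq_complex_re] at e1 e2
    rw [hTi, inner_formSpace, Complex.add_re, Complex.add_re, e1, e2, formSpaceFst_apply]
    have h3 : 0 ≤ (1 - κ) * ‖p.1.snd‖ ^ 2 := mul_nonneg (by linarith) (sq_nonneg _)
    linarith
  · constructor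
    · rintro ⟨G, hG, H⟩
      refine ⟨⟨WithLp.toLp 2 (u, G), hG.grad⟩, rfl, fun q => ?_⟩
      have h1 := H q.1.fst q.1.snd (hV.inFormDomain q.2)
      rw [hTi, inner_formSpace, formSpaceFst_apply]
      exact (by linear_combination h1 :
        ((inner ℂ q.1.fst u : ℂ) + inner ℂ q.1.snd G)
          + ∫ x, (V x : ℂ) * (conj (q.1.fst x) * u x) = inner ℂ q.1.fst h + inner ℂ q.1.fst u)
    · rintro ⟨p, rfl, H⟩
      refine ⟨p.1.snd, hV.inFormDomain p.2, fun φ K hφ => ?_⟩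
      have h1 := H ⟨WithLp.toLp 2 (φ, K), hφ.grad⟩
      rw [hTi, inner_formSpace] at h1
      have h2 : ((inner ℂ φ p.1.fst : ℂ) + inner ℂ K p.1.snd)
          + ∫ x, (V x : ℂ) * (conj (φ x) * p.1.fst x)
          = inner ℂ φ h + inner ℂ φ p.1.fst := h1
      exact (by linear_combination h2 : (inner ℂ K p.1.snd : ℂ)
          + ∫ x, (V x : ℂ) * (conj (φ x) * p.1.fst x) = inner ℂ φ h)

end SchrodingerResolvent

/-! ### Uniqueness for Laplace transforms sampled at integers. -/

section Laplace

open Set Filter Topology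

/-- An integrable function on the half line all of whose Laplace moments vanish is zero. -/
theorem ae_eq_zero_of_forall_integral_exp_pow {H : ℝ → ℂ} (hH : IntegrableOn H (Ioi 0))
    (h0 : ∀ n : ℕ, ∫ t in Ioi (0 : ℝ), ((Real.exp (-t) ^ n : ℝ) : ℂ) * H t = 0) :
    ∀ᵐ t ∂(volume : Measure ℝ), t ∈ Ioi (0 : ℝ) → H t = 0 := by
  have hexp : ∀ t ∈ Ioi (0 : ℝ), Real.exp (-t) ∈ Icc (0 : ℝ) 1 := fun t ht =>
    ⟨(Real.exp_pos _).le, Real.exp_le_one_iff.2 (by simpa using le_of_lt ht)⟩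
  have hpow : ∀ n : ℕ, IntegrableOn (fun t => ((Real.exp (-t) ^ n : ℝ) : ℂ) * H t) (Ioi 0) := by
    intro n
    refine hH.bdd_mul (c := 1) (by fun_prop) ?_
    refine (ae_restrict_iff' measurableSet_Ioi).2 (Eventually.of_forall fun t ht => ?_)
    rw [Complex.norm_real, norm_pow, Real.norm_of_nonneg (Real.exp_pos _).le]
    exact pow_le_one₀ (hexp t ht).1 (hexp t ht).2
  have hpoly : ∀ p : Polynomial ℝ,
      ∫ t in Ioi (0 : ℝ), ((p.eval (Real.exp (-t)) : ℝ) : ℂ) * H t = 0 := by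
    intro p
    have e : ∀ t, ((p.eval (Real.exp (-t)) : ℝ) : ℂ) * H t
        = ∑ i ∈ Finset.range (p.natDegree + 1),
          (p.coeff i : ℂ) * (((Real.exp (-t) ^ i : ℝ) : ℂ) * H t) := fun t => by
      rw [Polynomial.eval_eq_sum_range, Complex.ofReal_sum, Finset.sum_mul]
      refine Finset.sum_congr rfl fun i _ => ?_
      rw [Complex.ofReal_mul, mul_assoc]
    simp only [e]
    rw [integral_finsetSum _ fun i _ => (hpow i).const_mul _]
    refine Finset.sum_eq_zero fun i _ => ?_
    rw [integral_const_mul, h0, mul_zero]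
  refine isOpen_Ioi.ae_eq_zero_of_integral_contDiff_smul_eq_zero
    hH.locallyIntegrableOn fun φ hφ hc hs => ?_
  have hφ0 : ∀ t ≤ 0, φ t = 0 := fun t ht => by
    by_contra h
    exact not_lt.2 ht (hs (subset_tsupport φ h))
  obtain ⟨ρ, hρ⟩ := hc.isCompact.isBounded.subset_closedBall (0 : ℝ)
  have hφρ : ∀ t, ρ < t → φ t = 0 := fun t ht => by
    by_contra h
    have := hρ (subset_tsupport φ h)
    rw [mem_closedBall_zero_iff] at this
    exact not_lt.2 ((le_abs_self t).trans this) ht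
  -- In the variable s = e^{-t} the test function is φ(-log s). It is continuous at s = 0, since φ
  -- vanishes for large arguments and the convention log 0 = 0 gives φ(0) = 0. Weierstrass then
  -- approximates it by polynomials in e^{-t}, whose integrals against `H` vanish.
  have hq : Continuous fun s : ℝ => φ (-Real.log s) := by
    refine continuous_iff_continuousAt.2 fun s => ?_
    rcases eq_or_ne s 0 with rfl | hs0
    · have h1 : (fun s : ℝ => φ (-Real.log s)) =ᶠ[𝓝 0] fun _ => 0 := by
        have h2 : ∀ᶠ s : ℝ in 𝓝[≠] 0, φ (-Real.log s) = 0 := by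
          have := (tendsto_neg_atBot_atTop.comp Real.tendsto_log_nhdsNE_zero).eventually_gt_atTop ρ
          filter_upwards [this] with s hs
          exact hφρ _ hs
        rw [eventually_nhdsWithin_iff] at h2
        filter_upwards [h2] with s hs
        by_cases h : s = 0
        · rw [h, Real.log_zero, neg_zero, hφ0 0 le_rfl]
        · exact hs h
      exact (continuousAt_const.congr h1.symm)
    · exact (hφ.continuous.continuousAt).comp (Real.continuousAt_log hs0).neg
  set N := ∫ t in Ioi (0 : ℝ), ‖H t‖ with hN
  have hN0 : 0 ≤ N := integral_nonneg fun _ => norm_nonneg _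
  have hφi : IntegrableOn (fun t => φ t • H t) (Ioi 0) := by
    obtain ⟨M, hM⟩ := hφ.continuous.bounded_above_of_compact_support hc
    exact hH.bdd_smul M hφ.continuous.aestronglyMeasurable (Eventually.of_forall hM)
  have key : ∀ ε > 0, ‖∫ t in Ioi (0 : ℝ), φ t • H t‖ ≤ ε * N := by
    intro ε hε
    obtain ⟨p, hp⟩ := exists_polynomial_near_of_continuousOn 0 1 _ hq.continuousOn ε hε
    have hpi : IntegrableOn (fun t => ((p.eval (Real.exp (-t)) : ℝ) : ℂ) * H t) (Ioi 0) := by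
      obtain ⟨M, hM⟩ := isCompact_Icc.exists_bound_of_continuousOn
        (p.continuous.continuousOn (s := Icc (0 : ℝ) 1))
      refine hH.bdd_mul (c := M) ?_ ?_
      · exact (Complex.continuous_ofReal.comp
          (p.continuous.comp (Real.continuous_exp.comp continuous_neg))).aestronglyMeasurable
      · refine (ae_restrict_iff' measurableSet_Ioi).2 (Eventually.of_forall fun t ht => ?_)
        rw [Complex.norm_real]
        exact hM _ (hexp t ht)
    have e1 : ∫ t in Ioi (0 : ℝ), φ t • H t
        = ∫ t in Ioi (0 : ℝ), (φ t • H t - ((p.eval (Real.exp (-t)) : ℝ) : ℂ) * H t) := by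
      rw [integral_sub hφi hpi, hpoly, sub_zero]
    rw [e1, hN, ← integral_const_mul]
    refine norm_integral_le_of_norm_le (hH.norm.const_mul _) ?_
    refine (ae_restrict_iff' measurableSet_Ioi).2 (Eventually.of_forall fun t ht => ?_)
    rw [Complex.real_smul, ← sub_mul, norm_mul, ← Complex.ofReal_sub, Complex.norm_real]
    refine mul_le_mul_of_nonneg_right ?_ (norm_nonneg _)
    have := hp _ (hexp t ht)
    rw [Real.log_exp, neg_neg] at this
    rw [norm_sub_rev]
    exact this.le
  have hz : ∫ t in Ioi (0 : ℝ), φ t • H t = 0 := by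
    by_contra hne
    have hpos := norm_pos_iff.2 hne
    have h1 := key (‖∫ t in Ioi (0 : ℝ), φ t • H t‖ / (2 * (N + 1))) (by positivity)
    rw [div_mul_eq_mul_div, le_div_iff₀ (by positivity)] at h1
    nlinarith
  rw [← hz, setIntegral_eq_integral_of_forall_compl_eq_zero]
  intro t ht
  rw [hφ0 t (not_lt.1 ht), zero_smul]

end Laplace

/-! ### The sine symbol as a function of time and of the resolvent variable. -/

section SineSymbol

open Set Filter Topology

/-- The function `μ ↦ sin(t √μ) / √μ` in the resolvent variable `r = (1 + μ)⁻¹`. -/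
def resolventSine (t r : ℝ) : ℝ := if r = 0 then 0 else sineSymbol t (r⁻¹ - 1)

theorem sineSymbol_eq_sinc {t μ : ℝ} (hμ : 0 ≤ μ) : sineSymbol t μ = t * Real.sinc (t * √μ) := by
  unfold sineSymbol
  split_ifs with h
  · simp [h]
  · have h1 : √μ ≠ 0 := (Real.sqrt_pos.2 (lt_of_le_of_ne hμ (Ne.symm h))).ne'
    rcases eq_or_ne t 0 with rfl | ht
    · simp
    · rw [Real.sinc_of_ne_zero (mul_ne_zero ht h1)]
      field_simp

theorem mul_sinc_mul (t a : ℝ) : t * Real.sinc (t * a) * a = Real.sin (t * a) := by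
  rcases eq_or_ne (t * a) 0 with h | h
  · rcases mul_eq_zero.1 h with h | h <;> simp [h]
  · rw [Real.sinc_of_ne_zero h, mul_right_comm, mul_div_cancel₀ _ h]

/-- Multiplication by a turns both terms into sines, and sine is 1-Lipschitz; dividing by |a| leaves
a bound independent of a. This makes the sine evolution Lipschitz in t in operator norm. -/
theorem abs_mul_sinc_sub_le (s t a : ℝ) :
    |t * Real.sinc (t * a) - s * Real.sinc (s * a)| ≤ |t - s| := by
  rcases eq_or_ne a 0 with rfl | ha
  · simp
  · have h1 : |(t * Real.sinc (t * a) - s * Real.sinc (s * a)) * a| ≤ |t * a - s * a| := by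
      rw [sub_mul, mul_sinc_mul, mul_sinc_mul]
      exact Real.abs_sin_sub_sin_le _ _
    rw [← sub_mul, abs_mul, abs_mul] at h1
    exact le_of_mul_le_mul_right h1 (abs_pos.2 ha)

theorem hasDerivAt_mul_sinc (a t : ℝ) :
    HasDerivAt (fun t => t * Real.sinc (t * a)) (Real.cos (t * a)) t := by
  rcases eq_or_ne a 0 with rfl | ha
  · simpa using hasDerivAt_id' t
  · have e : (fun t => t * Real.sinc (t * a)) = fun t => Real.sin (t * a) / a := by
      ext t
      rw [← mul_sinc_mul, mul_div_cancel_right₀ _ ha]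
    rw [e]
    have := (((hasDerivAt_id t).mul_const a).sin).div_const a
    simpa [ha] using this

theorem abs_mul_sinc_le (t a : ℝ) : |t * Real.sinc (t * a)| ≤ |t| := by
  simpa using abs_mul_sinc_sub_le 0 t a

theorem integrableOn_mul_exp {k : ℝ} (hk : 0 < k) :
    IntegrableOn (fun t : ℝ => t * Real.exp (-(k * t))) (Ioi 0) := by
  simpa using integrableOn_rpow_mul_exp_neg_mul_rpow (p := 1) (s := 1) (by norm_num)
    one_pos hk

theorem integrableOn_exp_mul_sinc {k : ℝ} (hk : 0 < k) (a : ℝ) :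
    IntegrableOn (fun t : ℝ => Real.exp (-(k * t)) * (t * Real.sinc (t * a))) (Ioi 0) := by
  refine (integrableOn_mul_exp hk).mono' (Continuous.aestronglyMeasurable
    (by have := Real.continuous_sinc; fun_prop)) ?_
  refine (ae_restrict_iff' measurableSet_Ioi).2 (Eventually.of_forall fun t ht => ?_)
  have h2 := abs_mul_sinc_le t a
  rw [abs_of_pos (a := t) ht] at h2
  rw [Real.norm_eq_abs, abs_mul, abs_of_pos (Real.exp_pos _), mul_comm]
  exact mul_le_mul_of_nonneg_right h2 (Real.exp_pos _).le

/-- The antiderivative -e^{-kt}(k sin(ta)/a + cos(ta)) / (k² + a²) is explicit; written with sinc it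
covers a = 0 as well. -/
theorem integral_exp_mul_sinc {k : ℝ} (hk : 0 < k) (a : ℝ) :
    ∫ t in Ioi (0 : ℝ), Real.exp (-(k * t)) * (t * Real.sinc (t * a)) = (k ^ 2 + a ^ 2)⁻¹ := by
  have hd : 0 < k ^ 2 + a ^ 2 := by positivity
  have hder : ∀ t ∈ Ici (0 : ℝ), HasDerivAt (fun t => -(Real.exp (-(k * t))
      * (k * (t * Real.sinc (t * a)) + Real.cos (t * a))) / (k ^ 2 + a ^ 2))
      (Real.exp (-(k * t)) * (t * Real.sinc (t * a))) t := by
    intro t _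
    have h1 : HasDerivAt (fun t => Real.exp (-(k * t))) (Real.exp (-(k * t)) * (-k)) t := by
      simpa using (((hasDerivAt_id t).const_mul k).neg).exp
    have h2 : HasDerivAt (fun t => Real.cos (t * a)) (-Real.sin (t * a) * a) t := by
      simpa using ((hasDerivAt_id t).mul_const a).cos
    refine ((h1.mul (((hasDerivAt_mul_sinc a t).const_mul k).add h2)).neg.div_const
      (k ^ 2 + a ^ 2)).congr_deriv ?_
    rw [div_eq_iff hd.ne', ← mul_sinc_mul]
    simp only [Pi.add_apply]
    ring
  have hlin : Tendsto (fun t : ℝ => t * Real.exp (-(k * t))) atTop (𝓝 0) := by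
    simpa using tendsto_rpow_mul_exp_neg_mul_atTop_nhds_zero 1 k hk
  have hexp : Tendsto (fun t : ℝ => Real.exp (-(k * t))) atTop (𝓝 0) := by
    simpa using tendsto_rpow_mul_exp_neg_mul_atTop_nhds_zero 0 k hk
  have hlim : Tendsto (fun t => -(Real.exp (-(k * t))
      * (k * (t * Real.sinc (t * a)) + Real.cos (t * a))) / (k ^ 2 + a ^ 2)) atTop (𝓝 0) := by
    have h1 : Tendsto (fun t => Real.exp (-(k * t))
        * (k * (t * Real.sinc (t * a)) + Real.cos (t * a))) atTop (𝓝 0) := by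
      refine squeeze_zero_norm' (a := fun t => k * (t * Real.exp (-(k * t))) + Real.exp (-(k * t)))
        ?_ (by simpa using (hlin.const_mul k).add hexp)
      filter_upwards [eventually_ge_atTop 0] with t ht
      have h2 := abs_mul_sinc_le t a
      rw [abs_of_nonneg ht] at h2
      have h3 : |k * (t * Real.sinc (t * a)) + Real.cos (t * a)| ≤ k * t + 1 := by
        refine (abs_add_le _ _).trans (add_le_add ?_ (Real.abs_cos_le_one _))
        rw [abs_mul, abs_of_pos hk]
        exact mul_le_mul_of_nonneg_left h2 hk.le
      rw [Real.norm_eq_abs, abs_mul, abs_of_pos (Real.exp_pos _)]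
      refine (mul_le_mul_of_nonneg_left h3 (Real.exp_pos _).le).trans (le_of_eq (by ring))
    simpa using h1.neg.div_const (k ^ 2 + a ^ 2)
  rw [integral_Ioi_of_hasDerivAt_of_tendsto' hder (integrableOn_exp_mul_sinc hk a) hlim]
  simp [neg_div]

theorem resolventSine_of_pos {t r : ℝ} (h0 : 0 < r) (h1 : r ≤ 1) :
    resolventSine t r = t * Real.sinc (t * √(r⁻¹ - 1)) := by
  rw [resolventSine, if_neg h0.ne', sineSymbol_eq_sinc (sub_nonneg.2 ((one_le_inv₀ h0).2 h1))]

theorem abs_resolventSine_sub_le {s t r : ℝ} (hr : r ∈ Icc (0 : ℝ) 1) :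
    |resolventSine t r - resolventSine s r| ≤ |t - s| := by
  rcases hr.1.eq_or_lt with rfl | h0
  · simp [resolventSine]
  · rw [resolventSine_of_pos h0 hr.2, resolventSine_of_pos h0 hr.2]
    exact abs_mul_sinc_sub_le _ _ _

theorem resolventSine_zero_left {r : ℝ} (hr : r ∈ Icc (0 : ℝ) 1) : resolventSine 0 r = 0 := by
  rcases hr.1.eq_or_lt with rfl | h0
  · simp [resolventSine]
  · rw [resolventSine_of_pos h0 hr.2, zero_mul]

theorem abs_resolventSine_le {t r : ℝ} (hr : r ∈ Icc (0 : ℝ) 1) : |resolventSine t r| ≤ |t| := by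
  simpa [resolventSine_zero_left hr] using abs_resolventSine_sub_le (s := 0) (t := t) hr

/-- For μ = r⁻¹ - 1 and s = sin(t√μ)/√μ one has s² ≤ t² and μ s² ≤ 1; adding, s²/r ≤ 1 + t². This
quantifies the vanishing at r = 0, that is at μ = ∞. -/
theorem abs_resolventSine_le_sqrt {t r : ℝ} (hr : r ∈ Icc (0 : ℝ) 1) :
    |resolventSine t r| ≤ √(r * (1 + t ^ 2)) := by
  rcases hr.1.eq_or_lt with rfl | h0
  · simp [resolventSine]
  · rw [resolventSine_of_pos h0 hr.2]
    have hμ : 0 ≤ r⁻¹ - 1 := sub_nonneg.2 ((one_le_inv₀ h0).2 hr.2)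
    have h1 := sq_le_sq.2 (abs_mul_sinc_le t (√(r⁻¹ - 1)))
    have h2 := mul_sinc_mul t (√(r⁻¹ - 1))
    have h3 : (t * Real.sinc (t * √(r⁻¹ - 1))) ^ 2 * (r⁻¹ - 1) ≤ 1 := by
      calc _ = Real.sin (t * √(r⁻¹ - 1)) ^ 2 := by
            rw [← h2, mul_pow _ (√(r⁻¹ - 1)), Real.sq_sqrt hμ]
        _ ≤ 1 := Real.sin_sq_le_one _
    refine Real.abs_le_sqrt ?_
    have h4 : (t * Real.sinc (t * √(r⁻¹ - 1))) ^ 2 * r⁻¹ ≤ 1 + t ^ 2 := by linarith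
    calc _ = r * ((t * Real.sinc (t * √(r⁻¹ - 1))) ^ 2 * r⁻¹) := by field_simp
      _ ≤ _ := mul_le_mul_of_nonneg_left h4 h0.le

/-- Joint continuity is needed to exchange the functional calculus with the time integral. At r = 0
it comes from the square root bound, elsewhere from continuity of sinc. -/
theorem continuousOn_resolventSine :
    ContinuousOn (Function.uncurry resolventSine) (univ ×ˢ Icc (0 : ℝ) 1) := by
  rintro ⟨t, r⟩ ⟨-, hr⟩
  rcases hr.1.eq_or_lt with rfl | h0
  · have h1 : Function.uncurry resolventSine (t, 0) = 0 := by simp [resolventSine]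
    rw [ContinuousWithinAt, h1]
    refine squeeze_zero_norm' (a := fun p : ℝ × ℝ => √(p.2 * (1 + p.1 ^ 2))) ?_ ?_
    · filter_upwards [self_mem_nhdsWithin] with p hp
      exact abs_resolventSine_le_sqrt hp.2
    · have : Continuous fun p : ℝ × ℝ => √(p.2 * (1 + p.1 ^ 2)) := by fun_prop
      simpa using (this.tendsto (t, 0)).mono_left nhdsWithin_le_nhds
  · have h1 : ContinuousAt (fun p : ℝ × ℝ => p.1 * Real.sinc (p.1 * √(p.2⁻¹ - 1))) (t, r) := by
      have h2 : ContinuousAt (fun p : ℝ × ℝ => √(p.2⁻¹ - 1)) (t, r) :=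
        ((continuousAt_snd.inv₀ h0.ne').sub continuousAt_const).sqrt
      exact continuousAt_fst.mul (Real.continuous_sinc.continuousAt.comp (continuousAt_fst.mul h2))
    refine h1.continuousWithinAt.congr_of_eventuallyEq ?_ (resolventSine_of_pos h0 hr.2)
    have h3 : ∀ᶠ p : ℝ × ℝ in 𝓝[univ ×ˢ Icc 0 1] (t, r), 0 < p.2 :=
      nhdsWithin_le_nhds (continuousAt_snd.eventually (lt_mem_nhds h0))
    filter_upwards [h3, self_mem_nhdsWithin] with p hp hp'
    exact resolventSine_of_pos hp hp'.2.2

/-- This is (k² + μ)⁻¹ rewritten in the variable r = (1 + μ)⁻¹. -/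
theorem integral_exp_mul_resolventSine {k r : ℝ} (hk : 0 < k) (hr : r ∈ Icc (0 : ℝ) 1) :
    ∫ t in Ioi (0 : ℝ), Real.exp (-(k * t)) * resolventSine t r = r / (1 + (k ^ 2 - 1) * r) := by
  rcases hr.1.eq_or_lt with rfl | h0
  · simp [resolventSine]
  · simp only [resolventSine_of_pos h0 hr.2]
    have hμ : 0 ≤ r⁻¹ - 1 := sub_nonneg.2 ((one_le_inv₀ h0).2 hr.2)
    rw [integral_exp_mul_sinc hk, Real.sq_sqrt hμ]
    have h1 : 0 < k ^ 2 + (r⁻¹ - 1) := by positivity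
    have h2 : 1 + (k ^ 2 - 1) * r = r * (k ^ 2 + (r⁻¹ - 1)) := by field_simp; ring
    rw [h2, div_mul_eq_div_div, div_self h0.ne', one_div]

end SineSymbol

/-! ### The sine evolution as a function of the resolvent, and its Laplace transform. -/

section ResolventCalculus

open Set Filter Topology

variable {X : Type*} [NormedAddCommGroup X] [InnerProductSpace ℂ X] [CompleteSpace X]
  {g : Submodule ℂ (X × X)} {R : X →L[ℂ] X}

theorem continuousOn_resolventSine_right (t : ℝ) :
    ContinuousOn (resolventSine t) (Icc 0 1) :=
  continuousOn_resolventSine.comp (Continuous.prodMk_right t).continuousOn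
    fun _ hr => ⟨mem_univ _, hr⟩

/-- The operator `sin(t √H) / √H` in terms of the resolvent `R = (H + 1)⁻¹`. -/
def sineOperator (R : X →L[ℂ] X) (t : ℝ) : X →L[ℂ] X := cfc (resolventSine t) R

theorem IsResolventOf.norm_sineOperator_sub_le (h : IsResolventOf g R) (s t : ℝ) :
    ‖sineOperator R t - sineOperator R s‖ ≤ |t - s| := by
  have hR := h.isSelfAdjoint_resolvent
  rw [sineOperator, sineOperator, ← cfc_sub _ _ R ((continuousOn_resolventSine_right t).mono h.spectrum_subset)
    ((continuousOn_resolventSine_right s).mono h.spectrum_subset)]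
  exact norm_cfc_le (abs_nonneg _) fun r hr => abs_resolventSine_sub_le (h.spectrum_subset hr)

theorem IsResolventOf.continuous_sineOperator (h : IsResolventOf g R) :
    Continuous fun t => sineOperator R t :=
  (LipschitzWith.of_dist_le_mul (K := 1) fun t s => by
    simpa [dist_eq_norm] using h.norm_sineOperator_sub_le s t).continuous

theorem IsResolventOf.norm_sineOperator_le (h : IsResolventOf g R) (t : ℝ) :
    ‖sineOperator R t‖ ≤ |t| :=
  norm_cfc_le (abs_nonneg _) fun _ hr => abs_resolventSine_le (h.spectrum_subset hr)

/-- The Laplace transform of the sine evolution solves the resolvent equation. -/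
theorem IsResolventOf.exists_laplace (h : IsResolventOf g R) {k : ℝ} (hk : 1 ≤ k) (f : X) :
    ∃ v : X, (v, f - (k ^ 2 : ℝ) • v) ∈ g ∧ ∀ φ : X,
      ∫ t in Ioi (0 : ℝ), (Real.exp (-(k * t)) : ℂ) * inner ℂ φ (sineOperator R t f)
        = inner ℂ φ v := by
  have hk0 : 0 < k := one_pos.trans_le hk
  have hR := h.isSelfAdjoint_resolvent
  -- For k ≥ 1 the denominator stays at least 1 on [0, 1]; such k suffice for the uniqueness
  -- argument.
  have hden : ∀ r ∈ Icc (0 : ℝ) 1, 0 < 1 + (k ^ 2 - 1) * r := fun r hr => by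
    have : 0 ≤ (k ^ 2 - 1) * r := mul_nonneg (by nlinarith) hr.1
    linarith
  let b : ℝ → ℝ := fun r => r / (1 + (k ^ 2 - 1) * r)
  have hb : ContinuousOn b (spectrum ℝ R) := by
    refine ContinuousOn.div continuousOn_id (by fun_prop) fun r hr => ?_
    exact (hden r (h.spectrum_subset hr)).ne'
  -- B = `cfc b R` plays the part of (H + k²)⁻¹: the identity rearranges to R(f - (k² - 1)Bf) = Bf,
  -- which says that (Bf, f - k² Bf) lies in the graph.
  have hB : cfc b R + (k ^ 2 - 1) • (R * cfc b R) = R := by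
    have e1 : R * cfc b R = cfc (fun r => r * b r) R := by
      conv_lhs => rw [← cfc_id' ℝ R]
      rw [cfc_id' ℝ R]
      rw [cfc_mul (fun r => r) b R continuousOn_id hb, cfc_id' ℝ R]
    rw [e1, ← cfc_smul (k ^ 2 - 1) (fun r => r * b r) R (continuousOn_id.mul hb),
      ← cfc_add R b (fun r => (k ^ 2 - 1) • (r * b r)) hb
        ((continuousOn_id.mul hb).const_smul (k ^ 2 - 1))]
    conv_rhs => rw [← cfc_id' ℝ R]
    refine cfc_congr fun r hr => ?_
    have := (hden r (h.spectrum_subset hr)).ne'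
    calc r / (1 + (k ^ 2 - 1) * r) + (k ^ 2 - 1) * (r * (r / (1 + (k ^ 2 - 1) * r)))
        = r * (1 + (k ^ 2 - 1) * r) / (1 + (k ^ 2 - 1) * r) := by ring
      _ = r := mul_div_cancel_right₀ _ this
  have hint : cfc b R = ∫ t in Ioi (0 : ℝ), Real.exp (-(k * t)) • sineOperator R t := by
    have e1 := cfc_setIntegral (μ := (volume : Measure ℝ)) measurableSet_Ioi
      (fun t r => Real.exp (-(k * t)) * resolventSine t r)
      (fun t => t * Real.exp (-(k * t))) R ?_ ?_ (integrableOn_mul_exp hk0).2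
    · rw [cfc_congr (g := fun r => ∫ t in Ioi (0 : ℝ), Real.exp (-(k * t)) * resolventSine t r)
        fun r hr => (integral_exp_mul_resolventSine hk0 (h.spectrum_subset hr)).symm, e1]
      congr 1 with t
      rw [sineOperator, ← cfc_smul (Real.exp (-(k * t))) (resolventSine t) R
        ((continuousOn_resolventSine_right t).mono h.spectrum_subset)]
      rfl
    · refine ContinuousOn.mul (by fun_prop) (continuousOn_resolventSine.mono ?_)
      exact prod_mono (subset_univ _) h.spectrum_subset
    · refine (ae_restrict_iff' measurableSet_Ioi).2 (Eventually.of_forall fun t ht r hr => ?_)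
      have := abs_resolventSine_le (t := t) (h.spectrum_subset hr)
      rw [abs_of_pos (a := t) ht] at this
      rw [norm_mul, Real.norm_of_nonneg (Real.exp_pos _).le, mul_comm]
      exact mul_le_mul_of_nonneg_right this (Real.exp_pos _).le
  have hI : IntegrableOn (fun t => Real.exp (-(k * t)) • sineOperator R t) (Ioi 0) := by
    refine (integrableOn_mul_exp hk0).mono' ?_ ?_
    · exact ((show Continuous fun t : ℝ => Real.exp (-(k * t)) by fun_prop).smul
        h.continuous_sineOperator).aestronglyMeasurable
    · refine (ae_restrict_iff' measurableSet_Ioi).2 (Eventually.of_forall fun t ht => ?_)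
      have := h.norm_sineOperator_le t
      rw [abs_of_pos ht] at this
      rw [norm_smul, Real.norm_of_nonneg (Real.exp_pos _).le, mul_comm]
      exact mul_le_mul_of_nonneg_right this (Real.exp_pos _).le
  refine ⟨cfc b R f, ?_, fun φ => ?_⟩
  · rw [h.mem_iff]
    have h1 : cfc b R f + (k ^ 2 - 1) • R (cfc b R f) = R f :=
      congrArg (fun A : X →L[ℂ] X => A f) hB
    have h2 : f - (k ^ 2 : ℝ) • cfc b R f + cfc b R f = f - (k ^ 2 - 1) • cfc b R f := by
      rw [sub_smul, one_smul]; abel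
    rw [h2, map_sub, ContinuousLinearMap.map_smul_of_tower]
    rw [← h1, add_sub_cancel_right]
  · have e : ∀ t, (Real.exp (-(k * t)) : ℂ) * inner ℂ φ (sineOperator R t f)
        = inner ℂ φ ((Real.exp (-(k * t)) • sineOperator R t) f) := fun t => by
      rw [smul_apply, ← Complex.coe_smul, inner_smul_right]
    simp only [e]
    rw [integral_inner (hI.apply_continuousLinearMap f),
      ← ContinuousLinearMap.integral_apply hI, hint]

end ResolventCalculus

/-! ### Newtonian potentials in extended nonnegative integrals. -/

section Kernels

open Set Metric

variable {V : E3 → ℝ} {κ : ℝ}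

theorem measurable_newton_sub : Measurable fun p : E3 × E3 => newton (p.1 - p.2) :=
  measurable_newton.comp (measurable_fst.sub measurable_snd)

theorem newton_mul_norm_le (z : E3) : newton z * ‖z‖ ≤ (4 * Real.pi)⁻¹ := by
  rcases eq_or_ne z 0 with rfl | h
  · simp only [norm_zero, mul_zero]
    positivity
  · have := norm_pos_iff.2 h
    rw [newton, mul_inv, inv_mul_cancel_right₀ this.ne']

theorem enorm_ofReal (r : ℝ) : ‖(r : ℂ)‖ₑ = ‖r‖ₑ := by
  rw [enorm_eq_iff_norm_eq, Complex.norm_real]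

/-- Tonelli: a bound for the w-weighted mass of the kernel in its first variable passes to its
action on `a`. The L¹ iteration estimates for the Born series are instances of this. -/
theorem lintegral_mul_kernel_le {w a b : E3 → ℝ≥0∞} {N : E3 → E3 → ℝ≥0∞} (hw : AEMeasurable w)
    (ha : Measurable a) (hN : Measurable (Function.uncurry N))
    (h : ∀ y, ∫⁻ x, w x * N x y ≤ b y) :
    ∫⁻ x, w x * ∫⁻ y, N x y * a y ≤ ∫⁻ y, b y * a y := by
  have hNx : ∀ x, Measurable (N x) := fun x => hN.of_uncurry_left
  have hNy : ∀ y, Measurable fun x => N x y := fun y => hN.of_uncurry_right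
  calc ∫⁻ x, w x * ∫⁻ y, N x y * a y = ∫⁻ x, ∫⁻ y, w x * (N x y * a y) := by
        congr 1 with x
        exact (lintegral_const_mul _ ((hNx x).mul ha)).symm
    _ = ∫⁻ y, ∫⁻ x, w x * (N x y * a y) :=
        lintegral_lintegral_swap (hw.comp_fst.mul
          (hN.mul (ha.comp measurable_snd)).aemeasurable)
    _ = ∫⁻ y, (∫⁻ x, w x * N x y) * a y := by
        congr 1 with y
        simp only [← mul_assoc]
        exact lintegral_mul_const'' _ (hw.mul (hNy y).aemeasurable)
    _ ≤ ∫⁻ y, b y * a y := lintegral_mono fun y => mul_le_mul_left (h y) _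

/-- From 2r⁻¹ ≤ 1 + r⁻²; it reduces Newtonian potentials of balls to the |z|⁻² estimate. -/
theorem newton_le (z : E3) : newton z ≤ 1 + (‖z‖ ^ 2)⁻¹ := by
  rcases eq_or_ne z 0 with rfl | h
  · simp [newton]
  · have h0 := norm_pos_iff.2 h
    have h1 : newton z ≤ ‖z‖⁻¹ := by
      rw [newton, mul_inv]
      exact mul_le_of_le_one_left (by positivity) four_pi_inv_le_one
    have h2 := sq_nonneg (1 - ‖z‖⁻¹)
    have h3 : 0 < ‖z‖⁻¹ := by positivity
    rw [← inv_pow]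
    nlinarith

theorem exists_lintegral_newton_le {h : E3 → ℂ} (hh : BoundedSupport h) :
    ∃ K : ℝ, 0 ≤ K ∧ ∀ y, ∫⁻ x, ‖h x‖ₑ * ‖newton (x - y)‖ₑ ≤ ENNReal.ofReal K := by
  obtain ⟨M, ρ, hM, hs⟩ := hh.bound
  obtain ⟨C, hC0, hC⟩ := exists_setIntegral_norm_sub_sq_inv_le (ρ := max ρ 1) (by positivity)
  have hM0 : 0 ≤ M := (norm_nonneg _).trans (hM 0)
  set B := ball (0 : E3) (max ρ 1) with hB
  refine ⟨M * (volume.real B + C), by positivity, fun y => ?_⟩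
  have hi1 : IntegrableOn (fun _ : E3 => (1 : ℝ)) B := integrableOn_const measure_ball_lt_top.ne
  have hi2 := integrableOn_norm_sub_sq_inv y (max ρ 1)
  have hi : IntegrableOn (fun x : E3 => M * (1 + (‖x - y‖ ^ 2)⁻¹)) B := (hi1.add hi2).const_mul M
  calc ∫⁻ x, ‖h x‖ₑ * ‖newton (x - y)‖ₑ
      ≤ ∫⁻ x, B.indicator (fun x => ENNReal.ofReal (M * (1 + (‖x - y‖ ^ 2)⁻¹))) x := by
        refine lintegral_mono fun x => ?_
        by_cases hx : x ∈ B
        · rw [indicator_of_mem hx, ← ofReal_norm, ← ofReal_norm,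
            Real.norm_of_nonneg (newton_nonneg _), ← ENNReal.ofReal_mul (norm_nonneg _)]
          exact ENNReal.ofReal_le_ofReal
            (mul_le_mul (hM x) (newton_le _) (newton_nonneg _) hM0)
        · rw [hB, mem_ball_zero_iff, not_lt] at hx
          rw [hs x ((le_max_left _ _).trans hx)]
          simp
    _ = ∫⁻ x in B, ENNReal.ofReal (M * (1 + (‖x - y‖ ^ 2)⁻¹)) :=
        lintegral_indicator measurableSet_ball _
    _ = ENNReal.ofReal (∫ x in B, M * (1 + (‖x - y‖ ^ 2)⁻¹)) :=
        (ofReal_integral_eq_lintegral_ofReal hi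
          (Filter.Eventually.of_forall fun x => by positivity)).symm
    _ ≤ ENNReal.ofReal (M * (volume.real B + C)) := by
        refine ENNReal.ofReal_le_ofReal ?_
        rw [integral_const_mul, integral_add hi1 hi2, setIntegral_const, smul_eq_mul, mul_one]
        refine mul_le_mul_of_nonneg_left (add_le_add_right ((hC y).trans ?_) _) hM0
        exact mul_le_of_le_one_right hC0 (decay_le_one y)

end Kernels

/-! ### Retarded Born terms: majorants, decay in time, Laplace transforms. -/

section Born

variable (V : E3 → ℝ) (g : E3 → C3)

/-- Majorants, uniform in time, for the terms of the Born series of the wave equation. -/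
def majorant : ℕ → E3 → ℝ≥0∞
  | 0, x => ∫⁻ y, ‖newton (x - y)‖ₑ * ‖g y‖ₑ
  | n + 1, x => ∫⁻ y, ‖newton (x - y)‖ₑ * (‖V y‖ₑ * majorant n y)

/-- The function `t ↦ t` cut off to the interval `(0, r)`. -/
def ramp (t r : ℝ) : ℝ := if 0 < t ∧ t < r then t else 0

/-- The terms of the Born series for the wave equation with potential `V`, with initial velocity
given by its gradient `g`. -/
def born : ℕ → ℝ → E3 → ℂ
  | 0, t, x => -∫ y, (ramp t ‖y - x‖ : ℂ)
      * inner ℂ (cplx (radialField (fun _ => (4 * Real.pi)⁻¹) (y - x))) (g y)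
  | n + 1, t, x => -∫ y, ((V y * newton (x - y) : ℝ) : ℂ) * born n (t - ‖x - y‖) y

variable {V g} {κ : ℝ}

theorem measurable_ramp : Measurable (Function.uncurry ramp) := by
  unfold ramp Function.uncurry
  refine Measurable.ite ?_ measurable_fst measurable_const
  exact (measurableSet_lt measurable_const measurable_fst).inter
    (measurableSet_lt measurable_fst measurable_snd)

theorem ramp_nonneg (t r : ℝ) : 0 ≤ ramp t r := by
  unfold ramp
  split_ifs with h
  exacts [h.1.le, le_rfl]

theorem ramp_le {t r : ℝ} (hr : 0 ≤ r) : ramp t r ≤ r := by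
  unfold ramp
  split_ifs with h
  exacts [h.2.le, hr]

/-- The source of the decay of the first Born term: t² ≤ r² on 0 < t < r, and r² absorbs the |z|⁻²
of the kernel. -/
theorem mul_ramp_le (t r : ℝ) : t * ramp t r ≤ r ^ 2 := by
  unfold ramp
  split_ifs with h
  · nlinarith [h.1, h.2]
  · rw [mul_zero]; positivity

theorem ramp_of_nonpos {t r : ℝ} (ht : t ≤ 0) : ramp t r = 0 := if_neg fun h => not_lt.2 ht h.1

theorem measurable_majorant (hV : Measurable V) (hg : Measurable g) (n : ℕ) :
    Measurable (majorant V g n) := by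
  induction n with
  | zero =>
    exact Measurable.lintegral_prod_right
      (measurable_newton_sub.enorm.mul (hg.comp measurable_snd).enorm)
  | succ n ih =>
    exact Measurable.lintegral_prod_right
      (measurable_newton_sub.enorm.mul ((hV.enorm.mul ih).comp measurable_snd))

theorem stronglyMeasurable_born (hV : Measurable V) (hg : Measurable g) (n : ℕ) :
    StronglyMeasurable (Function.uncurry (born V g n)) := by
  induction n with
  | zero =>
    refine (StronglyMeasurable.integral_prod_right (f := fun (p : ℝ × E3) (y : E3) =>
      (ramp p.1 ‖y - p.2‖ : ℂ)
      * inner ℂ (cplx (radialField (fun _ => (4 * Real.pi)⁻¹) (y - p.2))) (g y)) ?_).neg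
    refine Measurable.stronglyMeasurable ?_
    refine Measurable.mul ?_ (Measurable.inner ?_ (hg.comp measurable_snd))
    · exact Complex.measurable_ofReal.comp (measurable_ramp.comp
        ((measurable_fst.comp measurable_fst).prodMk
          (measurable_snd.sub (measurable_snd.comp measurable_fst)).norm))
    · exact continuous_cplx.measurable.comp ((measurable_radialField measurable_const).comp
        (measurable_snd.sub (measurable_snd.comp measurable_fst)))
  | succ n ih =>
    refine (StronglyMeasurable.integral_prod_right (f := fun (p : ℝ × E3) (y : E3) =>
      ((V y * newton (p.2 - y) : ℝ) : ℂ) * born V g n (p.1 - ‖p.2 - y‖) y) ?_).neg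
    refine Measurable.stronglyMeasurable ?_
    have h1 : Measurable fun q : (ℝ × E3) × E3 => q.1.2 - q.2 :=
      (measurable_snd.comp measurable_fst).sub measurable_snd
    refine Measurable.mul ?_ ?_
    · exact Complex.measurable_ofReal.comp
        ((hV.comp measurable_snd).mul (measurable_newton.comp h1))
    · exact ih.measurable.comp
        (((measurable_fst.comp measurable_fst).sub h1.norm).prodMk measurable_snd)

/-- Causality: delays are nonnegative. Laplace integrals over ℝ and over the half line therefore
agree, and time may be translated freely. -/
theorem born_of_nonpos (n : ℕ) {t : ℝ} (ht : t ≤ 0) (x : E3) : born V g n t x = 0 := by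
  induction n generalizing t x with
  | zero => simp [born, ramp_of_nonpos ht]
  | succ n ih =>
    have : ∀ y, born V g n (t - ‖x - y‖) y = 0 := fun y =>
      ih (by linarith [norm_nonneg (x - y)]) y
    simp [born, this]

theorem norm_inner_radialField_le (z : E3) (w : C3) :
    ‖(inner ℂ (cplx (radialField (fun _ => (4 * Real.pi)⁻¹) z)) w : ℂ)‖
      ≤ (4 * Real.pi)⁻¹ * (‖z‖ ^ 2)⁻¹ * ‖w‖ := by
  refine (norm_inner_cplx_le _ _).trans (mul_le_mul_of_nonneg_right ?_ (norm_nonneg _))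
  rw [norm_radialField, abs_of_nonneg (by positivity)]

theorem enorm_born_zero_integrand_le (t : ℝ) (x y : E3) :
    ‖(ramp t ‖y - x‖ : ℂ) * inner ℂ (cplx (radialField (fun _ => (4 * Real.pi)⁻¹) (y - x))) (g y)‖ₑ
      ≤ ‖newton (x - y)‖ₑ * ‖g y‖ₑ := by
  rw [← enorm_norm (g y), ← enorm_mul, enorm_le_iff_norm_le, norm_mul, Complex.norm_real,
    Real.norm_of_nonneg (ramp_nonneg _ _), norm_mul, norm_norm,
    Real.norm_of_nonneg (newton_nonneg _), newton_sub_comm]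
  calc ramp t ‖y - x‖ * _ ≤ ‖y - x‖ * ((4 * Real.pi)⁻¹ * (‖y - x‖ ^ 2)⁻¹ * ‖g y‖) :=
        mul_le_mul (ramp_le (norm_nonneg _)) (norm_inner_radialField_le _ _) (norm_nonneg _)
          (norm_nonneg _)
    _ = newton (y - x) * ‖g y‖ := by
        rw [newton]
        rcases eq_or_ne ‖y - x‖ 0 with h | h
        · simp [h]
        · field_simp

/-- The first term is controlled by `ramp t r ≤ r`; afterwards a delay only changes the time at
which the previous term is taken, which its majorant does not see. -/
theorem enorm_born_le (n : ℕ) (t : ℝ) (x : E3) : ‖born V g n t x‖ₑ ≤ majorant V g n x := by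
  induction n generalizing t x with
  | zero =>
    rw [born, enorm_neg]
    refine (enorm_integral_le_lintegral_enorm _).trans (lintegral_mono fun y => ?_)
    exact enorm_born_zero_integrand_le t x y
  | succ n ih =>
    rw [born, enorm_neg]
    refine (enorm_integral_le_lintegral_enorm _).trans (lintegral_mono fun y => ?_)
    rw [Complex.ofReal_mul, enorm_mul, enorm_mul, enorm_ofReal, enorm_ofReal,
      mul_comm ‖V y‖ₑ, mul_assoc]
    exact mul_le_mul_right (mul_le_mul_right (ih _ _) _) _

theorem KatoBound.lintegral_mul_newton_le (hV : KatoBound V κ) {a : E3 → ℝ≥0∞}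
    (ha : Measurable a) :
    ∫⁻ x, ‖V x‖ₑ * ∫⁻ y, ‖newton (x - y)‖ₑ * a y ≤ ENNReal.ofReal κ * ∫⁻ y, a y := by
  rw [← lintegral_const_mul _ ha]
  exact lintegral_mul_kernel_le hV.meas.enorm.aemeasurable ha measurable_newton_sub.enorm
    hV.lintegral_newton_le

/-- Integrating |V| against the outermost Newtonian kernel costs one factor κ per term; the exponent
is n + 1 because the zeroth majorant already contains a kernel. -/
theorem KatoBound.lintegral_majorant_le (hV : KatoBound V κ) (hg : Measurable g) (n : ℕ) :
    ∫⁻ x, ‖V x‖ₑ * majorant V g n x ≤ ENNReal.ofReal (κ ^ (n + 1)) * ∫⁻ y, ‖g y‖ₑ := by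
  induction n with
  | zero =>
    rw [zero_add, pow_one]
    exact hV.lintegral_mul_newton_le hg.enorm
  | succ n ih =>
    rw [pow_succ' κ, ENNReal.ofReal_mul hV.pos.le, mul_assoc]
    exact (hV.lintegral_mul_newton_le (hV.meas.enorm.mul (measurable_majorant hV.meas hg n))).trans
      (mul_le_mul_right ih _)

/-- Here the outermost kernel is integrated against h instead of |V|, which trades one factor κ for
`K`. -/
theorem KatoBound.lintegral_mul_majorant_le (hV : KatoBound V κ) (hg : Measurable g)
    {h : E3 → ℂ} (hh : BoundedSupport h) {K : ℝ}
    (hK : ∀ y, ∫⁻ x, ‖h x‖ₑ * ‖newton (x - y)‖ₑ ≤ ENNReal.ofReal K) (n : ℕ) :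
    ∫⁻ x, ‖h x‖ₑ * majorant V g n x
      ≤ ENNReal.ofReal K * (ENNReal.ofReal (κ ^ n) * ∫⁻ y, ‖g y‖ₑ) := by
  cases n with
  | zero =>
    rw [pow_zero, ENNReal.ofReal_one, one_mul, ← lintegral_const_mul _ hg.enorm]
    exact lintegral_mul_kernel_le hh.meas.enorm hg.enorm measurable_newton_sub.enorm hK
  | succ n =>
    refine (lintegral_mul_kernel_le (N := fun x y => ‖newton (x - y)‖ₑ) hh.meas.enorm
      (hV.meas.enorm.mul (measurable_majorant hV.meas hg n)) measurable_newton_sub.enorm hK).trans ?_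
    refine (lintegral_const_mul _ (hV.meas.enorm.mul (measurable_majorant hV.meas hg n))).le.trans ?_
    exact mul_le_mul_right (hV.lintegral_majorant_le hg n) _

/-- The decay in time of the terms of the Born series. -/
theorem mul_enorm_born_le (hV : KatoBound V κ) (hg : Measurable g) (n : ℕ) (t : ℝ) (x : E3) :
    ENNReal.ofReal t * ‖born V g n t x‖ₑ
      ≤ ENNReal.ofReal ((4 * Real.pi)⁻¹ * ((n + 1) * κ ^ n)) * ∫⁻ y, ‖g y‖ₑ := by
  set A := ∫⁻ y, ‖g y‖ₑ with hA
  induction n generalizing t x with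
  | zero =>
    rw [born, enorm_neg]
    calc ENNReal.ofReal t * ‖_‖ₑ ≤ ENNReal.ofReal t * ∫⁻ y, ‖(ramp t ‖y - x‖ : ℂ)
          * inner ℂ (cplx (radialField (fun _ => (4 * Real.pi)⁻¹) (y - x))) (g y)‖ₑ :=
          mul_le_mul_right (enorm_integral_le_lintegral_enorm _) _
      _ = ∫⁻ y, ENNReal.ofReal t * ‖(ramp t ‖y - x‖ : ℂ)
          * inner ℂ (cplx (radialField (fun _ => (4 * Real.pi)⁻¹) (y - x))) (g y)‖ₑ :=
          (lintegral_const_mul' _ _ ENNReal.ofReal_ne_top).symm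
      _ ≤ ∫⁻ y, ENNReal.ofReal (4 * Real.pi)⁻¹ * ‖g y‖ₑ := by
          refine lintegral_mono fun y => ?_
          rw [← ofReal_norm, ← ofReal_norm, ← ENNReal.ofReal_mul' (norm_nonneg _),
            ← ENNReal.ofReal_mul (by positivity)]
          refine ENNReal.ofReal_le_ofReal ?_
          rw [norm_mul, Complex.norm_real, Real.norm_of_nonneg (ramp_nonneg _ _), ← mul_assoc]
          calc t * ramp t ‖y - x‖ * _
              ≤ ‖y - x‖ ^ 2 * ((4 * Real.pi)⁻¹ * (‖y - x‖ ^ 2)⁻¹ * ‖g y‖) :=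
                mul_le_mul (mul_ramp_le _ _) (norm_inner_radialField_le _ _) (norm_nonneg _)
                  (by positivity)
            _ ≤ (4 * Real.pi)⁻¹ * ‖g y‖ := by
                rcases eq_or_ne ‖y - x‖ 0 with h | h
                · rw [h]; simp; positivity
                · exact le_of_eq (by field_simp)
      _ = ENNReal.ofReal (4 * Real.pi)⁻¹ * A := lintegral_const_mul _ hg.enorm
      _ = _ := by simp
  | succ n ih =>
    rw [born, enorm_neg]
    set a := ENNReal.ofReal ((4 * Real.pi)⁻¹ * ((n + 1) * κ ^ n)) * A with ha
    have hpt : ∀ y, ENNReal.ofReal t * ‖((V y * newton (x - y) : ℝ) : ℂ)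
        * born V g n (t - ‖x - y‖) y‖ₑ ≤ ‖V y‖ₑ * ‖newton (y - x)‖ₑ * a
          + ENNReal.ofReal (4 * Real.pi)⁻¹ * (‖V y‖ₑ * majorant V g n y) := fun y => by
      -- The time is split into the delayed time, cut off at zero by `ENNReal.ofReal`, and the
      -- delay. The induction hypothesis turns the first part into (n + 1) κ^(n+1); the delay
      -- cancels the Newtonian kernel and leaves ∫ |V| against the majorant, which supplies one more
      -- κ^(n+1).
      have h1 : ENNReal.ofReal t ≤ ENNReal.ofReal (t - ‖x - y‖) + ENNReal.ofReal ‖x - y‖ := by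
        refine le_trans (le_of_eq ?_) ENNReal.ofReal_add_le
        rw [sub_add_cancel]
      have h2 : ‖newton (x - y)‖ₑ * ENNReal.ofReal ‖x - y‖ ≤ ENNReal.ofReal (4 * Real.pi)⁻¹ := by
        rw [← ofReal_norm, Real.norm_of_nonneg (newton_nonneg _),
          ← ENNReal.ofReal_mul (newton_nonneg _)]
        exact ENNReal.ofReal_le_ofReal (newton_mul_norm_le _)
      rw [Complex.ofReal_mul, enorm_mul, enorm_mul, enorm_ofReal, enorm_ofReal]
      set b := ‖born V g n (t - ‖x - y‖) y‖ₑ with hb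
      calc ENNReal.ofReal t * (‖V y‖ₑ * ‖newton (x - y)‖ₑ * b)
          ≤ (ENNReal.ofReal (t - ‖x - y‖) + ENNReal.ofReal ‖x - y‖)
            * (‖V y‖ₑ * ‖newton (x - y)‖ₑ * b) := mul_le_mul_left h1 _
        _ = ‖V y‖ₑ * ‖newton (x - y)‖ₑ * (ENNReal.ofReal (t - ‖x - y‖) * b)
            + (‖newton (x - y)‖ₑ * ENNReal.ofReal ‖x - y‖) * (‖V y‖ₑ * b) := by ring
        _ ≤ _ := by
            rw [newton_sub_comm y x]
            exact add_le_add (mul_le_mul_right (ih _ _) _)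
              (mul_le_mul' h2 (mul_le_mul_right (enorm_born_le _ _ _) _))
    calc ENNReal.ofReal t * ‖_‖ₑ ≤ ENNReal.ofReal t * ∫⁻ y, ‖((V y * newton (x - y) : ℝ) : ℂ)
        * born V g n (t - ‖x - y‖) y‖ₑ :=
          mul_le_mul_right (enorm_integral_le_lintegral_enorm _) _
      _ = ∫⁻ y, ENNReal.ofReal t * ‖((V y * newton (x - y) : ℝ) : ℂ)
        * born V g n (t - ‖x - y‖) y‖ₑ := (lintegral_const_mul' _ _ ENNReal.ofReal_ne_top).symm
      _ ≤ ∫⁻ y, (‖V y‖ₑ * ‖newton (y - x)‖ₑ * a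
          + ENNReal.ofReal (4 * Real.pi)⁻¹ * (‖V y‖ₑ * majorant V g n y)) := lintegral_mono hpt
      _ = (∫⁻ y, ‖V y‖ₑ * ‖newton (y - x)‖ₑ) * a
          + ENNReal.ofReal (4 * Real.pi)⁻¹ * ∫⁻ y, ‖V y‖ₑ * majorant V g n y := by
          have hm : Measurable fun y => ‖V y‖ₑ * ‖newton (y - x)‖ₑ :=
            hV.meas.enorm.mul (measurable_newton.comp (measurable_id.sub_const x)).enorm
          rw [lintegral_add_left (hm.mul_const _), lintegral_mul_const _ hm,
            lintegral_const_mul' _ _ ENNReal.ofReal_ne_top]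
      _ ≤ ENNReal.ofReal κ * a
          + ENNReal.ofReal (4 * Real.pi)⁻¹ * (ENNReal.ofReal (κ ^ (n + 1)) * A) :=
          add_le_add (mul_le_mul_left (hV.lintegral_newton_le x) _)
            (mul_le_mul_right (hV.lintegral_majorant_le hg n) _)
      _ = _ := by
          have hκ := hV.pos.le
          rw [ha, ← mul_assoc _ _ A, ← mul_assoc _ _ A, ← ENNReal.ofReal_mul hκ,
            ← ENNReal.ofReal_mul (by positivity), ← add_mul,
            ← ENNReal.ofReal_add (by positivity) (by positivity)]
          congr 2
          push_cast
          ring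

/-- Fubini's theorem for an integrand dominated by a product. -/
theorem integrable_prod_of_enorm_le {α β : Type*} [MeasurableSpace α] [MeasurableSpace β]
    {μ : Measure α} {ν : Measure β} [SFinite μ] [SFinite ν] {F : α × β → ℂ} {e : α → ℝ≥0∞}
    {b : β → ℝ≥0∞} (hF : AEStronglyMeasurable F (μ.prod ν)) (he : AEMeasurable e μ)
    (hb : AEMeasurable b ν) (h : ∀ p, ‖F p‖ₑ ≤ e p.1 * b p.2) (he' : ∫⁻ t, e t ∂μ ≠ ⊤)
    (hb' : ∫⁻ y, b y ∂ν ≠ ⊤) : Integrable F (μ.prod ν) := by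
  refine ⟨hF, ?_⟩
  calc ∫⁻ p, ‖F p‖ₑ ∂(μ.prod ν) ≤ ∫⁻ p, e p.1 * b p.2 ∂(μ.prod ν) := lintegral_mono h
    _ = (∫⁻ t, e t ∂μ) * ∫⁻ y, b y ∂ν := lintegral_prod_mul he hb
    _ < ⊤ := ENNReal.mul_lt_top he'.lt_top hb'.lt_top

/-- The weight of the Laplace transform, on the half line. -/
def laplaceWeight (k t : ℝ) : ℝ≥0∞ := (Set.Ioi (0 : ℝ)).indicator (fun t => ‖Real.exp (-(k * t))‖ₑ) t

theorem measurable_laplaceWeight (k : ℝ) : Measurable (laplaceWeight k) :=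
  Measurable.indicator (by fun_prop) measurableSet_Ioi

theorem lintegral_laplaceWeight {k : ℝ} (hk : 0 < k) :
    ∫⁻ t, laplaceWeight k t = ENNReal.ofReal k⁻¹ := by
  have hi : IntegrableOn (fun t : ℝ => Real.exp (-(k * t))) (Set.Ioi 0) := by
    simpa using exp_neg_integrableOn_Ioi 0 hk
  have h2 : ∫ t in Set.Ioi (0 : ℝ), Real.exp (-(k * t)) = k⁻¹ := by
    simpa [one_div] using integral_exp_mul_Ioi (neg_lt_zero.2 hk) 0
  rw [← h2, ofReal_integral_eq_lintegral_ofReal hi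
    (Filter.Eventually.of_forall fun t => (Real.exp_pos _).le)]
  simp only [laplaceWeight]
  rw [lintegral_indicator measurableSet_Ioi]
  refine lintegral_congr fun t => ?_
  rw [← ofReal_norm, Real.norm_of_nonneg (Real.exp_pos _).le]

/-- The Laplace transform of a term of the Born series. -/
def bornLaplace (V : E3 → ℝ) (g : E3 → C3) (k : ℝ) (n : ℕ) (x : E3) : ℂ :=
  ∫ t : ℝ, (Real.exp (-(k * t)) : ℂ) * born V g n t x

variable {k : ℝ}

/-- The time s in the Born term may lag behind the time t of the weight, as it does inside the
recursion; by causality nothing is lost when s ≤ 0. -/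
theorem enorm_exp_mul_born_le (n : ℕ) (t s : ℝ) (hs : s ≤ t) (x : E3) :
    ‖(Real.exp (-(k * t)) : ℂ) * born V g n s x‖ₑ ≤ laplaceWeight k t * majorant V g n x := by
  rcases le_or_gt s 0 with h | h
  · simp [born_of_nonpos n h]
  · rw [laplaceWeight, Set.indicator_of_mem (show t ∈ Set.Ioi 0 from h.trans_le hs), enorm_mul,
      enorm_ofReal]
    exact mul_le_mul_right (enorm_born_le n s x) _

theorem enorm_bornLaplace_le (hk : 0 < k) (n : ℕ) (x : E3) :
    ‖bornLaplace V g k n x‖ₑ ≤ ENNReal.ofReal k⁻¹ * majorant V g n x := by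
  rw [← lintegral_laplaceWeight hk, ← lintegral_mul_const _ (measurable_laplaceWeight k)]
  exact (enorm_integral_le_lintegral_enorm _).trans
    (lintegral_mono fun t => enorm_exp_mul_born_le n t t le_rfl x)

theorem stronglyMeasurable_bornLaplace (hV : Measurable V) (hg : Measurable g) (n : ℕ) :
    StronglyMeasurable (bornLaplace V g k n) := by
  refine StronglyMeasurable.integral_prod_right (f := fun (x : E3) (t : ℝ) =>
    (Real.exp (-(k * t)) : ℂ) * born V g n t x) (Measurable.stronglyMeasurable ?_)
  refine Measurable.mul (by fun_prop) ?_
  exact (stronglyMeasurable_born hV hg n).measurable.comp measurable_swap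

theorem yukawa_eq_exp_mul_newton (k : ℝ) (z : E3) :
    yukawa k z = Real.exp (-(k * ‖z‖)) * newton z := by
  rw [yukawa, newton, div_eq_mul_inv]

/-- A delay by |x - y| multiplies the Laplace transform by e^{-k|x-y|}, which turns the Newtonian
kernel into the Yukawa kernel. The finite majorant at x justifies Fubini. -/
theorem bornLaplace_succ (hV : Measurable V) (hg : Measurable g) (hk : 0 < k) (n : ℕ) {x : E3}
    (hx : majorant V g (n + 1) x ≠ ⊤) :
    bornLaplace V g k (n + 1) x
      = -∫ y, ((V y * yukawa k (x - y) : ℝ) : ℂ) * bornLaplace V g k n y := by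
  let F : ℝ → E3 → ℂ := fun t y => (Real.exp (-(k * t)) : ℂ)
    * (((V y * newton (x - y) : ℝ) : ℂ) * born V g n (t - ‖x - y‖) y)
  have hsub : Measurable fun y : E3 => x - y := measurable_id.const_sub x
  have hF : Integrable (Function.uncurry F) ((volume : Measure ℝ).prod (volume : Measure E3)) := by
    refine integrable_prod_of_enorm_le (e := laplaceWeight k)
      (b := fun y => ‖newton (x - y)‖ₑ * (‖V y‖ₑ * majorant V g n y)) ?_
      (measurable_laplaceWeight k).aemeasurable ?_ ?_ ?_ hx
    · refine Measurable.aestronglyMeasurable ?_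
      refine Measurable.mul (by fun_prop) (Measurable.mul ?_ ?_)
      · exact Complex.measurable_ofReal.comp ((hV.mul (measurable_newton.comp hsub)).comp measurable_snd)
      · exact (stronglyMeasurable_born hV hg n).measurable.comp
          ((measurable_fst.sub (hsub.norm.comp measurable_snd)).prodMk measurable_snd)
    · exact ((measurable_newton.comp hsub).enorm.mul
        (hV.enorm.mul (measurable_majorant hV hg n))).aemeasurable
    · rintro ⟨t, y⟩
      have h1 := enorm_exp_mul_born_le (V := V) (g := g) (k := k) n t (t - ‖x - y‖)
        (by linarith [norm_nonneg (x - y)]) y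
      calc ‖F t y‖ₑ = ‖newton (x - y)‖ₑ * (‖V y‖ₑ
            * ‖(Real.exp (-(k * t)) : ℂ) * born V g n (t - ‖x - y‖) y‖ₑ) := by
            simp only [F, Complex.ofReal_mul, enorm_mul, enorm_ofReal]
            ring
        _ ≤ ‖newton (x - y)‖ₑ * (‖V y‖ₑ * (laplaceWeight k t * majorant V g n y)) :=
            mul_le_mul_right (mul_le_mul_right h1 _) _
        _ = _ := by ring
    · rw [lintegral_laplaceWeight hk]
      exact ENNReal.ofReal_ne_top
  have hshift : ∀ y, ∫ t : ℝ, (Real.exp (-(k * t)) : ℂ) * born V g n (t - ‖x - y‖) y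
      = (Real.exp (-(k * ‖x - y‖)) : ℂ) * bornLaplace V g k n y := fun y => by
    rw [bornLaplace, ← integral_const_mul]
    refine Eq.trans ?_ (integral_sub_right_eq_self (fun s : ℝ => (Real.exp (-(k * ‖x - y‖)) : ℂ)
      * ((Real.exp (-(k * s)) : ℂ) * born V g n s y)) ‖x - y‖)
    congr 1 with t
    rw [← mul_assoc, ← Complex.ofReal_mul, ← Real.exp_add]
    ring_nf
  calc bornLaplace V g k (n + 1) x = -∫ t : ℝ, ∫ y, F t y := by
        rw [bornLaplace, ← integral_neg]
        congr 1 with t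
        rw [born, mul_neg, ← integral_const_mul]
    _ = -∫ y, ∫ t : ℝ, F t y := by rw [integral_integral_swap hF]
    _ = _ := by
        congr 2 with y
        rw [yukawa_eq_exp_mul_newton]
        simp only [F, mul_left_comm _ ((V y * newton (x - y) : ℝ) : ℂ)]
        rw [integral_const_mul, hshift]
        push_cast
        ring

/-- The integral is ∫₀^r t e^{-kt} dt, and `primitiveProfile` is its antiderivative up to the factor
4π; the ramp is thus the time profile behind the gradient form of the Yukawa potential. -/
theorem integral_exp_mul_ramp (hk : 0 < k) {r : ℝ} (hr : 0 ≤ r) :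
    ∫ t : ℝ, Real.exp (-(k * t)) * ramp t r = 4 * Real.pi * primitiveProfile k r := by
  have e : ∀ t, Real.exp (-(k * t)) * ramp t r
      = (Set.Ioo 0 r).indicator (fun t => t * Real.exp (-(k * t))) t := fun t => by
    by_cases h : t ∈ Set.Ioo 0 r
    · rw [Set.indicator_of_mem h, ramp, if_pos ⟨h.1, h.2⟩, mul_comm]
    · rw [Set.indicator_of_notMem h, ramp, if_neg fun h' => h ⟨h'.1, h'.2⟩, mul_zero]
  simp only [e]
  rw [integral_indicator measurableSet_Ioo, ← integral_Ioc_eq_integral_Ioo,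
    ← intervalIntegral.integral_of_le hr]
  have h := intervalIntegral.integral_eq_sub_of_hasDerivAt (a := 0) (b := r)
    (f := fun r => 4 * Real.pi * primitiveProfile k r) (f' := fun t => t * Real.exp (-(k * t)))
    (fun t _ => ((hasDerivAt_primitiveProfile hk t).const_mul (4 * Real.pi)).congr_deriv
      (by field_simp)) (Continuous.intervalIntegrable (by fun_prop) _ _)
  rw [h]
  simp [primitiveProfile]

/-- Together with `HasWeakGradient.ae_yukawa_eq` this identifies the transform of the first Born
term with the Yukawa potential of f when g = ∇f. -/
theorem bornLaplace_zero (hg : Measurable g) (hk : 0 < k) {x : E3}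
    (hx : majorant V g 0 x ≠ ⊤) :
    bornLaplace V g k 0 x
      = -∫ y, (inner ℂ (cplx (radialField (primitiveProfile k) (y - x))) (g y) : ℂ) := by
  let F : ℝ → E3 → ℂ := fun t y => (Real.exp (-(k * t)) : ℂ) * ((ramp t ‖y - x‖ : ℂ)
      * inner ℂ (cplx (radialField (fun _ => (4 * Real.pi)⁻¹) (y - x))) (g y))
  have hsub : Measurable fun y : E3 => y - x := measurable_id.sub_const x
  have hF : Integrable (Function.uncurry F) ((volume : Measure ℝ).prod (volume : Measure E3)) := by
    refine integrable_prod_of_enorm_le (e := laplaceWeight k)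
      (b := fun y => ‖newton (x - y)‖ₑ * ‖g y‖ₑ) ?_
      (measurable_laplaceWeight k).aemeasurable ?_ ?_ ?_ hx
    · refine Measurable.aestronglyMeasurable ?_
      refine Measurable.mul (by fun_prop) (Measurable.mul ?_
        (Measurable.inner ?_ (hg.comp measurable_snd)))
      · exact Complex.measurable_ofReal.comp (measurable_ramp.comp
          (measurable_fst.prodMk (hsub.norm.comp measurable_snd)))
      · exact continuous_cplx.measurable.comp ((measurable_radialField measurable_const).comp
          (hsub.comp measurable_snd))
    · exact ((measurable_newton.comp (measurable_id.const_sub x)).enorm.mul hg.enorm).aemeasurable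
    · rintro ⟨t, y⟩
      rcases le_or_gt t 0 with h | h
      · simp [F, ramp_of_nonpos h]
      · simp only [Function.uncurry_apply_pair, F]
        rw [laplaceWeight, Set.indicator_of_mem (show t ∈ Set.Ioi 0 from h), enorm_mul,
          enorm_ofReal]
        exact mul_le_mul_right (enorm_born_zero_integrand_le t x y) _
    · rw [lintegral_laplaceWeight hk]
      exact ENNReal.ofReal_ne_top
  calc bornLaplace V g k 0 x = -∫ t : ℝ, ∫ y, F t y := by
        rw [bornLaplace, ← integral_neg]
        congr 1 with t
        rw [born, mul_neg, ← integral_const_mul]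
    _ = -∫ y, ∫ t : ℝ, F t y := by rw [integral_integral_swap hF]
    _ = _ := by
        congr 2 with y
        have e1 : ∫ t : ℝ, F t y = ((4 * Real.pi * primitiveProfile k ‖y - x‖ : ℝ) : ℂ)
            * inner ℂ (cplx (radialField (fun _ => (4 * Real.pi)⁻¹) (y - x))) (g y) := by
          rw [← integral_exp_mul_ramp hk (norm_nonneg _), ← integral_complex_ofReal,
            ← integral_mul_const]
          congr 1 with t
          simp only [F]
          push_cast
          ring
        rw [e1, inner_cplx, inner_cplx, Finset.mul_sum]
        refine Finset.sum_congr rfl fun i _ => ?_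
        rw [← mul_assoc, ← Complex.ofReal_mul]
        congr 2
        simp only [radialField, PiLp.smul_apply, smul_eq_mul]
        field_simp

end Born

/-! ### The Born series of the resolvent equation in a weighted L¹ norm. -/

section Perturbation

open Set Metric Filter Topology

/-- The integral operator `w ↦ (-Δ + k²)⁻¹ (V w)`. -/
def perturb (V : E3 → ℝ) (k : ℝ) (w : E3 → ℂ) (x : E3) : ℂ :=
  ∫ y, ((V y * yukawa k (x - y) : ℝ) : ℂ) * w y

/-- An exponential weight. -/
def expWeight (k : ℝ) (y : E3) : ℝ≥0∞ := ‖Real.exp (-(k * ‖y‖))‖ₑ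

variable {V : E3 → ℝ} {g : E3 → C3} {κ k : ℝ}

theorem measurable_expWeight (k : ℝ) : Measurable (expWeight k) := by
  unfold expWeight
  fun_prop

theorem measurable_yukawa_sub (k : ℝ) : Measurable fun p : E3 × E3 => yukawa k (p.1 - p.2) :=
  (measurable_yukawa k).comp (measurable_fst.sub measurable_snd)

theorem expWeight_le_one (hk : 0 < k) (y : E3) : expWeight k y ≤ 1 := by
  rw [expWeight, ← ofReal_norm, Real.norm_of_nonneg (Real.exp_pos _).le, ENNReal.ofReal_le_one,
    Real.exp_le_one_iff]
  have := mul_nonneg hk.le (norm_nonneg y)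
  linarith

/-- By the triangle inequality e^{-k|x|} e^{-k|x-y|} ≤ e^{-k|y|}: the exponential decay of the
kernel is spent on transporting the weight, and the Newtonian kernel remains, so the contraction
constant is still κ. -/
theorem expWeight_mul_yukawa_le (hk : 0 < k) (x y : E3) :
    expWeight k x * ‖yukawa k (x - y)‖ₑ ≤ ‖newton (x - y)‖ₑ * expWeight k y := by
  rw [expWeight, expWeight, ← enorm_mul, ← enorm_mul, enorm_le_iff_norm_le,
    yukawa_eq_exp_mul_newton, Real.norm_of_nonneg (by have := newton_nonneg (x - y); positivity),
    Real.norm_of_nonneg (by have := newton_nonneg (x - y); positivity), ← mul_assoc,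
    ← Real.exp_add, mul_comm]
  refine mul_le_mul_of_nonneg_left (Real.exp_le_exp.2 ?_) (newton_nonneg _)
  have h1 : ‖y‖ ≤ ‖x‖ + ‖x - y‖ := by
    have e : x - (x - y) = y := by abel
    have := norm_sub_le x (x - y)
    rwa [e] at this
  nlinarith

theorem KatoBound.lintegral_expWeight_yukawa_le (hV : KatoBound V κ) (hk : 0 < k) (y : E3) :
    ∫⁻ x, (‖V x‖ₑ * expWeight k x) * ‖yukawa k (x - y)‖ₑ ≤ ENNReal.ofReal κ * expWeight k y := by
  have hm : Measurable fun x => ‖V x‖ₑ * ‖newton (x - y)‖ₑ :=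
    hV.meas.enorm.mul (measurable_newton.comp (measurable_id.sub_const y)).enorm
  calc ∫⁻ x, (‖V x‖ₑ * expWeight k x) * ‖yukawa k (x - y)‖ₑ
      ≤ ∫⁻ x, (‖V x‖ₑ * ‖newton (x - y)‖ₑ) * expWeight k y := by
        refine lintegral_mono fun x => ?_
        rw [mul_assoc, mul_assoc]
        exact mul_le_mul_right (expWeight_mul_yukawa_le hk x y) _
    _ = (∫⁻ x, ‖V x‖ₑ * ‖newton (x - y)‖ₑ) * expWeight k y := lintegral_mul_const _ hm
    _ ≤ _ := mul_le_mul_left (hV.lintegral_newton_le y) _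

/-- Where h is nonzero the weight e^{-k|x|} is at least e^{-kρ}, so it can be inserted at the price
of e^{kρ} and then transported to y. -/
theorem exists_lintegral_yukawa_le (hk : 0 < k) {h : E3 → ℂ} (hh : BoundedSupport h) :
    ∃ K : ℝ, 0 ≤ K ∧
      ∀ y, ∫⁻ x, ‖h x‖ₑ * ‖yukawa k (x - y)‖ₑ ≤ ENNReal.ofReal K * expWeight k y := by
  obtain ⟨K, hK0, hK⟩ := exists_lintegral_newton_le hh
  obtain ⟨M, ρ, hM, hs⟩ := hh.bound
  refine ⟨Real.exp (k * ρ) * K, by positivity, fun y => ?_⟩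
  have hm : AEMeasurable fun x => ‖h x‖ₑ * ‖newton (x - y)‖ₑ :=
    hh.meas.enorm.mul (measurable_newton.comp (measurable_id.sub_const y)).enorm.aemeasurable
  calc ∫⁻ x, ‖h x‖ₑ * ‖yukawa k (x - y)‖ₑ
      ≤ ∫⁻ x, (‖h x‖ₑ * ‖newton (x - y)‖ₑ) * (ENNReal.ofReal (Real.exp (k * ρ)) * expWeight k y) := by
        refine lintegral_mono fun x => ?_
        rcases le_or_gt ρ ‖x‖ with hx | hx
        · simp [hs x hx]
        rw [mul_assoc]
        refine mul_le_mul_right ?_ _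
        have h1 : 1 ≤ ENNReal.ofReal (Real.exp (k * ρ)) * expWeight k x := by
          rw [expWeight, ← ofReal_norm, Real.norm_of_nonneg (Real.exp_pos _).le,
            ← ENNReal.ofReal_mul (Real.exp_pos _).le, ← Real.exp_add, ENNReal.one_le_ofReal,
            Real.one_le_exp_iff]
          nlinarith
        calc ‖yukawa k (x - y)‖ₑ = 1 * ‖yukawa k (x - y)‖ₑ := (one_mul _).symm
          _ ≤ ENNReal.ofReal (Real.exp (k * ρ)) * expWeight k x * ‖yukawa k (x - y)‖ₑ :=
              mul_le_mul_left h1 _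
          _ ≤ ENNReal.ofReal (Real.exp (k * ρ)) * (‖newton (x - y)‖ₑ * expWeight k y) := by
              rw [mul_assoc]
              exact mul_le_mul_right (expWeight_mul_yukawa_le hk x y) _
          _ = _ := by ring
    _ = (∫⁻ x, ‖h x‖ₑ * ‖newton (x - y)‖ₑ) * (ENNReal.ofReal (Real.exp (k * ρ)) * expWeight k y) :=
        lintegral_mul_const'' _ hm
    _ ≤ ENNReal.ofReal K * (ENNReal.ofReal (Real.exp (k * ρ)) * expWeight k y) :=
        mul_le_mul_left (hK y) _
    _ = _ := by rw [ENNReal.ofReal_mul (Real.exp_pos _).le]; ring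

/-- The weighted norm in which the perturbation is a contraction. -/
def perturbNorm (V : E3 → ℝ) (k : ℝ) (w : E3 → ℂ) : ℝ≥0∞ :=
  ∫⁻ y, expWeight k y * (‖V y‖ₑ * ‖w y‖ₑ)

theorem enorm_perturb_integrand (k : ℝ) (w : E3 → ℂ) (x y : E3) :
    ‖((V y * yukawa k (x - y) : ℝ) : ℂ) * w y‖ₑ = ‖yukawa k (x - y)‖ₑ * (‖V y‖ₑ * ‖w y‖ₑ) := by
  rw [enorm_mul, enorm_ofReal, enorm_mul]
  ring

theorem enorm_perturb_le (k : ℝ) (w : E3 → ℂ) (x : E3) :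
    ‖perturb V k w x‖ₑ ≤ ∫⁻ y, ‖yukawa k (x - y)‖ₑ * (‖V y‖ₑ * ‖w y‖ₑ) :=
  (enorm_integral_le_lintegral_enorm _).trans
    (lintegral_mono fun y => (enorm_perturb_integrand k w x y).le)

theorem stronglyMeasurable_perturb_integrand (hV : Measurable V) {w : E3 → ℂ} (hw : Measurable w) :
    Measurable fun p : E3 × E3 => ((V p.2 * yukawa k (p.1 - p.2) : ℝ) : ℂ) * w p.2 :=
  (Complex.measurable_ofReal.comp ((hV.comp measurable_snd).mul (measurable_yukawa_sub k))).mul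
    (hw.comp measurable_snd)

theorem measurable_perturb (hV : Measurable V) {w : E3 → ℂ} (hw : Measurable w) :
    Measurable (perturb V k w) :=
  (StronglyMeasurable.integral_prod_right
    (stronglyMeasurable_perturb_integrand hV hw).stronglyMeasurable).measurable

theorem KatoBound.perturbNorm_perturb_le (hV : KatoBound V κ) (hk : 0 < k) {w : E3 → ℂ}
    (hw : Measurable w) :
    perturbNorm V k (perturb V k w) ≤ ENNReal.ofReal κ * perturbNorm V k w := by
  calc perturbNorm V k (perturb V k w)
      ≤ ∫⁻ x, (‖V x‖ₑ * expWeight k x) * ∫⁻ y, ‖yukawa k (x - y)‖ₑ * (‖V y‖ₑ * ‖w y‖ₑ) := by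
        refine lintegral_mono fun x => ?_
        rw [mul_comm ‖V x‖ₑ (expWeight k x), mul_assoc]
        exact mul_le_mul_right (mul_le_mul_right (enorm_perturb_le k w x) _) _
    _ ≤ ∫⁻ y, (ENNReal.ofReal κ * expWeight k y) * (‖V y‖ₑ * ‖w y‖ₑ) :=
        lintegral_mul_kernel_le (hV.meas.enorm.mul (measurable_expWeight k)).aemeasurable
          (hV.meas.enorm.mul hw.enorm) (measurable_yukawa_sub k).enorm
          (hV.lintegral_expWeight_yukawa_le hk)
    _ = _ := by
        simp only [mul_assoc]
        exact lintegral_const_mul _ ((measurable_expWeight k).mul (hV.meas.enorm.mul hw.enorm))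

theorem lintegral_mul_perturb_le (hV : Measurable V) {w h : E3 → ℂ} (hw : Measurable w)
    (hh : BoundedSupport h) {K : ℝ}
    (hK : ∀ y, ∫⁻ x, ‖h x‖ₑ * ‖yukawa k (x - y)‖ₑ ≤ ENNReal.ofReal K * expWeight k y) :
    ∫⁻ x, ‖h x‖ₑ * ∫⁻ y, ‖yukawa k (x - y)‖ₑ * (‖V y‖ₑ * ‖w y‖ₑ)
      ≤ ENNReal.ofReal K * perturbNorm V k w := by
  refine (lintegral_mul_kernel_le (N := fun x y => ‖yukawa k (x - y)‖ₑ) hh.meas.enorm (hV.enorm.mul hw.enorm)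
    (measurable_yukawa_sub k).enorm hK).trans (le_of_eq ?_)
  simp only [mul_assoc]
  exact lintegral_const_mul _ ((measurable_expWeight k).mul (hV.enorm.mul hw.enorm))

theorem boundedSupport_indicator_ball (ρ : ℝ) :
    BoundedSupport ((ball (0 : E3) ρ).indicator fun _ => (1 : ℂ)) where
  meas := (stronglyMeasurable_const.indicator measurableSet_ball).aestronglyMeasurable
  bound := ⟨1, ρ, fun x => (norm_indicator_le_norm_self _ _).trans (by simp), fun x hx =>
    indicator_of_notMem (by simpa using hx) _⟩

theorem setLIntegral_ball_perturb_lt_top (hV : Measurable V) (hk : 0 < k) {w : E3 → ℂ}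
    (hw : Measurable w) (hJ : perturbNorm V k w ≠ ⊤) (ρ : ℝ) :
    ∫⁻ x in ball (0 : E3) ρ, ∫⁻ y, ‖yukawa k (x - y)‖ₑ * (‖V y‖ₑ * ‖w y‖ₑ) < ⊤ := by
  obtain ⟨K, -, hK⟩ := exists_lintegral_yukawa_le hk (boundedSupport_indicator_ball ρ)
  have h1 := lintegral_mul_perturb_le hV hw (boundedSupport_indicator_ball ρ) hK
  refine lt_of_le_of_lt (le_trans (le_of_eq ?_) h1)
    (ENNReal.mul_lt_top ENNReal.ofReal_lt_top hJ.lt_top)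
  rw [← lintegral_indicator measurableSet_ball]
  refine lintegral_congr fun x => ?_
  by_cases hx : x ∈ ball (0 : E3) ρ
  · simp [indicator_of_mem hx]
  · simp [indicator_of_notMem hx]

theorem ae_integrable_perturb (hV : Measurable V) (hk : 0 < k) {w : E3 → ℂ} (hw : Measurable w)
    (hJ : perturbNorm V k w ≠ ⊤) :
    ∀ᵐ x, Integrable fun y => ((V y * yukawa k (x - y) : ℝ) : ℂ) * w y := by
  have hm : Measurable fun x => ∫⁻ y, ‖yukawa k (x - y)‖ₑ * (‖V y‖ₑ * ‖w y‖ₑ) :=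
    Measurable.lintegral_prod_right ((measurable_yukawa_sub k).enorm.mul
      ((hV.enorm.mul hw.enorm).comp measurable_snd))
  have h1 : ∀ n : ℕ, ∀ᵐ x, x ∈ ball (0 : E3) n →
      ∫⁻ y, ‖yukawa k (x - y)‖ₑ * (‖V y‖ₑ * ‖w y‖ₑ) < ⊤ := fun n =>
    (ae_restrict_iff' measurableSet_ball).1
      (ae_lt_top hm (setLIntegral_ball_perturb_lt_top hV hk hw hJ n).ne)
  filter_upwards [ae_all_iff.2 h1] with x hx
  obtain ⟨n, hn⟩ := exists_nat_gt ‖x‖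
  refine ⟨((stronglyMeasurable_perturb_integrand hV hw).comp
    measurable_prodMk_left).aestronglyMeasurable, ?_⟩
  rw [HasFiniteIntegral, lintegral_congr (enorm_perturb_integrand k w x)]
  exact hx n (by simpa using hn)

theorem locallyIntegrable_perturb (hV : Measurable V) (hk : 0 < k) {w : E3 → ℂ} (hw : Measurable w)
    (hJ : perturbNorm V k w ≠ ⊤) : LocallyIntegrable (perturb V k w) := by
  refine locallyIntegrable_iff.2 fun S hS => ?_
  obtain ⟨ρ, hρ⟩ := hS.isBounded.subset_ball (0 : E3)
  refine IntegrableOn.mono_set ⟨(measurable_perturb hV hw).aestronglyMeasurable, ?_⟩ hρ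
  exact (lintegral_mono fun x => enorm_perturb_le k w x).trans_lt
    (setLIntegral_ball_perturb_lt_top hV hk hw hJ ρ)

theorem perturb_congr {w w' : E3 → ℂ} (h : w =ᵐ[volume] w') : perturb V k w = perturb V k w' := by
  ext x
  refine integral_congr_ae ?_
  filter_upwards [h] with y hy
  rw [hy]

theorem measurable_bornLaplace (hV : Measurable V) (hg : Measurable g) (n : ℕ) :
    Measurable (bornLaplace V g k n) := (stronglyMeasurable_bornLaplace hV hg n).measurable

theorem KatoBound.perturbNorm_bornLaplace_ne_top (hV : KatoBound V κ) (hk : 0 < k)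
    (hg : Measurable g) (hg' : ∫⁻ y, ‖g y‖ₑ ≠ ⊤) (n : ℕ) :
    perturbNorm V k (bornLaplace V g k n) ≠ ⊤ := by
  refine ne_top_of_le_ne_top ?_ (b := ENNReal.ofReal k⁻¹ * (ENNReal.ofReal (κ ^ (n + 1)) * ∫⁻ y, ‖g y‖ₑ)) ?_
  · exact ENNReal.mul_ne_top ENNReal.ofReal_ne_top (ENNReal.mul_ne_top ENNReal.ofReal_ne_top hg')
  · calc perturbNorm V k (bornLaplace V g k n)
        ≤ ∫⁻ y, ENNReal.ofReal k⁻¹ * (‖V y‖ₑ * majorant V g n y) := by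
          refine lintegral_mono fun y => ?_
          calc expWeight k y * (‖V y‖ₑ * ‖bornLaplace V g k n y‖ₑ)
              ≤ 1 * (‖V y‖ₑ * (ENNReal.ofReal k⁻¹ * majorant V g n y)) :=
                mul_le_mul' (expWeight_le_one hk y)
                  (mul_le_mul_right (enorm_bornLaplace_le hk n y) _)
            _ = _ := by ring
      _ = ENNReal.ofReal k⁻¹ * ∫⁻ y, ‖V y‖ₑ * majorant V g n y :=
          lintegral_const_mul _ (hV.meas.enorm.mul (measurable_majorant hV.meas hg n))
      _ ≤ _ := mul_le_mul_right (hV.lintegral_majorant_le hg n) _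

theorem KatoBound.ae_majorant_ne_top (hV : KatoBound V κ) (hg : Measurable g)
    (hg' : ∫⁻ y, ‖g y‖ₑ ≠ ⊤) (n : ℕ) : ∀ᵐ x, majorant V g n x ≠ ⊤ := by
  have h1 : ∀ m : ℕ, ∀ᵐ x, x ∈ ball (0 : E3) m → majorant V g n x < ⊤ := fun m => by
    refine (ae_restrict_iff' measurableSet_ball).1 (ae_lt_top (measurable_majorant hV.meas hg n) ?_)
    have hb := boundedSupport_indicator_ball (m : ℝ)
    obtain ⟨K, -, hK⟩ := exists_lintegral_newton_le hb
    refine ne_top_of_le_ne_top (ENNReal.mul_ne_top ENNReal.ofReal_ne_top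
      (ENNReal.mul_ne_top ENNReal.ofReal_ne_top hg'))
      (le_trans (le_of_eq ?_) (hV.lintegral_mul_majorant_le hg hb hK n))
    rw [← lintegral_indicator measurableSet_ball]
    refine lintegral_congr fun x => ?_
    by_cases hx : x ∈ ball (0 : E3) m
    · simp [indicator_of_mem hx]
    · simp [indicator_of_notMem hx]
  filter_upwards [ae_all_iff.2 h1] with x hx
  obtain ⟨m, hm⟩ := exists_nat_gt ‖x‖
  exact (hx m (by simpa using hm)).ne

theorem KatoBound.ae_bornLaplace_succ (hV : KatoBound V κ) (hk : 0 < k) (hg : Measurable g)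
    (hg' : ∫⁻ y, ‖g y‖ₑ ≠ ⊤) (n : ℕ) :
    ∀ᵐ x, bornLaplace V g k (n + 1) x = -perturb V k (bornLaplace V g k n) x := by
  filter_upwards [hV.ae_majorant_ne_top hg hg' (n + 1)] with x hx
  exact bornLaplace_succ hV.meas hg hk n hx

/-- The remainder of the Born series. -/
def bornRemainder (V : E3 → ℝ) (k : ℝ) (v : E3 → ℂ) : ℕ → E3 → ℂ
  | 0 => v
  | n + 1 => fun x => -perturb V k (bornRemainder V k v n) x

theorem measurable_bornRemainder (hV : Measurable V) {v : E3 → ℂ} (hv : Measurable v) (n : ℕ) :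
    Measurable (bornRemainder V k v n) := by
  induction n with
  | zero => exact hv
  | succ n ih => exact (measurable_perturb hV ih).neg

theorem KatoBound.perturbNorm_bornRemainder_le (hV : KatoBound V κ) (hk : 0 < k) {v : E3 → ℂ}
    (hv : Measurable v) (n : ℕ) :
    perturbNorm V k (bornRemainder V k v n) ≤ ENNReal.ofReal (κ ^ n) * perturbNorm V k v := by
  induction n with
  | zero => simp [bornRemainder]
  | succ n ih =>
    have h1 : perturbNorm V k (bornRemainder V k v (n + 1))
        = perturbNorm V k (perturb V k (bornRemainder V k v n)) := by
      simp [perturbNorm, bornRemainder]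
    rw [h1, pow_succ', ENNReal.ofReal_mul hV.pos.le, mul_assoc]
    exact (hV.perturbNorm_perturb_le hk (measurable_bornRemainder hV.meas hv n)).trans
      (mul_le_mul_right ih _)

/-- The expansion at stage m is inserted into the right side of v = b₀ - G(Vv); the operator raises
the index of every term and of the remainder by one. Finiteness of the weighted norms allows the
integral to be split almost everywhere. -/
theorem KatoBound.ae_eq_sum_add_bornRemainder (hV : KatoBound V κ) (hk : 0 < k) (hg : Measurable g)
    (hg' : ∫⁻ y, ‖g y‖ₑ ≠ ⊤) {v : E3 → ℂ} (hv : Measurable v) (hJ : perturbNorm V k v ≠ ⊤)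
    (heq : ∀ᵐ x, v x = bornLaplace V g k 0 x - perturb V k v x) (m : ℕ) :
    ∀ᵐ x, v x = ∑ n ∈ Finset.range m, bornLaplace V g k n x + bornRemainder V k v m x := by
  induction m with
  | zero => simp [bornRemainder]
  | succ m ih =>
    have h1 : ∀ᵐ x, ∀ n, Integrable fun y =>
        ((V y * yukawa k (x - y) : ℝ) : ℂ) * bornLaplace V g k n y :=
      ae_all_iff.2 fun n => ae_integrable_perturb hV.meas hk (measurable_bornLaplace hV.meas hg n)
        (hV.perturbNorm_bornLaplace_ne_top hk hg hg' n)
    have h2 : ∀ᵐ x, Integrable fun y =>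
        ((V y * yukawa k (x - y) : ℝ) : ℂ) * bornRemainder V k v m y :=
      ae_integrable_perturb hV.meas hk (measurable_bornRemainder hV.meas hv m)
        (ne_top_of_le_ne_top (ENNReal.mul_ne_top ENNReal.ofReal_ne_top hJ)
          (hV.perturbNorm_bornRemainder_le hk hv m))
    have h3 := ae_all_iff.2 fun n => hV.ae_bornLaplace_succ hk hg hg' n
    filter_upwards [heq, h1, h2, h3] with x hx h1 h2 h3
    have e : perturb V k v x = ∑ n ∈ Finset.range m, perturb V k (bornLaplace V g k n) x
        + perturb V k (bornRemainder V k v m) x := by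
      rw [perturb_congr ih]
      simp only [perturb, mul_add, Finset.mul_sum]
      rw [integral_add (integrable_finsetSum _ fun n _ => h1 n) h2,
        integral_finsetSum _ fun n _ => h1 n]
    rw [hx, e, Finset.sum_range_succ', bornRemainder]
    simp only [h3, Finset.sum_neg_distrib]
    ring

theorem BoundedSupport.integrable_conj_mul {h w : E3 → ℂ} (hh : BoundedSupport h)
    (hw : AEStronglyMeasurable w) (hi : ∫⁻ x, ‖h x‖ₑ * ‖w x‖ₑ ≠ ⊤) :
    Integrable fun x => conj (h x) * w x := by
  refine ⟨(Complex.continuous_conj.comp_aestronglyMeasurable hh.meas).mul hw, ?_⟩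
  simp only [HasFiniteIntegral, enorm_mul, RCLike.enorm_conj]
  exact hi.lt_top

theorem KatoBound.lintegral_mul_bornLaplace_le (hV : KatoBound V κ) (hk : 0 < k)
    (hg : Measurable g) {h : E3 → ℂ} (hh : BoundedSupport h) {K : ℝ}
    (hK : ∀ y, ∫⁻ x, ‖h x‖ₑ * ‖newton (x - y)‖ₑ ≤ ENNReal.ofReal K) (n : ℕ) :
    ∫⁻ x, ‖h x‖ₑ * ‖bornLaplace V g k n x‖ₑ
      ≤ ENNReal.ofReal k⁻¹ * (ENNReal.ofReal K * (ENNReal.ofReal (κ ^ n) * ∫⁻ y, ‖g y‖ₑ)) := by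
  calc ∫⁻ x, ‖h x‖ₑ * ‖bornLaplace V g k n x‖ₑ
      ≤ ∫⁻ x, ENNReal.ofReal k⁻¹ * (‖h x‖ₑ * majorant V g n x) := by
        refine lintegral_mono fun x => ?_
        rw [mul_left_comm]
        exact mul_le_mul_right (enorm_bornLaplace_le hk n x) _
    _ = ENNReal.ofReal k⁻¹ * ∫⁻ x, ‖h x‖ₑ * majorant V g n x :=
        lintegral_const_mul' _ _ ENNReal.ofReal_ne_top
    _ ≤ _ := mul_le_mul_right (hV.lintegral_mul_majorant_le hg hh hK n) _

/-- One application of the operator is spent on passing from `perturbNorm` to integrability against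
h; hence κ^n for the remainder of index n + 1. -/
theorem KatoBound.lintegral_mul_bornRemainder_le (hV : KatoBound V κ) (hk : 0 < k) {v : E3 → ℂ}
    (hv : Measurable v) {h : E3 → ℂ} (hh : BoundedSupport h) {K : ℝ}
    (hK : ∀ y, ∫⁻ x, ‖h x‖ₑ * ‖yukawa k (x - y)‖ₑ ≤ ENNReal.ofReal K * expWeight k y) (n : ℕ) :
    ∫⁻ x, ‖h x‖ₑ * ‖bornRemainder V k v (n + 1) x‖ₑ
      ≤ ENNReal.ofReal K * (ENNReal.ofReal (κ ^ n) * perturbNorm V k v) := by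
  refine le_trans (lintegral_mono fun x => mul_le_mul_right ?_ _)
    ((lintegral_mul_perturb_le hV.meas (measurable_bornRemainder hV.meas hv n) hh hK).trans
      (mul_le_mul_right (hV.perturbNorm_bornRemainder_le hk hv n) _))
  simp only [bornRemainder, enorm_neg]
  exact enorm_perturb_le _ _ _

/-- The Born series of the resolvent equation. -/
theorem KatoBound.hasSum_integral_bornLaplace (hV : KatoBound V κ) (hκ : κ < 1) (hk : 0 < k)
    (hg : Measurable g) (hg' : ∫⁻ y, ‖g y‖ₑ ≠ ⊤) {v : E3 → ℂ} (hv : Measurable v)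
    (hJ : perturbNorm V k v ≠ ⊤)
    (heq : ∀ᵐ x, v x = bornLaplace V g k 0 x - perturb V k v x) {h : E3 → ℂ}
    (hh : BoundedSupport h) :
    HasSum (fun n => ∫ x, conj (h x) * bornLaplace V g k n x) (∫ x, conj (h x) * v x) := by
  have hκ0 := hV.pos.le
  obtain ⟨K, hK0, hK⟩ := exists_lintegral_newton_le hh
  obtain ⟨K', hK0', hK'⟩ := exists_lintegral_yukawa_le hk hh
  have hb := hV.lintegral_mul_bornLaplace_le hk hg hh hK
  have hr := hV.lintegral_mul_bornRemainder_le hk hv hh hK'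
  have hbi : ∀ n, Integrable fun x => conj (h x) * bornLaplace V g k n x := fun n =>
    hh.integrable_conj_mul (measurable_bornLaplace hV.meas hg n).aestronglyMeasurable
      (ne_top_of_le_ne_top (by finiteness) (hb n))
  have hri : ∀ n, Integrable fun x => conj (h x) * bornRemainder V k v (n + 1) x := fun n =>
    hh.integrable_conj_mul (measurable_bornRemainder hV.meas hv _).aestronglyMeasurable
      (ne_top_of_le_ne_top (by finiteness) (hr n))
  have hnorm : ∀ (w : E3 → ℂ), ‖∫ x, conj (h x) * w x‖ₑ ≤ ∫⁻ x, ‖h x‖ₑ * ‖w x‖ₑ := fun w => by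
    refine (enorm_integral_le_lintegral_enorm _).trans (le_of_eq ?_)
    simp only [enorm_mul, RCLike.enorm_conj]
  have hgeo : Tendsto (fun n : ℕ => κ ^ n) atTop (𝓝 0) := tendsto_pow_atTop_nhds_zero_of_lt_one hκ0 hκ
  have hsummable : Summable fun n => ∫ x, conj (h x) * bornLaplace V g k n x := by
    refine Summable.of_norm_bounded (g := fun n => (k⁻¹ * K * (∫⁻ y, ‖g y‖ₑ).toReal) * κ ^ n)
      ((summable_geometric_of_lt_one hκ0 hκ).mul_left _) fun n => ?_
    rw [← ENNReal.ofReal_le_ofReal_iff (by positivity), ofReal_norm]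
    refine ((hnorm _).trans (hb n)).trans (le_of_eq ?_)
    nth_rewrite 1 [← ENNReal.ofReal_toReal hg']
    rw [← ENNReal.ofReal_mul (by positivity), ← ENNReal.ofReal_mul (by positivity),
      ← ENNReal.ofReal_mul (by positivity)]
    congr 1
    ring
  -- The partial sums are shifted by one because the remainder bound starts at index 1.
  rw [hsummable.hasSum_iff_tendsto_nat, ← tendsto_add_atTop_iff_nat 1, tendsto_iff_norm_sub_tendsto_zero]
  have hdiff : ∀ m, ‖∑ n ∈ Finset.range (m + 1), (∫ x, conj (h x) * bornLaplace V g k n x)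
      - ∫ x, conj (h x) * v x‖ ≤ K' * (perturbNorm V k v).toReal * κ ^ m := fun m => by
    have e : ∫ x, conj (h x) * v x
        = ∑ n ∈ Finset.range (m + 1), (∫ x, conj (h x) * bornLaplace V g k n x)
          + ∫ x, conj (h x) * bornRemainder V k v (m + 1) x := by
      rw [← integral_finsetSum _ fun n _ => hbi n,
        ← integral_add (integrable_finsetSum _ fun n _ => hbi n) (hri m)]
      refine integral_congr_ae ?_
      filter_upwards [hV.ae_eq_sum_add_bornRemainder hk hg hg' hv hJ heq (m + 1)] with x hx
      rw [hx, mul_add, Finset.mul_sum]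
    rw [e, sub_add_cancel_left, norm_neg, ← ENNReal.ofReal_le_ofReal_iff (by positivity), ofReal_norm]
    refine ((hnorm _).trans (hr m)).trans (le_of_eq ?_)
    nth_rewrite 1 [← ENNReal.ofReal_toReal hJ]
    rw [← ENNReal.ofReal_mul (by positivity), ← ENNReal.ofReal_mul (by positivity)]
    congr 1
    ring
  refine squeeze_zero (fun _ => norm_nonneg _) hdiff ?_
  simpa using hgeo.const_mul (K' * (perturbNorm V k v).toReal)

end Perturbation

/-! ### Summation of the Born series in time, after pairing with a test function. -/

section BornPairing

open Set Filter Topology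

variable {V : E3 → ℝ} {g : E3 → C3} {κ k : ℝ} {h : E3 → ℂ}

/-- The pairing of a term of the Born series with a test function. -/
def bornPairing (V : E3 → ℝ) (g : E3 → C3) (h : E3 → ℂ) (n : ℕ) (t : ℝ) : ℂ :=
  ∫ x, conj (h x) * born V g n t x

/-- The constant of the dispersive estimate, as a series in `κ`. -/
def dispersiveConst (κ : ℝ) : ℝ := ∑' n : ℕ, (4 * Real.pi)⁻¹ * ((n + 1) * κ ^ n)

theorem summable_dispersiveConst (hκ0 : 0 < κ) (hκ : κ < 1) :
    Summable fun n : ℕ => (4 * Real.pi)⁻¹ * ((n + 1) * κ ^ n) := by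
  refine Summable.mul_left _ ?_
  have h1 := summable_pow_mul_geometric_of_norm_lt_one 1 (r := κ) (by
    rwa [Real.norm_of_nonneg hκ0.le])
  have h2 := summable_geometric_of_lt_one hκ0.le hκ
  refine (h1.add h2).congr fun n => ?_
  simp only [pow_one]
  ring

theorem dispersiveConst_pos (hκ0 : 0 < κ) (hκ : κ < 1) : 0 < dispersiveConst κ :=
  (summable_dispersiveConst hκ0 hκ).tsum_pos (fun n => by positivity) 0 (by simp; positivity)

theorem enorm_integral_conj_mul_le (h w : E3 → ℂ) :
    ‖∫ x, conj (h x) * w x‖ₑ ≤ ∫⁻ x, ‖h x‖ₑ * ‖w x‖ₑ := by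
  refine (enorm_integral_le_lintegral_enorm _).trans (le_of_eq ?_)
  simp only [enorm_mul, RCLike.enorm_conj]

/-- A bound uniform in t, without decay: it makes the series converge and lets the Laplace transform
be taken term by term. The decay is kept separately in `KatoBound.mul_norm_bornPairing_le`. -/
theorem KatoBound.norm_bornPairing_le (hV : KatoBound V κ) (hg : Measurable g)
    (hg' : ∫⁻ y, ‖g y‖ₑ ≠ ⊤) (hh : BoundedSupport h) {K : ℝ} (hK0 : 0 ≤ K)
    (hK : ∀ y, ∫⁻ x, ‖h x‖ₑ * ‖newton (x - y)‖ₑ ≤ ENNReal.ofReal K) (n : ℕ) (t : ℝ) :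
    ‖bornPairing V g h n t‖ ≤ K * (∫⁻ y, ‖g y‖ₑ).toReal * κ ^ n := by
  have hκ0 := hV.pos.le
  rw [← ENNReal.ofReal_le_ofReal_iff (by positivity), ofReal_norm]
  refine (enorm_integral_conj_mul_le _ _).trans (((lintegral_mono fun x => mul_le_mul_right
    (enorm_born_le n t x) _).trans (hV.lintegral_mul_majorant_le hg hh hK n)).trans (le_of_eq ?_))
  nth_rewrite 1 [← ENNReal.ofReal_toReal hg']
  rw [← ENNReal.ofReal_mul (by positivity), ← ENNReal.ofReal_mul (by positivity)]
  congr 1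
  ring

theorem KatoBound.mul_norm_bornPairing_le (hV : KatoBound V κ) (hg : Measurable g)
    (hg' : ∫⁻ y, ‖g y‖ₑ ≠ ⊤) (hh : ∫⁻ x, ‖h x‖ₑ ≠ ⊤) (n : ℕ) {t : ℝ} (ht : 0 ≤ t) :
    t * ‖bornPairing V g h n t‖ ≤ (∫⁻ x, ‖h x‖ₑ).toReal * (∫⁻ y, ‖g y‖ₑ).toReal
      * ((4 * Real.pi)⁻¹ * ((n + 1) * κ ^ n)) := by
  have hκ0 := hV.pos.le
  rw [← ENNReal.ofReal_le_ofReal_iff (by positivity), ENNReal.ofReal_mul ht, ofReal_norm]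
  calc ENNReal.ofReal t * ‖bornPairing V g h n t‖ₑ
      ≤ ENNReal.ofReal t * ∫⁻ x, ‖h x‖ₑ * ‖born V g n t x‖ₑ :=
        mul_le_mul_right (enorm_integral_conj_mul_le _ _) _
    _ = ∫⁻ x, ENNReal.ofReal t * (‖h x‖ₑ * ‖born V g n t x‖ₑ) :=
        (lintegral_const_mul' _ _ ENNReal.ofReal_ne_top).symm
    _ ≤ ∫⁻ x, ‖h x‖ₑ * (ENNReal.ofReal ((4 * Real.pi)⁻¹ * ((n + 1) * κ ^ n)) * ∫⁻ y, ‖g y‖ₑ) := by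
        refine lintegral_mono fun x => ?_
        rw [mul_left_comm]
        exact mul_le_mul_right (mul_enorm_born_le hV hg n t x) _
    _ = (∫⁻ x, ‖h x‖ₑ)
          * (ENNReal.ofReal ((4 * Real.pi)⁻¹ * ((n + 1) * κ ^ n)) * ∫⁻ y, ‖g y‖ₑ) :=
        lintegral_mul_const' _ _ (by finiteness)
    _ = _ := by
        nth_rewrite 1 [← ENNReal.ofReal_toReal hg', ← ENNReal.ofReal_toReal hh]
        rw [← ENNReal.ofReal_mul (by positivity), ← ENNReal.ofReal_mul (by positivity)]
        congr 1
        ring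

theorem stronglyMeasurable_bornPairing (hV : Measurable V) (hg : Measurable g) (hh : Measurable h)
    (n : ℕ) : StronglyMeasurable (bornPairing V g h n) := by
  refine StronglyMeasurable.integral_prod_right (f := fun (t : ℝ) (x : E3) =>
    conj (h x) * born V g n t x) (Measurable.stronglyMeasurable ?_)
  exact ((Complex.continuous_conj.measurable.comp hh).comp measurable_snd).mul
    (stronglyMeasurable_born hV hg n).measurable

theorem KatoBound.integral_exp_mul_bornPairing (hV : KatoBound V κ) (hk : 0 < k)
    (hg : Measurable g) (hg' : ∫⁻ y, ‖g y‖ₑ ≠ ⊤) (hh : BoundedSupport h) (hm : Measurable h) (n : ℕ) :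
    ∫ t in Ioi (0 : ℝ), (Real.exp (-(k * t)) : ℂ) * bornPairing V g h n t
      = ∫ x, conj (h x) * bornLaplace V g k n x := by
  obtain ⟨K, hK0, hK⟩ := exists_lintegral_newton_le hh
  let F : ℝ → E3 → ℂ := fun t x => conj (h x) * ((Real.exp (-(k * t)) : ℂ) * born V g n t x)
  have hF : Integrable (Function.uncurry F) ((volume : Measure ℝ).prod (volume : Measure E3)) := by
    refine integrable_prod_of_enorm_le (e := laplaceWeight k)
      (b := fun x => ‖h x‖ₑ * majorant V g n x) ?_ (measurable_laplaceWeight k).aemeasurable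
      (hm.enorm.mul (measurable_majorant hV.meas hg n)).aemeasurable ?_ ?_
      (ne_top_of_le_ne_top (by finiteness) (hV.lintegral_mul_majorant_le hg hh hK n))
    · refine Measurable.aestronglyMeasurable ?_
      exact ((Complex.continuous_conj.measurable.comp hm).comp measurable_snd).mul
        (Measurable.mul (by fun_prop) (stronglyMeasurable_born hV.meas hg n).measurable)
    · rintro ⟨t, x⟩
      simp only [Function.uncurry_apply_pair, F]
      rw [enorm_mul, RCLike.enorm_conj, mul_left_comm]
      exact mul_le_mul_right (enorm_exp_mul_born_le n t t le_rfl x) _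
    · rw [lintegral_laplaceWeight hk]
      exact ENNReal.ofReal_ne_top
  calc ∫ t in Ioi (0 : ℝ), (Real.exp (-(k * t)) : ℂ) * bornPairing V g h n t
      = ∫ t : ℝ, (Real.exp (-(k * t)) : ℂ) * bornPairing V g h n t := by
        refine setIntegral_eq_integral_of_forall_compl_eq_zero fun t ht => ?_
        simp [bornPairing, born_of_nonpos n (not_lt.1 ht)]
    _ = ∫ t : ℝ, ∫ x, F t x := by
        congr 1 with t
        rw [bornPairing, ← integral_const_mul]
        congr 1 with x
        simp only [F]
        ring
    _ = ∫ x, ∫ t : ℝ, F t x := integral_integral_swap hF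
    _ = _ := by
        congr 1 with x
        simp only [F]
        rw [integral_const_mul, bornLaplace]

theorem integrableOn_exp_mul {k : ℝ} (hk : 0 < k) {B : ℝ} {a : ℝ → ℂ}
    (ha : AEStronglyMeasurable a) (hB : ∀ t, ‖a t‖ ≤ B) :
    IntegrableOn (fun t => (Real.exp (-(k * t)) : ℂ) * a t) (Ioi 0) ∧
      ∫ t in Ioi (0 : ℝ), ‖(Real.exp (-(k * t)) : ℂ) * a t‖ ≤ k⁻¹ * B := by
  have hi : IntegrableOn (fun t : ℝ => Real.exp (-(k * t)) * B) (Ioi 0) := by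
    have := (exp_neg_integrableOn_Ioi 0 hk).mul_const B
    simpa [IntegrableOn] using this
  have hb : ∀ t, ‖(Real.exp (-(k * t)) : ℂ) * a t‖ ≤ Real.exp (-(k * t)) * B := fun t => by
    rw [norm_mul, Complex.norm_real, Real.norm_of_nonneg (Real.exp_pos _).le]
    exact mul_le_mul_of_nonneg_left (hB t) (Real.exp_pos _).le
  have h1 : IntegrableOn (fun t => (Real.exp (-(k * t)) : ℂ) * a t) (Ioi 0) := by
    refine hi.mono' (AEStronglyMeasurable.restrict ?_) (Eventually.of_forall hb)
    exact (Continuous.aestronglyMeasurable (by fun_prop)).mul ha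
  refine ⟨h1, ?_⟩
  have h2 : ∫ t in Ioi (0 : ℝ), Real.exp (-(k * t)) = k⁻¹ := by
    simpa [one_div] using integral_exp_mul_Ioi (neg_lt_zero.2 hk) 0
  calc _ ≤ ∫ t in Ioi (0 : ℝ), Real.exp (-(k * t)) * B := integral_mono h1.norm hi hb
    _ = k⁻¹ * B := by rw [integral_mul_const, h2]

/-- The sum of the Born series, its Laplace transform and its decay. -/
theorem KatoBound.exists_bornSum (hV : KatoBound V κ) (hκ : κ < 1)
    (hg : Measurable g) (hg' : ∫⁻ y, ‖g y‖ₑ ≠ ⊤) (hh : BoundedSupport h) (hm : Measurable h)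
    (hh' : ∫⁻ x, ‖h x‖ₑ ≠ ⊤) :
    ∃ (a : ℝ → ℂ) (B : ℝ), AEStronglyMeasurable a ∧ (∀ t, ‖a t‖ ≤ B) ∧
      (∀ t, 0 ≤ t → t * ‖a t‖
        ≤ (∫⁻ x, ‖h x‖ₑ).toReal * (∫⁻ y, ‖g y‖ₑ).toReal * dispersiveConst κ) ∧
      ∀ k, 0 < k → HasSum (fun n => ∫ x, conj (h x) * bornLaplace V g k n x)
        (∫ t in Ioi (0 : ℝ), (Real.exp (-(k * t)) : ℂ) * a t) := by
  have hκ0 := hV.pos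
  obtain ⟨K, hK0, hK⟩ := exists_lintegral_newton_le hh
  set c := K * (∫⁻ y, ‖g y‖ₑ).toReal with hc
  have hc0 : 0 ≤ c := by positivity
  have hb := hV.norm_bornPairing_le hg hg' hh hK0 hK
  have hgeo : Summable fun n : ℕ => c * κ ^ n := (summable_geometric_of_lt_one hκ0.le hκ).mul_left _
  have hsn : ∀ t, Summable fun n => ‖bornPairing V g h n t‖ := fun t =>
    Summable.of_nonneg_of_le (fun n => norm_nonneg _) (fun n => hb n t) hgeo
  have hs : ∀ t, Summable fun n => bornPairing V g h n t := fun t => (hsn t).of_norm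
  have hmeas : ∀ n, AEStronglyMeasurable (bornPairing V g h n) (volume : Measure ℝ) := fun n =>
    (stronglyMeasurable_bornPairing hV.meas hg hm n).aestronglyMeasurable
  refine ⟨fun t => ∑' n, bornPairing V g h n t, ∑' n : ℕ, c * κ ^ n, ?_, fun t => ?_,
    fun t ht => ?_, fun k hk => ?_⟩
  · refine aestronglyMeasurable_of_tendsto_ae atTop
      (f := fun m t => ∑ n ∈ Finset.range m, bornPairing V g h n t) (fun m => ?_)
      (Eventually.of_forall fun t => (hs t).hasSum.tendsto_sum_nat)
    exact Finset.aestronglyMeasurable_fun_sum _ fun n _ => hmeas n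
  · exact tsum_of_norm_bounded hgeo.hasSum fun n => hb n t
  · have h1 := norm_tsum_le_tsum_norm (hsn t)
    refine (mul_le_mul_of_nonneg_left h1 ht).trans ?_
    rw [← tsum_mul_left, dispersiveConst, ← tsum_mul_left]
    exact Summable.tsum_le_tsum (fun n => hV.mul_norm_bornPairing_le hg hg' hh' n ht)
      ((hsn t).mul_left t) ((summable_dispersiveConst hκ0 hκ).mul_left _)
  · have h1 := fun n => integrableOn_exp_mul hk (hmeas n) (hb n)
    have h2 := hasSum_integral_of_summable_integral_norm (fun n => (h1 n).1)
      (Summable.of_nonneg_of_le (fun n => integral_nonneg fun t => norm_nonneg _)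
        (fun n => (h1 n).2) (hgeo.mul_left k⁻¹))
    simp only [hV.integral_exp_mul_bornPairing hk hg hg' hh hm, tsum_mul_left] at h2
    exact h2

end BornPairing

/-! ### The integral form of the resolvent equation. -/

section ResolventEquation

open Set Metric Filter Topology

variable {V : E3 → ℝ} {g : E3 → C3} {κ k : ℝ} {h : E3 → ℂ}

theorem expWeight_le (hk : 0 < k) (x : E3) : expWeight k x ≤ ENNReal.ofReal k⁻¹ * ‖x‖ₑ⁻¹ := by
  rcases eq_or_ne x 0 with rfl | hx
  · simp [hk]
  · have h0 := norm_pos_iff.2 hx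
    rw [expWeight, ← ofReal_norm, ← ofReal_norm, Real.norm_of_nonneg (Real.exp_pos _).le,
      ← ENNReal.ofReal_inv_of_pos h0, ← ENNReal.ofReal_mul (by positivity)]
    refine ENNReal.ofReal_le_ofReal ?_
    have := mul_exp_neg_le (s := k * ‖x‖)
    rw [← mul_inv, ← one_div, le_div_iff₀ (by positivity)]
    linarith

/-- Since e^{-k|x|} ≤ (k|x|)⁻¹, the Kato bound at y = 0 makes |V| e^{-k|x|} integrable. With a =
e^{-k|x|} ≤ 1 and b = |v|, the inequality ab ≤ a + b² reduces the claim to this and to integrability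
of |V||v|². -/
theorem KatoBound.perturbNorm_ne_top (hV : KatoBound V κ) (hk : 0 < k) {v : E3 → ℂ}
    (hi : Integrable fun x => |V x| * ‖v x‖ ^ 2) : perturbNorm V k v ≠ ⊤ := by
  have h1 : ∫⁻ x, ‖V x‖ₑ * expWeight k x ≠ ⊤ := by
    refine ne_top_of_le_ne_top (b := ENNReal.ofReal k⁻¹ * ENNReal.ofReal (4 * Real.pi * κ))
      (by finiteness) ?_
    calc ∫⁻ x, ‖V x‖ₑ * expWeight k x
        ≤ ∫⁻ x, ENNReal.ofReal k⁻¹ * (‖V x‖ₑ / ‖x - 0‖ₑ) := by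
          refine lintegral_mono fun x => ?_
          rw [sub_zero, div_eq_mul_inv, mul_left_comm]
          exact mul_le_mul_right (expWeight_le hk x) _
      _ = ENNReal.ofReal k⁻¹ * ∫⁻ x, ‖V x‖ₑ / ‖x - 0‖ₑ :=
          lintegral_const_mul' _ _ ENNReal.ofReal_ne_top
      _ ≤ _ := mul_le_mul_right (hV.le 0) _
  have h2 : ∫⁻ x, ‖V x‖ₑ * ‖v x‖ₑ ^ 2 ≠ ⊤ := by
    refine ne_of_lt (lt_of_le_of_lt (le_of_eq ?_) hi.2)
    refine lintegral_congr fun x => ?_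
    rw [enorm_mul, enorm_pow, enorm_norm, Real.enorm_abs]
  refine ne_top_of_le_ne_top (ENNReal.add_ne_top.2 ⟨h1, h2⟩) ?_
  have hm : Measurable fun x => ‖V x‖ₑ * expWeight k x :=
    hV.meas.enorm.mul (measurable_expWeight k)
  rw [← lintegral_add_left hm]
  refine lintegral_mono fun x => ?_
  have h3 : expWeight k x * ‖v x‖ₑ ≤ expWeight k x + ‖v x‖ₑ ^ 2 := by
    rcases le_total ‖v x‖ₑ 1 with h | h
    · exact (mul_le_of_le_one_right' h).trans le_self_add
    · refine le_trans ?_ le_add_self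
      rw [sq]
      exact mul_le_mul_left ((expWeight_le_one hk x).trans h) _
  calc expWeight k x * (‖V x‖ₑ * ‖v x‖ₑ) = ‖V x‖ₑ * (expWeight k x * ‖v x‖ₑ) := by ring
    _ ≤ ‖V x‖ₑ * (expWeight k x + ‖v x‖ₑ ^ 2) := mul_le_mul_right h3 _
    _ = _ := mul_add _ _ _

theorem conj_yukawaPot (k : ℝ) (h : E3 → ℂ) (y : E3) :
    conj (yukawaPot k h y) = ∫ x, conj (h x) * (yukawa k (y - x) : ℂ) := by
  rw [yukawaPot, ← integral_conj]
  simp only [map_mul, Complex.conj_ofReal]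

theorem BoundedSupport.conj (hh : BoundedSupport h) : BoundedSupport fun x => conj (h x) where
  meas := Complex.continuous_conj.comp_aestronglyMeasurable hh.meas
  bound := by
    obtain ⟨M, ρ, hM, hρ⟩ := hh.bound
    exact ⟨M, ρ, by simpa using hM, fun x hx => by simp [hρ x hx]⟩

theorem norm_yukawa_mul_le (hk : 0 < k) (f : E3 → ℂ) (p : E3 × E3) :
    ‖(yukawa k (p.2 - p.1) : ℂ) * f p.2‖ ≤ k⁻¹ * ((‖p.2 - p.1‖ ^ 2)⁻¹ * ‖(fun y => ‖f y‖) p.2‖) := by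
  rw [norm_mul, norm_norm, ← mul_assoc]
  exact mul_le_mul_of_nonneg_right (norm_ofReal_yukawa_le hk _) (norm_nonneg _)

theorem aestronglyMeasurable_yukawa_mul {f : E3 → ℂ} (hf : AEStronglyMeasurable f) (k : ℝ) :
    AEStronglyMeasurable (fun p : E3 × E3 => (yukawa k (p.2 - p.1) : ℂ) * f p.2)
      (volume.prod volume) :=
  (Complex.measurable_ofReal.comp ((measurable_yukawa k).comp
    (measurable_snd.sub measurable_fst))).aestronglyMeasurable.mul hf.comp_snd

theorem locallyIntegrable_integral_yukawa (hk : 0 < k) (f : L2) :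
    LocallyIntegrable fun x => ∫ y, (yukawa k (y - x) : ℂ) * f y :=
  locallyIntegrable_potential (w := fun y => ‖f y‖) (C := k⁻¹)
    (aestronglyMeasurable_yukawa_mul (Lp.aestronglyMeasurable f) k)
    (Lp.aestronglyMeasurable f).norm
    (by simpa using integrable_decay_mul_of_memLp (Lp.memLp f)) (norm_yukawa_mul_le hk f)

theorem BoundedSupport.integral_conj_yukawaPot_mul (hh : BoundedSupport h) (hk : 0 < k) (f : L2) :
    ∫ y, conj (yukawaPot k h y) * f y
      = ∫ x, conj (h x) * ∫ y, (yukawa k (y - x) : ℂ) * f y := by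
  obtain ⟨M, ρ, hM, hρ⟩ := hh.conj.bound
  refine Eq.trans ?_ (integral_mul_potential (w := fun y => ‖f y‖) (C := k⁻¹)
    (aestronglyMeasurable_yukawa_mul (Lp.aestronglyMeasurable f) k)
    (Lp.aestronglyMeasurable f).norm
    (by simpa using integrable_decay_mul_of_memLp (Lp.memLp f)) (norm_yukawa_mul_le hk f)
    hh.conj.meas hM hρ).symm
  congr 1 with y
  rw [conj_yukawaPot, ← integral_mul_const]
  simp only [mul_assoc]

/-- Fubini and the symmetry of the kernel move the Yukawa operator from h onto V v; absolute
convergence is the finiteness of `perturbNorm`. -/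
theorem BoundedSupport.integral_potential_mul (hh : BoundedSupport h) (hV : Measurable V)
    (hk : 0 < k) {v : E3 → ℂ} (hv : Measurable v) (hJ : perturbNorm V k v ≠ ⊤) :
    ∫ y, (V y : ℂ) * (conj (yukawaPot k h y) * v y) = ∫ x, conj (h x) * perturb V k v x := by
  obtain ⟨K, -, hK⟩ := exists_lintegral_yukawa_le hk hh
  let F : E3 → E3 → ℂ := fun x y => conj (h x) * (((V y * yukawa k (x - y) : ℝ) : ℂ) * v y)
  have hF : Integrable (Function.uncurry F) ((volume : Measure E3).prod volume) := by
    have hm : AEStronglyMeasurable (Function.uncurry F) ((volume : Measure E3).prod volume) :=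
      hh.conj.meas.comp_fst.mul (stronglyMeasurable_perturb_integrand hV hv).aestronglyMeasurable
    refine ⟨hm, ?_⟩
    rw [HasFiniteIntegral, lintegral_prod _ hm.enorm]
    refine lt_of_le_of_lt (le_trans (le_of_eq ?_) (lintegral_mul_perturb_le hV hv hh hK))
      (by finiteness)
    refine lintegral_congr fun x => ?_
    rw [← lintegral_const_mul' _ _ enorm_ne_top]
    refine lintegral_congr fun y => ?_
    simp only [Function.uncurry_apply_pair, F]
    rw [enorm_mul, RCLike.enorm_conj, enorm_perturb_integrand]
  calc ∫ y, (V y : ℂ) * (conj (yukawaPot k h y) * v y) = ∫ y, ∫ x, F x y := by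
        congr 1 with y
        rw [conj_yukawaPot, ← integral_mul_const, ← integral_const_mul]
        congr 1 with x
        simp only [F]
        rw [yukawa_sub_comm]
        push_cast
        ring
    _ = ∫ x, ∫ y, F x y := (integral_integral_swap hF).symm
    _ = _ := by
        congr 1 with x
        simp only [F]
        rw [integral_const_mul, perturb]

/-- The resolvent equation in integral form. -/
theorem KatoBound.ae_resolvent_eq (hV : KatoBound V κ) (hk : 0 < k) {v f : L2}
    (hvf : (v, f - (k ^ 2 : ℝ) • v) ∈ schrodingerGraph V) :
    perturbNorm V k v ≠ ⊤ ∧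
      ∀ᵐ x, v x = (∫ y, (yukawa k (y - x) : ℂ) * f y) - perturb V k v x := by
  obtain ⟨G, hG, hq⟩ := hvf
  have hvm : Measurable v := (Lp.stronglyMeasurable v).measurable
  have hJ := hV.perturbNorm_ne_top hk (hV.integral_le hG.grad (Lp.memLp _) (Lp.memLp _)).1
  refine ⟨hJ, ?_⟩
  have hl1 := Lp.locallyIntegrable_two v
  have hl2 := locallyIntegrable_integral_yukawa hk f
  have hl3 := locallyIntegrable_perturb hV.meas hk hvm hJ
  have key : ∀ᵐ x, v x - ((∫ y, (yukawa k (y - x) : ℂ) * f y) - perturb V k v x) = 0 := by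
    refine ae_eq_zero_of_integral_contDiff_smul_eq_zero (hl1.sub (hl2.sub hl3)) fun φ hφ hc => ?_
    obtain ⟨M, ρ, hM, hρ⟩ := exists_bound_of_hasCompactSupport hφ.continuous hc
    let h : E3 → ℂ := fun x => (φ x : ℂ)
    have hh : BoundedSupport h :=
      ⟨(Complex.continuous_ofReal.comp hφ.continuous).aestronglyMeasurable, M, ρ,
        by simpa [h] using hM, fun x hx => by simp [h, hρ x hx]⟩
    have hconj : ∀ x, conj (h x) = h x := fun x => Complex.conj_ofReal _
    have hp := hh.memLp_pot hk
    have hK := hh.memLp_potGrad hk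
    -- The Yukawa potential of a test function lies in H¹ and is admissible in the weak form of Hv =
    -- f - k²v. Subtracting the weak form of (-Δ + k²)(G * h) = h eliminates the gradient and mass
    -- terms.
    have hdom : InFormDomain V (hp.toLp _) (hK.toLp _) := hV.inFormDomain
      ((hh.hasWeakGradient_pot hk).congr hp.coeFn_toLp.symm hK.coeFn_toLp.symm)
    have h1 := hq _ _ hdom
    have h2 := hh.integral_conj_mul hk hG.grad (integrable_decay_mul_of_memLp (Lp.memLp v))
      (integrable_decay_mul_of_memLp (Lp.memLp G))
    have e1 : (inner ℂ (hK.toLp _) G : ℂ) = ∫ y, (inner ℂ (yukawaPotGrad k h y) (G y) : ℂ) := by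
      rw [L2.inner_def]
      refine integral_congr_ae ?_
      filter_upwards [hK.coeFn_toLp] with y hy
      rw [hy]
    have e2 : ∀ w : L2, (inner ℂ (hp.toLp _) w : ℂ) = ∫ y, conj (yukawaPot k h y) * w y := fun w => by
      rw [L2.inner_def]
      refine integral_congr_ae ?_
      filter_upwards [hp.coeFn_toLp] with y hy
      rw [hy, RCLike.inner_apply, mul_comm]
    have e3 : ∫ y, (V y : ℂ) * (conj (hp.toLp _ y) * v y)
        = ∫ y, (V y : ℂ) * (conj (yukawaPot k h y) * v y) := by
      refine integral_congr_ae ?_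
      filter_upwards [hp.coeFn_toLp] with y hy
      rw [hy]
    have e4 : (inner ℂ (hp.toLp _) (f - (k ^ 2 : ℝ) • v) : ℂ)
        = inner ℂ (hp.toLp _) f - (k : ℂ) ^ 2 * inner ℂ (hp.toLp _) v := by
      rw [inner_sub_right, inner_smul_right_eq_smul, Complex.real_smul, Complex.ofReal_pow]
    simp only at h1
    rw [e1, e3, e4, e2, e2, hh.integral_conj_yukawaPot_mul hk,
      hh.integral_potential_mul hV.meas hk hvm hJ] at h1
    simp only [hconj] at h1 h2
    have i1 : Integrable fun x => φ x • v x := hl1.integrable_smul_left_of_hasCompactSupport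
      hφ.continuous hc
    have i2 : Integrable fun x => φ x • ∫ y, (yukawa k (y - x) : ℂ) * f y :=
      hl2.integrable_smul_left_of_hasCompactSupport hφ.continuous hc
    have i3 : Integrable fun x => φ x • perturb V k v x :=
      hl3.integrable_smul_left_of_hasCompactSupport hφ.continuous hc
    have i23 : Integrable fun x => φ x • (∫ y, (yukawa k (y - x) : ℂ) * f y)
        - φ x • perturb V k v x := i2.sub i3
    simp only [smul_sub]
    rw [integral_sub i1 i23, integral_sub i2 i3]
    simp only [Complex.real_smul]
    linear_combination h2 + h1
  filter_upwards [key] with x hx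
  exact sub_eq_zero.1 hx

end ResolventEquation

/-! ### The dispersive estimate: identification in time, duality, null sets. -/

section Dispersive

open Set Metric Filter Topology

variable {V : E3 → ℝ} {g : E3 → C3} {κ k : ℝ} {h : E3 → ℂ}

theorem BoundedSupport.memLp (hh : BoundedSupport h) (p : ℝ≥0∞) :
    MemLp h p (volume : Measure E3) := by
  obtain ⟨M, ρ, hM, hρ⟩ := hh.bound
  refine (memLp_indicator_const p (measurableSet_ball (x := (0 : E3)) (ε := ρ)) M
    (Or.inr measure_ball_lt_top.ne)).mono' hh.meas (Eventually.of_forall fun x => ?_)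
  by_cases hx : x ∈ ball (0 : E3) ρ
  · rw [indicator_of_mem hx]
    exact hM x
  · rw [indicator_of_notMem hx, hρ x (by simpa using hx), norm_zero]

/-- The dispersive estimate, tested against bounded functions with bounded support. -/
theorem KatoBound.norm_integral_sine_le (hV : KatoBound V κ) (hκ : κ < 1) {R : L2 →L[ℂ] L2}
    (hR : IsResolventOf (schrodingerGraph V) R) {f : L2} (hfg : HasWeakGradient f g)
    (hg : Measurable g) (hg' : ∫⁻ y, ‖g y‖ₑ ≠ ⊤) (hh : BoundedSupport h) (hm : Measurable h)
    {t : ℝ} (ht : 0 < t) :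
    ‖∫ x, conj (h x) * (sineOperator R t f : L2) x‖
      ≤ dispersiveConst κ * t⁻¹ * (∫⁻ y, ‖g y‖ₑ).toReal * (∫⁻ x, ‖h x‖ₑ).toReal := by
  have hh1 : ∫⁻ x, ‖h x‖ₑ ≠ ⊤ := by
    rw [← eLpNorm_one_eq_lintegral_enorm]
    exact (hh.memLp 1).eLpNorm_ne_top
  have hgi : Integrable g := ⟨hg.aestronglyMeasurable, hg'.lt_top⟩
  have hh2 := hh.memLp 2
  have hinner : ∀ w : L2, (inner ℂ (hh2.toLp h) w : ℂ) = ∫ x, conj (h x) * w x := fun w => by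
    rw [L2.inner_def]
    refine integral_congr_ae ?_
    filter_upwards [hh2.coeFn_toLp] with y hy
    rw [hy, RCLike.inner_apply, mul_comm]
  obtain ⟨a, B, ham, haB, hat, hal⟩ := hV.exists_bornSum hκ hg hg' hh hm hh1
  let D : ℝ → ℂ := fun t => inner ℂ (hh2.toLp h) (sineOperator R t f)
  have hDc : Continuous D := by
    have h1 : Continuous fun t => sineOperator R t f :=
      hR.continuous_sineOperator.clm_apply continuous_const
    exact continuous_const.inner h1
  have hDle : ∀ t, 0 < t → ‖D t‖ ≤ t * (‖hh2.toLp h‖ * ‖f‖) := fun t ht => by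
    have h1 := (sineOperator R t).le_of_opNorm_le (hR.norm_sineOperator_le t) f
    rw [abs_of_pos ht] at h1
    refine (norm_inner_le_norm _ _).trans ((mul_le_mul_of_nonneg_left h1 (norm_nonneg _)).trans ?_)
    exact le_of_eq (by ring)
  have hDi : ∀ k : ℝ, 0 < k → IntegrableOn (fun t => (Real.exp (-(k * t)) : ℂ) * D t) (Ioi 0) := by
    intro k hk
    refine ((integrableOn_mul_exp hk).mul_const (‖hh2.toLp h‖ * ‖f‖)).mono'
      (Continuous.aestronglyMeasurable (by fun_prop)) ?_
    refine (ae_restrict_iff' measurableSet_Ioi).2 (Eventually.of_forall fun t ht => ?_)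
    rw [norm_mul, Complex.norm_real, Real.norm_of_nonneg (Real.exp_pos _).le]
    refine (mul_le_mul_of_nonneg_left (hDle t ht) (Real.exp_pos _).le).trans (le_of_eq ?_)
    ring
  have hai : ∀ k : ℝ, 0 < k → IntegrableOn (fun t => (Real.exp (-(k * t)) : ℂ) * a t) (Ioi 0) :=
    fun k hk => (integrableOn_exp_mul hk ham haB).1
  -- Both transforms equal ⟨h, v⟩ with v = (H + k²)⁻¹ f: that of `D` by the functional calculus,
  -- that of `a` because v is the sum of the Born series starting from the Yukawa potential of f.
  have hlap : ∀ k : ℝ, 1 ≤ k → ∫ t in Ioi (0 : ℝ), (Real.exp (-(k * t)) : ℂ) * (D t - a t) = 0 := by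
    intro k hk1
    have hk : 0 < k := one_pos.trans_le hk1
    obtain ⟨v, hv, hvl⟩ := hR.exists_laplace hk1 f
    obtain ⟨hJ, heq⟩ := hV.ae_resolvent_eq hk hv
    have hz : ∀ᵐ x, bornLaplace V g k 0 x = ∫ y, (yukawa k (y - x) : ℂ) * f y := by
      filter_upwards [hV.ae_majorant_ne_top hg hg' 0, hfg.ae_yukawa_eq hk
        (integrable_decay_mul_of_memLp (Lp.memLp f)) (integrable_decay_mul_of_integrable hgi)]
        with x hx hx'
      rw [bornLaplace_zero hg hk hx, hx']
    have heq' : ∀ᵐ x, v x = bornLaplace V g k 0 x - perturb V k v x := by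
      filter_upwards [heq, hz] with x h1 h2
      rw [h1, h2]
    have h1 := (hV.hasSum_integral_bornLaplace hκ hk hg hg' (Lp.stronglyMeasurable v).measurable
      hJ heq' hh).unique (hal k hk)
    simp only [mul_sub]
    rw [integral_sub (hDi k hk) (hai k hk), ← h1, ← hinner, ← hvl, sub_self]
  -- Taking k = n + 1, one factor e^{-t} is kept in the function to make it integrable, and the
  -- remaining e^{-nt} are the moments.
  have hae := ae_eq_zero_of_forall_integral_exp_pow
    (H := fun t => (Real.exp (-(1 * t)) : ℂ) * (D t - a t)) (by
      simp only [mul_sub]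
      exact (hDi 1 one_pos).sub (hai 1 one_pos)) fun n => by
      rw [← hlap (n + 1) (by linarith [n.cast_nonneg (α := ℝ)])]
      congr 1 with t
      rw [← mul_assoc, ← Complex.ofReal_mul, ← Real.exp_nat_mul, ← Real.exp_add]
      ring_nf
  set A := (∫⁻ x, ‖h x‖ₑ).toReal * (∫⁻ y, ‖g y‖ₑ).toReal * dispersiveConst κ with hA
  have hbound : ∀ᵐ s : ℝ, s ∈ Ioi (0 : ℝ) → s * ‖D s‖ ≤ A := by
    filter_upwards [hae] with s hs hs0
    have h1 := (mul_eq_zero.1 (hs hs0)).resolve_left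
      (Complex.ofReal_ne_zero.2 (Real.exp_pos _).ne')
    rw [sub_eq_zero.1 h1]
    exact hat s (le_of_lt hs0)
  -- `D` is continuous, so the set of positive times violating the bound is open; being null, it is
  -- empty.
  have hall : t * ‖D t‖ ≤ A := by
    by_contra hlt
    have hopen : IsOpen {s : ℝ | 0 < s ∧ A < s * ‖D s‖} :=
      (isOpen_lt continuous_const continuous_id).inter
        (isOpen_lt continuous_const (continuous_id.mul hDc.norm))
    refine (hopen.measure_pos volume ⟨t, ht, not_le.1 hlt⟩).ne' ?_
    refine measure_mono_null (fun s hs => ?_) hbound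
    exact fun hs' => not_le.2 hs.2 (hs' hs.1)
  rw [← hinner]
  change ‖D t‖ ≤ _
  have h2 : ‖D t‖ ≤ t⁻¹ * A := by
    rw [← div_eq_inv_mul, le_div_iff₀ ht, mul_comm]
    exact hall
  refine h2.trans (le_of_eq ?_)
  rw [hA]
  ring

/-- Converse Hölder inequality: with h the phase w/|w| on a bounded set S, the hypothesis becomes
∫_S |w| ≤ B |S|. The phase is set to 1 where w vanishes, so that ∫ |h| is exactly |S|. -/
theorem ae_norm_le_of_forall_integral_le {w : E3 → ℂ} (hw : Measurable w) (hl : LocallyIntegrable w)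
    {B : ℝ} (hB : ∀ h : E3 → ℂ, BoundedSupport h → Measurable h →
      ‖∫ x, conj (h x) * w x‖ ≤ B * (∫⁻ x, ‖h x‖ₑ).toReal) : ∀ᵐ x, ‖w x‖ ≤ B := by
  have h1 : ∀ n : ℕ, ∀ᵐ x, x ∈ ball (0 : E3) n → ‖w x‖ ≤ B := fun n => by
    refine (ae_restrict_iff' measurableSet_ball).1 ?_
    have hwi : IntegrableOn w (ball (0 : E3) n) :=
      (hl.integrableOn_isCompact (isCompact_closedBall 0 (n : ℝ))).mono_set ball_subset_closedBall
    refine ae_le_of_forall_setIntegral_le (f := fun x => ‖w x‖) (g := fun _ => B)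
      hwi.norm (integrableOn_const measure_ball_lt_top.ne) fun s hs _ => ?_
    rw [Measure.restrict_restrict hs]
    set S := s ∩ ball (0 : E3) n with hS
    have hSm : MeasurableSet S := hs.inter measurableSet_ball
    have hSf : volume S ≠ ⊤ := ne_top_of_le_ne_top measure_ball_lt_top.ne (measure_mono inter_subset_right)
    let h : E3 → ℂ := S.indicator fun x => if w x = 0 then 1 else w x / (‖w x‖ : ℂ)
    have hn : ∀ x, ‖if w x = 0 then (1 : ℂ) else w x / (‖w x‖ : ℂ)‖ = 1 := fun x => by
      split_ifs with h0
      · simp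
      · rw [norm_div, Complex.norm_real, norm_norm, div_self (norm_ne_zero_iff.2 h0)]
    have hm : Measurable h := by
      refine Measurable.indicator (Measurable.ite (hw (measurableSet_singleton 0)) measurable_const ?_) hSm
      exact hw.div (Complex.measurable_ofReal.comp hw.norm)
    have hh : BoundedSupport h := by
      refine ⟨hm.aestronglyMeasurable, 1, n, fun x => ?_, fun x hx => indicator_of_notMem ?_ _⟩
      · exact (norm_indicator_le_norm_self _ _).trans (hn x).le
      · intro hxS
        have := hxS.2
        rw [mem_ball_zero_iff] at this
        linarith
    have e1 : ∫⁻ x, ‖h x‖ₑ = volume S := by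
      rw [← lintegral_indicator_one hSm]
      refine lintegral_congr fun x => ?_
      by_cases hx : x ∈ S
      · simp only [h, indicator_of_mem hx, Pi.one_apply]
        rw [← ofReal_norm, hn, ENNReal.ofReal_one]
      · simp [h, indicator_of_notMem hx]
    have e2 : ∫ x, conj (h x) * w x = ((∫ x in S, ‖w x‖ : ℝ) : ℂ) := by
      rw [← integral_indicator hSm, ← integral_complex_ofReal]
      congr 1 with x
      by_cases hx : x ∈ S
      · simp only [h, indicator_of_mem hx]
        split_ifs with h0
        · simp [h0]
        · have h2 : (‖w x‖ : ℂ) ≠ 0 := Complex.ofReal_ne_zero.2 (norm_ne_zero_iff.2 h0)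
          rw [map_div₀, Complex.conj_ofReal, div_mul_eq_mul_div, Complex.conj_mul', sq,
            mul_div_cancel_right₀ _ h2]
      · simp [h, indicator_of_notMem hx]
    have h2 := hB h hh hm
    rw [e1, e2, Complex.norm_real, Real.norm_of_nonneg (integral_nonneg fun x => norm_nonneg _)] at h2
    rw [setIntegral_const, smul_eq_mul, mul_comm]
    exact h2
  filter_upwards [ae_all_iff.2 h1] with x hx
  obtain ⟨n, hn⟩ := exists_nat_gt ‖x‖
  exact hx n (by simpa using hn)

/-- With the next lemmas this shows that nothing depends on V on null sets, so that V may be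
replaced by a measurable representative, as `KatoBound` requires. -/
theorem katoNorm_congr {V V' : E3 → ℝ} (h : V =ᵐ[volume] V') : katoNorm V = katoNorm V' := by
  unfold katoNorm
  congr 1 with y
  refine lintegral_congr_ae ?_
  filter_upwards [h] with x hx
  rw [hx]

theorem InFormDomain.of_ae_eq {V V' : E3 → ℝ} (h : V =ᵐ[volume] V') {u : L2} {G : L2vec}
    (hu : InFormDomain V u G) : InFormDomain V' u G where
  grad := hu.grad
  pot := hu.pot.congr (by filter_upwards [h] with x hx; rw [hx])

theorem schrodingerGraph_le {V V' : E3 → ℝ} (h : V =ᵐ[volume] V') :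
    schrodingerGraph V ≤ schrodingerGraph V' := by
  rintro p ⟨G, hG, hp⟩
  refine ⟨G, hG.of_ae_eq h, fun φ K hφ => ?_⟩
  rw [← hp φ K (hφ.of_ae_eq h.symm)]
  congr 1
  refine integral_congr_ae ?_
  filter_upwards [h] with x hx
  rw [hx]

theorem schrodinger_congr {V V' : E3 → ℝ} (h : V =ᵐ[volume] V') : schrodinger V = schrodinger V' := by
  rw [schrodinger, schrodinger,
    (schrodingerGraph_le h).antisymm (schrodingerGraph_le h.symm)]

theorem IsResolventOf.sineEvolution_eq {R : L2 →L[ℂ] L2}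
    (hR : IsResolventOf (schrodingerGraph V) R) (t : ℝ) :
    sineEvolution V t = sineOperator R t := by
  rw [sineEvolution, functionOf, schrodinger, hR.shiftedInverse_eq]
  rfl

/-- The dispersive estimate for a measurable potential. -/
theorem KatoBound.eLpNorm_sineEvolution_le (hV : KatoBound V κ) (hκ : κ < 1) {t : ℝ} (ht : 0 < t)
    {f : L2} (hfg : HasWeakGradient f g) :
    eLpNorm (sineEvolution V t f) ⊤ volume
      ≤ ENNReal.ofReal (dispersiveConst κ * t⁻¹) * eLpNorm g 1 volume := by
  have hC := dispersiveConst_pos hV.pos hκ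
  have hCt : 0 < dispersiveConst κ * t⁻¹ := by positivity
  obtain ⟨g', hg'm, hgg'⟩ := hfg.locInt_grad.aestronglyMeasurable
  have hfg' := hfg.congr (Filter.EventuallyEq.refl _ _) hgg'
  rw [eLpNorm_congr_ae hgg', eLpNorm_one_eq_lintegral_enorm]
  -- If the gradient is not integrable the right side is infinite, because the constant in front is
  -- positive.
  by_cases htop : ∫⁻ y, ‖g' y‖ₑ = ⊤
  · rw [htop, ENNReal.mul_top (ENNReal.ofReal_pos.2 hCt).ne']
    exact le_top
  obtain ⟨R, hR⟩ := hV.exists_resolvent hκ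
  rw [hR.sineEvolution_eq, ← ENNReal.ofReal_toReal htop, ← ENNReal.ofReal_mul hCt.le,
    eLpNorm_exponent_top]
  refine eLpNormEssSup_le_of_ae_bound (ae_norm_le_of_forall_integral_le
    (Lp.stronglyMeasurable _).measurable (Lp.locallyIntegrable_two _) fun h hh hm => ?_)
  exact hV.norm_integral_sine_le hκ hR hfg' hg'm.measurable htop hh hm ht

end Dispersive

theorem mainTheorem8 (V : E3 → ℝ) (hV : MemLp V (3 / 2) (volume : Measure E3))
    (hK : katoNorm V < ENNReal.ofReal (4 * Real.pi)) :
    IsSelfAdjoint (schrodinger V) ∧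
    (∀ u : (schrodinger V).domain, 0 ≤ (inner ℂ (u : L2) (schrodinger V u)).re) ∧
    ∃ C : ℝ, 0 < C ∧ ∀ t : ℝ, 0 < t → ∀ (f : L2) (g : E3 → C3), HasWeakGradient f g →
      eLpNorm (sineEvolution V t f) ∞ volume
        ≤ ENNReal.ofReal (C * t⁻¹) * eLpNorm g 1 volume := by
  obtain ⟨V', hm, hVV'⟩ := hV.1
  simp only [sineEvolution]
  rw [schrodinger_congr hVV']
  rw [katoNorm_congr hVV'] at hK
  obtain ⟨κ, hκ, hV'⟩ := exists_katoBound hm.measurable hK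
  obtain ⟨R, hR⟩ := hV'.exists_resolvent hκ
  exact ⟨hR.isSelfAdjoint, hR.re_inner_nonneg, dispersiveConst κ, dispersiveConst_pos hV'.pos hκ,
    fun t ht f g hfg => hV'.eLpNorm_sineEvolution_le hκ ht hfg⟩

end
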